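/- **Setting.** Let $\mathcal M=(\mathcal S,\mathcal A,H,\mathbb P,r)$ be a tabular episodic MDP with $|\mathcal S|=S$, $|\mathcal A|=A$, steps $h\in\{1,\dots,H\}$, transition laws $\mathbb P_h(\cdot\mid s,a)$ and deterministic rewards $r_h(s,a)\in[0,1]$. For a (randomized, Markov) policy $\pi$ let $V_h^\pi(s)=\sum_{h'=h}^H\mathbb E[r_{h'}(s_{h'},a_{h'})\mid s_h=s]$, and put $V_h^\star(s)=\sup_\pi V_h^\pi(s)$, $V_{H+1}^\star=0$, $Q_h^\star(s,a)=r_h(s,a)+\mathbb E_{s'\sim\mathbb P_h(\cdot\mid s,a)}V_{h+1}^\star(s')$, $\Delta_h(s,a)=V_h^\star(s)-Q_h^\star(s,a)$. Assume that some $\Delta_h(s,a)$ is positive, let $\Delta_{\min}$ be the smallest positive $\Delta_h(s,a)$, and let $\mathbb Q^\star=\max_{s,a,h}\operatorname{Var}_{s'\sim\mathbb P_h(\cdot\mid s,a)}\bigl(V_{h+1}^\star(s')\bigr)$. Over $K\ge1$ episodes, $T=HK$, with initial states $s_1^k$ chosen by an adversary (possibly depending on the past and randomized) and policies $\pi^k$,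 let $\mathrm{Regret}(T)=\sum_{k=1}^K\bigl(V_1^\star(s_1^k)-V_1^{\pi^k}(s_1^k)\bigr)$. **Algorithm (refined Q-EarlySettled-Advantage).** Parameters: $\beta\in(0,H]$, $\delta\in(0,1)$, $c_b>0$; put $\iota=\log(SAT/\delta)$ and $\eta_n=\frac{H+1}{H+n}$. Initially, for all $s,a$ and $h\le H$: $Q_h,Q_h^{\mathrm{UCB}},Q_h^{\mathrm R},V_h,V_h^{\mathrm R}=H$; $Q_h^{\mathrm{LCB}},V_h^{\mathrm{LCB}},N_h,\mu_h^{\mathrm{ref}},\sigma_h^{\mathrm{ref}},\mu_h^{\mathrm{adv}},\sigma_h^{\mathrm{adv}},B_h^{\mathrm R}=0$; $u_h=\text{True}$; and $V_{H+1}=V^{\mathrm{LCB}}_{H+1}=V^{\mathrm R}_{H+1}=0$ throughout. Episode $k$ follows the greedy policy $\pi_h^k(s)\in\arg\max_aQ_h(s,a)$ for the table held at its start (ties broken arbitrarily). At step $h=1,\dots,H$, in state $s=s_h^k$, take $a=\pi_h^k(s)$, observe $s'=s_{h+1}^k\sim\mathbb P_h(\cdot\mid s,a)$, increase $N_h(s,a)$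 by one, set $n=N_h(s,a)$, and perform in this order (entries are at $(s,a)$ or $s$ unless shown otherwise): 1. $Q_h^{\mathrm{UCB}}\leftarrow(1-\eta_n)Q_h^{\mathrm{UCB}}+\eta_n\bigl(r_h+V_{h+1}(s')+c_b\sqrt{H^3\iota/n}\bigr)$; 2. $Q_h^{\mathrm{LCB}}\leftarrow(1-\eta_n)Q_h^{\mathrm{LCB}}+\eta_n\bigl(r_h+V^{\mathrm{LCB}}_{h+1}(s')-c_b\sqrt{H^3\iota/n}\bigr)$; 3. $\mu_h^{\mathrm{ref}}\leftarrow(1-\frac1n)\mu_h^{\mathrm{ref}}+\frac1nV^{\mathrm R}_{h+1}(s')$ and $\sigma_h^{\mathrm{ref}}\leftarrow(1-\frac1n)\sigma_h^{\mathrm{ref}}+\frac1nV^{\mathrm R}_{h+1}(s')^2$; with $D=V_{h+1}(s')-V^{\mathrm R}_{h+1}(s')$, $\mu_h^{\mathrm{adv}}\leftarrow(1-\eta_n)\mu_h^{\mathrm{adv}}+\eta_nD$ and $\sigma_h^{\mathrm{adv}}\leftarrow(1-\eta_n)\sigma_h^{\mathrm{adv}}+\eta_nD^2$; 4. $B^{\mathrm{next}}=c_b\sqrt{\iota/n}\bigl(\sqrt{\sigma_h^{\mathrm{ref}}-(\mu_h^{\mathrm{ref}})^2}+\sqrt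 H\sqrt{\sigma_h^{\mathrm{adv}}-(\mu_h^{\mathrm{adv}})^2}\bigr)$, $\delta^{\mathrm R}=B^{\mathrm{next}}-B_h^{\mathrm R}$, $B_h^{\mathrm R}\leftarrow B^{\mathrm{next}}$, $b^{\mathrm R}=B_h^{\mathrm R}+(1-\eta_n)\delta^{\mathrm R}/\eta_n+c_bH^2\iota/n^{3/4}$; 5. $Q_h^{\mathrm R}\leftarrow(1-\eta_n)Q_h^{\mathrm R}+\eta_n\bigl(r_h+D+\mu_h^{\mathrm{ref}}+b^{\mathrm R}\bigr)$; 6. $Q_h\leftarrow\min\{Q_h^{\mathrm R},Q_h^{\mathrm{UCB}},Q_h\}$, $V_h\leftarrow\max_{a'}Q_h(s,a')$, $V_h^{\mathrm{LCB}}\leftarrow\max\{\max_{a'}Q_h^{\mathrm{LCB}}(s,a'),V_h^{\mathrm{LCB}}\}$; 7. if $V_h-V_h^{\mathrm{LCB}}>\beta$, then $V_h^{\mathrm R}\leftarrow V_h$; otherwise, if $u_h$ is True, then $V_h^{\mathrm R}\leftarrow V_h$ and $u_h\leftarrow\text{False}$. **Theorem.** There is a universal constant $c_0>0$ such that for every $c_b\ge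 c_0$ and every $q\in\mathbb N$ there is a constant $C>0$, depending only on $c_b$ and $q$, with the following property. For every MDP as above, every $K\ge1$, every $\beta\in(0,H]$ and every $\delta\in(0,1)$ with $\delta\ge(SAT)^{-q}$, the algorithm satisfies $$\mathbb E[\mathrm{Regret}(T)]\le C\left(\frac{(\mathbb Q^\star+\beta^2H)H^3SA\log(SAT)}{\Delta_{\min}}+\frac{H^7SA\log^2(SAT)}{\beta}\right).$$ In particular, the gap-free term is linear in $S$. Moreover, if $\mathbb Q^\star=0$ and $\beta=H\min\{1,\Delta_{\min}^{1/3}\}$, then $$\mathbb E[\mathrm{Regret}(T)]\le C\,H^6SA\log^2(SAT)\,\max\{1,\Delta_{\min}^{-1/3}\}.$$ -/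

import Mathlib

open MeasureTheory

/-! ### Tabular episodic Markov decision processes -/

/-- A tabular episodic MDP with horizon `H`.  The steps of an episode are `1, …, H`; the entries of
`P` and `r` at other indices play no role.  `P h s a` is the law of the next state and `r h s a` is
the deterministic reward. -/
structure EpisodicMDP (S A : Type*) [Fintype S] where
  /-- number of steps of an episode -/
  H : ℕ
  /-- transition kernel -/
  P : ℕ → S → A → stdSimplex ℝ S
  /-- reward function -/
  r : ℕ → S → A → ℝ
  r_mem : ∀ h ∈ Finset.Icc 1 H, ∀ s a, r h s a ∈ Set.Icc (0 : ℝ) 1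

/-- A (randomized, Markov) policy: a distribution over actions for each step and state. -/
abbrev MDPPolicy (S A : Type*) [Fintype A] := ℕ → S → stdSimplex ℝ A

/-- A deterministic policy, seen as a policy whose distributions are point masses. -/
noncomputable def detPolicy {S A : Type*} [Fintype A] (d : ℕ → S → A) : MDPPolicy S A :=
  open scoped Classical in fun h s => stdSimplex.vertex (d h s)

namespace EpisodicMDP

variable {S A : Type*} [Fintype S] [Fintype A]

/-- `M.stateLaw π h s n y` is the probability that `s_{h+n} = y` when `s_h = s` and the actions
are drawn from `π`. -/
noncomputable def stateLaw (M : EpisodicMDP S A) (π : MDPPolicy S A) (h : ℕ) (s : S) :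
    ℕ → S → ℝ
  | 0 => open scoped Classical in fun y => if y = s then 1 else 0
  | n + 1 => fun y => ∑ x, ∑ a, stateLaw M π h s n x * π (h + n) x a * M.P (h + n) x a y

/-- The value function `V_h^π(s) = ∑_{h' = h}^H 𝔼[r_{h'}(s_{h'}, a_{h'}) | s_h = s]`. -/
noncomputable def value (M : EpisodicMDP S A) (π : MDPPolicy S A) (h : ℕ) (s : S) : ℝ :=
  ∑ h' ∈ Finset.Icc h M.H, ∑ x, ∑ a, M.stateLaw π h s (h' - h) x * π h' x a * M.r h' x a

/-- The optimal value function `V_h^⋆(s) = sup_π V_h^π(s)`. -/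
noncomputable def optValue (M : EpisodicMDP S A) (h : ℕ) (s : S) : ℝ :=
  ⨆ π : MDPPolicy S A, M.value π h s

/-- `ℙ_{s,a,h} f`, the expectation of `f` at the next state. -/
noncomputable def nextMean (M : EpisodicMDP S A) (h : ℕ) (s : S) (a : A) (f : S → ℝ) : ℝ :=
  ∑ y, M.P h s a y * f y

/-- `𝕍_{s,a,h} f`, the variance of `f` at the next state. -/
noncomputable def nextVar (M : EpisodicMDP S A) (h : ℕ) (s : S) (a : A) (f : S → ℝ) : ℝ :=
  M.nextMean h s a (fun y => f y ^ 2) - M.nextMean h s a f ^ 2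

/-- The optimal action value function `Q_h^⋆(s, a) = r_h(s, a) + ℙ_{s,a,h} V_{h+1}^⋆`. -/
noncomputable def optQ (M : EpisodicMDP S A) (h : ℕ) (s : S) (a : A) : ℝ :=
  M.r h s a + M.nextMean h s a (M.optValue (h + 1))

/-- The suboptimality gap `Δ_h(s, a) = V_h^⋆(s) - Q_h^⋆(s, a)`. -/
noncomputable def gap (M : EpisodicMDP S A) (h : ℕ) (s : S) (a : A) : ℝ :=
  M.optValue h s - M.optQ h s a

/-- The set of all positive suboptimality gaps. -/
def positiveGaps (M : EpisodicMDP S A) : Set ℝ :=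
  {g | 0 < g ∧ ∃ h ∈ Finset.Icc 1 M.H, ∃ s a, M.gap h s a = g}

/-- The minimum gap `Δ_min`. -/
noncomputable def minGap (M : EpisodicMDP S A) : ℝ := sInf M.positiveGaps

/-- The maximum conditional variance `max_{s,a,h} 𝕍_{s,a,h}(V_{h+1}^⋆)`. -/
noncomputable def maxCondVar (M : EpisodicMDP S A) : ℝ :=
  sSup {v | ∃ h ∈ Finset.Icc 1 M.H, ∃ s a, M.nextVar h s a (M.optValue (h + 1)) = v}

/-- `Regret(T) = ∑_{k=1}^K (V_1^⋆(s_1^k) - V_1^{π^k}(s_1^k))` for initial states `s_1^k = init k`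
and deterministic policies `π^k = pol k`. -/
noncomputable def regret (M : EpisodicMDP S A) (K : ℕ) (init : ℕ → S) (pol : ℕ → ℕ → S → A) : ℝ :=
  ∑ k ∈ Finset.Icc 1 K, (M.optValue 1 (init k) - M.value (detPolicy (pol k)) 1 (init k))

end EpisodicMDP

/-! ### The refined Q-EarlySettled-Advantage algorithm -/

/-- The parameters of the algorithm: number of episodes `K`, settling parameter `β`, failure
probability `δ`, bonus constant `cb`. -/
structure QESAParams where
  K : ℕ
  β : ℝ
  δ : ℝ
  cb : ℝ

/-- The tables kept by the algorithm, indexed by step, state (and action). -/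
structure QESATables (S A : Type*) where
  /-- visit counts `N_h(s, a)` -/
  N : ℕ → S → A → ℕ
  /-- `Q_h(s, a)` -/
  Q : ℕ → S → A → ℝ
  /-- `Q_h^UCB(s, a)` -/
  QUCB : ℕ → S → A → ℝ
  /-- `Q_h^LCB(s, a)` -/
  QLCB : ℕ → S → A → ℝ
  /-- `Q_h^R(s, a)` -/
  QR : ℕ → S → A → ℝ
  /-- `μ_h^ref(s, a)` -/
  μref : ℕ → S → A → ℝ
  /-- `σ_h^ref(s, a)` -/
  σref : ℕ → S → A → ℝ
  /-- `μ_h^adv(s, a)` -/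
  μadv : ℕ → S → A → ℝ
  /-- `σ_h^adv(s, a)` -/
  σadv : ℕ → S → A → ℝ
  /-- `B_h^R(s, a)` -/
  BR : ℕ → S → A → ℝ
  /-- `V_h(s)` -/
  V : ℕ → S → ℝ
  /-- `V_h^LCB(s)` -/
  VLCB : ℕ → S → ℝ
  /-- the reference function `V_h^R(s)` -/
  VR : ℕ → S → ℝ
  /-- the flag `u_h(s)`: `true` as long as the reference value at `(s, h)` is not settled -/
  u : ℕ → S → Bool

/-- Overwrite the entry at `(h, s)` of a table by `v`. -/
noncomputable def writeState {S α : Type*} (f : ℕ → S → α) (h : ℕ) (s : S) (v : α) : ℕ → S → α :=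
  open scoped Classical in fun h' s' => if h' = h ∧ s' = s then v else f h' s'

/-- Overwrite the entry at `(h, s, a)` of a table by `v`. -/
noncomputable def writeStateAction {S A α : Type*} (f : ℕ → S → A → α) (h : ℕ) (s : S) (a : A)
    (v : α) : ℕ → S → A → α :=
  open scoped Classical in
    fun h' s' a' => if h' = h ∧ s' = s ∧ a' = a then v else f h' s' a'

namespace QESA

variable {S A : Type*} [Fintype S] [Fintype A]

/-- `ι = log(SAT/δ)` with `T = HK`. -/
noncomputable def iota (M : EpisodicMDP S A) (p : QESAParams) : ℝ :=
  Real.log ((Fintype.card S : ℝ) * Fintype.card A * (M.H * p.K) / p.δ)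

/-- The initial tables.  Estimates at step `H + 1` are `0` and are never overwritten. -/
noncomputable def init (M : EpisodicMDP S A) : QESATables S A where
  N := fun _ _ _ => 0
  Q := fun _ _ _ => M.H
  QUCB := fun _ _ _ => M.H
  QLCB := fun _ _ _ => 0
  QR := fun _ _ _ => M.H
  μref := fun _ _ _ => 0
  σref := fun _ _ _ => 0
  μadv := fun _ _ _ => 0
  σadv := fun _ _ _ => 0
  BR := fun _ _ _ => 0
  V := fun h _ => if h ≤ M.H then M.H else 0
  VLCB := fun _ _ => 0
  VR := fun h _ => if h ≤ M.H then M.H else 0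
  u := fun _ _ => true

/-- The update of the tables `t` at step `h`, after action `a` was taken in state `s` and the next
state `s'` was observed. -/
noncomputable def step (M : EpisodicMDP S A) (p : QESAParams) (t : QESATables S A)
    (h : ℕ) (s : S) (a : A) (s' : S) : QESATables S A :=
  let H : ℝ := M.H
  let ι : ℝ := iota M p
  let N' : ℕ := t.N h s a + 1
  let n : ℝ := N'
  let η : ℝ := (H + 1) / (H + n)
  -- upper and lower confidence estimates
  let qUCB : ℝ := (1 - η) * t.QUCB h s a
    + η * (M.r h s a + t.V (h + 1) s' + p.cb * √(H ^ 3 * ι / n))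
  let qLCB : ℝ := (1 - η) * t.QLCB h s a
    + η * (M.r h s a + t.VLCB (h + 1) s' - p.cb * √(H ^ 3 * ι / n))
  -- moments of the reference function and of the advantage
  let μref : ℝ := (1 - 1 / n) * t.μref h s a + 1 / n * t.VR (h + 1) s'
  let σref : ℝ := (1 - 1 / n) * t.σref h s a + 1 / n * t.VR (h + 1) s' ^ 2
  let μadv : ℝ := (1 - η) * t.μadv h s a + η * (t.V (h + 1) s' - t.VR (h + 1) s')
  let σadv : ℝ := (1 - η) * t.σadv h s a + η * (t.V (h + 1) s' - t.VR (h + 1) s') ^ 2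
  -- bonus
  let Bnext : ℝ := p.cb * √(ι / n) * (√(σref - μref ^ 2) + √H * √(σadv - μadv ^ 2))
  let δR : ℝ := Bnext - t.BR h s a
  let bR : ℝ := Bnext + (1 - η) * δR / η + p.cb * (H ^ 2 * ι / n ^ (3 / 4 : ℝ))
  -- reference-advantage estimate
  let qR : ℝ := (1 - η) * t.QR h s a
    + η * (M.r h s a + t.V (h + 1) s' - t.VR (h + 1) s' + μref + bR)
  let q : ℝ := min (min qR qUCB) (t.Q h s a)
  let Q' := writeStateAction t.Q h s a q
  let QLCB' := writeStateAction t.QLCB h s a qLCB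
  let v : ℝ := ⨆ a', Q' h s a'
  let vLCB : ℝ := max (⨆ a', QLCB' h s a') (t.VLCB h s)
  { N := writeStateAction t.N h s a N'
    Q := Q'
    QUCB := writeStateAction t.QUCB h s a qUCB
    QLCB := QLCB'
    QR := writeStateAction t.QR h s a qR
    μref := writeStateAction t.μref h s a μref
    σref := writeStateAction t.σref h s a σref
    μadv := writeStateAction t.μadv h s a μadv
    σadv := writeStateAction t.σadv h s a σadv
    BR := writeStateAction t.BR h s a Bnext
    V := writeState t.V h s v
    VLCB := writeState t.VLCB h s vLCB
    VR := if v - vLCB > p.β ∨ t.u h s = true then writeState t.VR h s v else t.VR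
    u := if v - vLCB > p.β then t.u else writeState t.u h s false }

/-- The tables after the first `h` steps of an episode with states `x 1, x 2, …` in which the
deterministic policy `d` was followed. -/
noncomputable def afterSteps (M : EpisodicMDP S A) (p : QESAParams) (t : QESATables S A)
    (x : ℕ → S) (d : ℕ → S → A) : ℕ → QESATables S A
  | 0 => t
  | h + 1 => step M p (afterSteps M p t x d h) (h + 1) (x (h + 1)) (d (h + 1) (x (h + 1)))
      (x (h + 2))

/-- The tables after the first `k` episodes, where episode `j` has states `x j 1, …, x j (H + 1)`
and follows the policy `pol j`. -/
noncomputable def tables (M : EpisodicMDP S A) (p : QESAParams)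
    (x : ℕ → ℕ → S) (pol : ℕ → ℕ → S → A) : ℕ → QESATables S A
  | 0 => init M
  | k + 1 => afterSteps M p (tables M p x pol k) (x (k + 1)) (pol (k + 1)) M.H

/-- `IsRun M p μ ℱ X π`: on the probability space `(Ω, μ)`, the states `X k h` (`s_h^k`) and
policies `π k` (`π^k`) form a run of the algorithm with `p.K` episodes on the MDP `M`.  The σ-algebra
`ℱ (k * H + h)` is the information available when step `h` of episode `k` is about to be taken.
The initial states and the choice among maximizing actions may depend on the past in any way
and may be randomized. -/
structure IsRun (M : EpisodicMDP S A) (p : QESAParams) {Ω : Type*} [mΩ : MeasurableSpace Ω]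
    (μ : Measure Ω) (ℱ : Filtration ℕ mΩ) (X : ℕ → ℕ → Ω → S) (π : ℕ → Ω → ℕ → S → A) : Prop where
  /-- the state `s_h^k` is known when step `h` of episode `k` is about to be taken -/
  state_meas : ∀ k ∈ Finset.Icc 1 p.K, ∀ h ∈ Finset.Icc 1 (M.H + 1), ∀ s,
    MeasurableSet[ℱ (k * M.H + h)] {ω | X k h ω = s}
  /-- the policy `π^k` is fixed at the beginning of episode `k` -/
  policy_meas : ∀ k ∈ Finset.Icc 1 p.K, ∀ h ∈ Finset.Icc 1 M.H, ∀ s a,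
    MeasurableSet[ℱ (k * M.H + 1)] {ω | π k ω h s = a}
  /-- `π^{k+1}` is greedy with respect to the `Q`-table held after `k` episodes -/
  greedy : ∀ k < p.K, ∀ ω, ∀ h ∈ Finset.Icc 1 M.H, ∀ s a,
    (tables M p (fun j i => X j i ω) (fun j => π j ω) k).Q h s a ≤
      (tables M p (fun j i => X j i ω) (fun j => π j ω) k).Q h s (π (k + 1) ω h s)
  /-- given the past, the next state has law `ℙ_h(· | s_h^k, a_h^k)` with `a_h^k = π_h^k(s_h^k)` -/
  transition : ∀ k ∈ Finset.Icc 1 p.K, ∀ h ∈ Finset.Icc 1 M.H, ∀ y,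
    μ[{ω | X k (h + 1) ω = y}.indicator (fun _ => (1 : ℝ)) | ℱ (k * M.H + h)] =ᵐ[μ]
      fun ω => M.P h (X k h ω) (π k ω h (X k h ω)) y

end QESA

/-! # Gap-dependent regret of the refined Q-EarlySettled-Advantage algorithm

By the Bellman equations and the conditional law of the next state, the expected regret is the
expected sum of the gaps `Δ_h(s_h, a_h)` along the trajectory (`QESA.IsRun.integral_regret`).  When
the tables are optimistic and the policy is greedy, a gap is at most the error `Q_h - Q_h^⋆` at the
visited pair, and a nonzero gap is at least `Δ_min`.  So it suffices to bound the sum of the errors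
which are at least `Δ_min`.

**Concentration.**  The analysis is deterministic on a good event (`QESA.GoodAt`): Bernstein
inequalities, for every step, every state-action pair and every number of visits, for twelve
functions of the next state which may depend on the tables held at the start of the episode.  They
follow from exponential supermartingales (`QESA.IsRun.integral_exp_expSum_le`), one for every
parameter of a finite grid (`QESA.le_of_grid`).  The sum `QESA.totalMass` of all the exponentials,
each divided by `exp (4 ι)`, is at least `1` off the good event and has a tiny expectation, so that
`H²K * totalMass` dominates the sum of the gaps there and adds at most `12` to the expected regret.

**Optimism.**  On the good event `V^LCB ≤ V^⋆ ≤ V` for all tables (`QESA.bracket`), by induction on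
the number of episodes.  The reference-advantage estimate is optimistic because its bonus telescopes
(`QESA.QR_eq`) to an expression in the empirical variances of the reference function and of the
advantage; these bound the conditional variances in Bernstein's inequality, up to an error absorbed
by the `n^{-3/4}` part of the bonus.

**Errors.**  In the same way (`QESA.QR_le`), the error at a pair visited `n ≥ 1` times is at most
the `η_i^n`-weighted average of the errors at the next step in these visits, plus, up to numerical
factors, `c_b` times `√((ℚ^⋆ + β²H) ι / n) + H²ι / n^{3/4} + X / n`, where `X` collects the cost of
the reference values which are not settled or exceed `V^⋆ + β`.  The first term uses that the
variance of a settled reference function is at most a multiple of `ℚ^⋆ + β²`.  The recursion is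
unfolded for weighted sums of errors (`weighted_error_le`): passing to the next step does not
increase the total weight, and increases the largest weight by the factor `1 + 1 / H` only.  With
the weights `1[error ≥ Δ_min]`, a contribution `ε = Δ_min / (2H)` per step can be absorbed into the
left-hand side; hence only the part of a term `C / √n` above `ε` matters, and it sums to `2C² / ε`
(`QESA.sum_clipSqrt_le`).  This is the term with `1 / Δ_min`.  The part of `H²ι / n^{3/4}` above `β
√(Hι / n)` sums to a multiple of `H⁴ι² / β` (`QESA.sum_clipRpow_le`), independently of the gap.

**Reference values.**  The same recursion applies to the widths `V - V^LCB`, without any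
concentration, and shows that the widths above `β` sum to `O(H⁵SAι / β)` at every step
(`QESA.Admissible.sum_width_le`).  The reference value of a visited state exceeds `V^⋆ + β` only
when the width does exceed `β`, and each state is visited at most once with a smaller width before
its reference value is settled.  So the costs `X` have a sum linear in `S` (`QESA.sum_cellCost_le`),
and the factors `1 / n` cost one more logarithm.

Altogether `QESA.sum_gap_le` bounds the sum of the gaps on the good event.  The theorem follows
since `ι ≤ (q + 1) log (SAT)` when `δ ≥ (SAT)^{-q}`. -/

section
open Finset

namespace QESA
open scoped Classical

/-! ### Learning-rate weights -/

/-- The learning rate `η_n = (H + 1) / (H + n)`. -/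
noncomputable def lr (H : ℝ) (n : ℕ) : ℝ := (H + 1) / (H + n)

/-- The weight `η_i^n = η_i ∏_{i < j ≤ n} (1 - η_j)` which the `i`-th of `n` updates retains.
The index `i = 0` stands for the initial value, so that `η_0^n = ∏_{j ≤ n} (1 - η_j)`; the weight
is `0` when `n < i`. -/
noncomputable def etaW (H : ℝ) (i : ℕ) : ℕ → ℝ
  | 0 => if i = 0 then 1 else 0
  | n + 1 => if i = n + 1 then lr H (n + 1) else (1 - lr H (n + 1)) * etaW H i n

section weights
variable {H : ℝ}

lemma lr_one (hH : 1 ≤ H) : lr H 1 = 1 := by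
  unfold lr; push_cast; exact div_self (by linarith)

lemma lr_pos (hH : 1 ≤ H) (n : ℕ) : 0 < lr H n := by
  unfold lr; positivity

lemma one_sub_lr (hH : 1 ≤ H) (n : ℕ) : 1 - lr H (n + 1) = n / (H + (n + 1 : ℕ)) := by
  have : H + ((n + 1 : ℕ) : ℝ) ≠ 0 := by positivity
  unfold lr; field_simp; push_cast; ring

lemma one_sub_lr_nonneg (hH : 1 ≤ H) (n : ℕ) : 0 ≤ 1 - lr H (n + 1) := by
  rw [one_sub_lr hH]; positivity

lemma etaW_nonneg (hH : 1 ≤ H) (i n : ℕ) : 0 ≤ etaW H i n := by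
  induction n with
  | zero => unfold etaW; split_ifs <;> norm_num
  | succ n ih =>
    unfold etaW; split_ifs
    · exact (lr_pos hH _).le
    · exact mul_nonneg (one_sub_lr_nonneg hH n) ih

lemma etaW_of_lt {i n : ℕ} (h : n < i) : etaW H i n = 0 := by
  induction n with
  | zero => unfold etaW; rw [if_neg (by omega)]
  | succ n ih => unfold etaW; rw [if_neg (by omega), ih (by omega), mul_zero]

lemma etaW_self (i : ℕ) : etaW H (i + 1) (i + 1) = lr H (i + 1) := by
  rw [etaW, if_pos rfl]

lemma etaW_succ {i n : ℕ} (h : i ≠ n + 1) :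
    etaW H i (n + 1) = (1 - lr H (n + 1)) * etaW H i n := by
  rw [etaW, if_neg h]

lemma etaW_zero_left (hH : 1 ≤ H) {n : ℕ} (hn : 1 ≤ n) : etaW H 0 n = 0 := by
  induction n, hn using Nat.le_induction with
  | base => rw [etaW_succ (by omega), lr_one hH]; simp
  | succ n hn ih => rw [etaW_succ (by omega), ih, mul_zero]

/-- Averages with the weights `η_i^n` obey the recursion of the updates. -/
lemma sum_etaW_succ (n : ℕ) (φ : ℕ → ℝ) :
    ∑ i ∈ range (n + 1), etaW H (i + 1) (n + 1) * φ (i + 1)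
      = (1 - lr H (n + 1)) * ∑ i ∈ range n, etaW H (i + 1) n * φ (i + 1)
        + lr H (n + 1) * φ (n + 1) := by
  rw [sum_range_succ, etaW_self, mul_sum]
  congr 1
  refine sum_congr rfl fun i hi => ?_
  rw [etaW_succ (by simp at hi; omega)]; ring

lemma sum_etaW (hH : 1 ≤ H) {n : ℕ} (hn : 1 ≤ n) : ∑ i ∈ range n, etaW H (i + 1) n = 1 := by
  induction n, hn using Nat.le_induction with
  | base => simp [etaW_self, lr_one hH]
  | succ n hn ih =>
    have := sum_etaW_succ (H := H) n (fun _ => 1)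
    simp only [mul_one] at this
    rw [this, ih]; ring

lemma etaW_le (hH : 1 ≤ H) {i n : ℕ} (hi : 1 ≤ i) (hn : 1 ≤ n) : etaW H i n ≤ 2 * H / n := by
  have hpos : ∀ m : ℕ, 0 < H + ((m + 1 : ℕ) : ℝ) := fun m => by positivity
  induction n, hn using Nat.le_induction with
  | base =>
    rcases eq_or_ne i 1 with rfl | h
    · rw [etaW_self, lr_one hH]; norm_num; linarith
    · rw [etaW_of_lt (by omega)]; positivity
  | succ n hn ih =>
    rcases eq_or_ne i (n + 1) with rfl | h
    · rw [etaW_self]; unfold lr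
      have h1 := hpos n
      have h2 : (0 : ℝ) < ((n + 1 : ℕ) : ℝ) := by positivity
      rw [div_le_div_iff₀ h1 h2]
      push_cast; nlinarith [(Nat.cast_nonneg n : (0 : ℝ) ≤ n)]
    · rw [etaW_succ h, one_sub_lr hH]
      have hn' : (0 : ℝ) < n := by exact_mod_cast hn
      calc _ ≤ (n / (H + (n + 1 : ℕ)) : ℝ) * (2 * H / n) := by gcongr
        _ = 2 * H / (H + (n + 1 : ℕ)) := by field_simp
        _ ≤ _ := by gcongr; linarith

/-- The total weight `∑_n η_i^n` which an update receives in all later averages is at most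
`1 + 1 / H`: the quantity `∑_{m ≤ n} η_i^m + n η_i^n / H` is constant for `n ≥ i`. -/
lemma sum_etaW_right_le (hH : 1 ≤ H) {i : ℕ} (hi : 1 ≤ i) (N : ℕ) :
    ∑ n ∈ range N, etaW H i n ≤ 1 + 1 / H := by
  have key : ∀ n, i ≤ n → ∑ m ∈ range (n + 1), etaW H i m + n * etaW H i n / H = 1 + 1 / H := by
    intro n hn
    induction n, hn using Nat.le_induction with
    | base =>
      rw [sum_range_succ, sum_eq_zero fun m hm => etaW_of_lt (by simpa using hm)]
      obtain ⟨m, rfl⟩ : ∃ m, i = m + 1 := ⟨i - 1, by omega⟩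
      rw [etaW_self]; unfold lr
      have : H + ((m + 1 : ℕ) : ℝ) ≠ 0 := by positivity
      field_simp; ring
    | succ n hn ih =>
      rw [sum_range_succ, etaW_succ (by omega), one_sub_lr hH, ← ih]
      have : H + ((n + 1 : ℕ) : ℝ) ≠ 0 := by positivity
      field_simp; push_cast; ring
  have hH0 : 0 < H := by linarith
  calc ∑ n ∈ range N, etaW H i n ≤ ∑ m ∈ range (max N i + 1), etaW H i m := by
        apply sum_le_sum_of_subset_of_nonneg
        · intro x; simp only [mem_range]; omega
        · intros; exact etaW_nonneg hH _ _
    _ ≤ 1 + 1 / H := by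
        rw [← key (max N i) (by omega)]
        have := etaW_nonneg hH i (max N i)
        have : 0 ≤ ((max N i : ℕ) : ℝ) * etaW H i (max N i) / H := by positivity
        linarith

/-- Averaging a slowly decreasing function with the weights `η_i^n` at most doubles it. -/
lemma sum_etaW_mul_le (hH : 1 ≤ H) (φ : ℕ → ℝ) (h0 : ∀ n, 0 ≤ φ n)
    (hφ : ∀ n : ℕ, n * φ n ≤ (n + 1 : ℕ) * φ (n + 1)) (n : ℕ) :
    ∑ i ∈ range n, etaW H (i + 1) n * φ (i + 1) ≤ 2 * φ n := by
  induction n with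
  | zero => simpa using h0 0
  | succ n ih =>
    rw [sum_etaW_succ]
    have h1 := one_sub_lr_nonneg hH n
    calc _ ≤ (1 - lr H (n + 1)) * (2 * φ n) + lr H (n + 1) * φ (n + 1) := by gcongr
      _ = (2 * (n * φ n) + (H + 1) * φ (n + 1)) / (H + (n + 1 : ℕ)) := by
        rw [one_sub_lr hH]; unfold lr; ring
      _ ≤ (2 * ((n + 1 : ℕ) * φ (n + 1)) + (H + 1) * φ (n + 1)) / (H + (n + 1 : ℕ)) := by
        gcongr ?_ / _
        linarith [hφ n]
      _ ≤ 2 * φ (n + 1) := by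
        have : 0 < H + ((n + 1 : ℕ) : ℝ) := by positivity
        rw [div_le_iff₀ this]
        nlinarith [h0 (n + 1)]

end weights

/-! ### Visits of a cell -/

section visits
variable {Z : Type*}

/-- The episodes `j < k` in which the cell `z` is visited, when `c j` is the cell visited in
episode `j`. -/
noncomputable def visits (c : ℕ → Z) (z : Z) (k : ℕ) : Finset ℕ := (range k).filter (c · = z)

/-- The number of visits of the cell `z` during the episodes `j < k`. -/
noncomputable def cnt (c : ℕ → Z) (z : Z) (k : ℕ) : ℕ := (visits c z k).card

variable {c : ℕ → Z} {z : Z}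

lemma mem_visits {j k : ℕ} : j ∈ visits c z k ↔ j < k ∧ c j = z := by simp [visits]

lemma visits_mono {k k' : ℕ} (h : k ≤ k') : visits c z k ⊆ visits c z k' := by
  intro j; simp only [mem_visits]; rintro ⟨h1, h2⟩; exact ⟨by omega, h2⟩

lemma cnt_mono {k k' : ℕ} (h : k ≤ k') : cnt c z k ≤ cnt c z k' := card_le_card (visits_mono h)

lemma cnt_le (k : ℕ) : cnt c z k ≤ k := (card_filter_le _ _).trans (by simp)

lemma visits_succ_of_eq {k : ℕ} (h : c k = z) : visits c z (k + 1) = insert k (visits c z k) := by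
  unfold visits; rw [range_add_one, filter_insert, if_pos h]

lemma visits_succ_of_ne {k : ℕ} (h : c k ≠ z) : visits c z (k + 1) = visits c z k := by
  unfold visits; rw [range_add_one, filter_insert, if_neg h]

lemma notMem_visits (k : ℕ) : k ∉ visits c z k := by simp [mem_visits]

@[simp] lemma visits_zero : visits c z 0 = ∅ := by simp [visits]

@[simp] lemma cnt_zero : cnt c z 0 = 0 := by simp [cnt]

lemma cnt_succ_of_eq {k : ℕ} (h : c k = z) : cnt c z (k + 1) = cnt c z k + 1 := by
  unfold cnt; rw [visits_succ_of_eq h, card_insert_of_notMem (notMem_visits k)]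

lemma cnt_succ_of_ne {k : ℕ} (h : c k ≠ z) : cnt c z (k + 1) = cnt c z k := by
  unfold cnt; rw [visits_succ_of_ne h]

lemma sum_visits_succ_of_eq {k : ℕ} (h : c k = z) (f : ℕ → ℝ) :
    ∑ j ∈ visits c z (k + 1), f j = ∑ j ∈ visits c z k, f j + f k := by
  rw [visits_succ_of_eq h, sum_insert (notMem_visits k), add_comm]

lemma cnt_lt_of_visit {j k : ℕ} (h : j ∈ visits c z k) : cnt c z j + 1 ≤ cnt c z k := by
  rw [mem_visits] at h
  rw [← cnt_succ_of_eq h.2]; exact cnt_mono h.1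

/-- The counts at the visits of a cell are `0, 1, 2, …`. -/
lemma sum_visits_cnt (φ : ℕ → ℝ) (k : ℕ) :
    ∑ j ∈ visits c z k, φ (cnt c z j) = ∑ i ∈ range (cnt c z k), φ i := by
  induction k with
  | zero => simp
  | succ k ih =>
    by_cases h : c k = z
    · rw [sum_visits_succ_of_eq h, cnt_succ_of_eq h, sum_range_succ, ih]
    · rw [visits_succ_of_ne h, cnt_succ_of_ne h, ih]

lemma sum_cells_visits [Fintype Z] (f : ℕ → ℝ) (K : ℕ) :
    ∑ j ∈ range K, f j = ∑ z : Z, ∑ j ∈ visits c z K, f j := by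
  unfold visits
  exact (sum_fiberwise (range K) c f).symm

/-- Solution of the recursion `F ← (1 - η_n) F + η_n y`. -/
lemma eta_recursion {H : ℝ} {F y : ℕ → ℝ}
    (h1 : ∀ k, c k = z → F (k + 1) = (1 - lr H (cnt c z k + 1)) * F k + lr H (cnt c z k + 1) * y k)
    (h2 : ∀ k, c k ≠ z → F (k + 1) = F k) (k : ℕ) :
    F k = etaW H 0 (cnt c z k) * F 0
      + ∑ j ∈ visits c z k, etaW H (cnt c z j + 1) (cnt c z k) * y j := by
  induction k with
  | zero => simp [etaW]
  | succ k ih =>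
    by_cases h : c k = z
    · rw [h1 k h, sum_visits_succ_of_eq h, cnt_succ_of_eq h, etaW_self, etaW_succ (by omega)]
      have : ∑ j ∈ visits c z k, etaW H (cnt c z j + 1) (cnt c z k + 1) * y j
          = (1 - lr H (cnt c z k + 1)) *
            ∑ j ∈ visits c z k, etaW H (cnt c z j + 1) (cnt c z k) * y j := by
        rw [mul_sum]
        refine sum_congr rfl fun j hj => ?_
        rw [etaW_succ (by have := cnt_lt_of_visit hj; omega), mul_assoc]
      rw [this]
      conv_lhs => rw [ih]
      ring
    · rw [h2 k h, visits_succ_of_ne h, cnt_succ_of_ne h, ih]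

/-- Solution of the recursion `F ← (1 - 1/n) F + y / n`. -/
lemma avg_recursion {F y : ℕ → ℝ}
    (h1 : ∀ k, c k = z → F (k + 1) = (1 - 1 / ((cnt c z k + 1 : ℕ) : ℝ)) * F k
      + 1 / ((cnt c z k + 1 : ℕ) : ℝ) * y k)
    (h2 : ∀ k, c k ≠ z → F (k + 1) = F k) (k : ℕ) :
    cnt c z k * F k = ∑ j ∈ visits c z k, y j := by
  induction k with
  | zero => simp
  | succ k ih =>
    by_cases h : c k = z
    · rw [h1 k h, sum_visits_succ_of_eq h, cnt_succ_of_eq h, ← ih]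
      have : ((cnt c z k + 1 : ℕ) : ℝ) ≠ 0 := by positivity
      field_simp
      push_cast
      ring
    · rw [h2 k h, visits_succ_of_ne h, cnt_succ_of_ne h, ih]

lemma sum_visits_etaW {H : ℝ} (hH : 1 ≤ H) {k : ℕ} (hn : 1 ≤ cnt c z k) :
    ∑ j ∈ visits c z k, etaW H (cnt c z j + 1) (cnt c z k) = 1 := by
  rw [sum_visits_cnt (fun i => etaW H (i + 1) (cnt c z k)), sum_etaW hH hn]

lemma sum_visits_etaW_mul_le {H : ℝ} (hH : 1 ≤ H) (φ : ℕ → ℝ) (h0 : ∀ n, 0 ≤ φ n)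
    (hφ : ∀ n : ℕ, n * φ n ≤ (n + 1 : ℕ) * φ (n + 1)) (k : ℕ) :
    ∑ j ∈ visits c z k, etaW H (cnt c z j + 1) (cnt c z k) * φ (cnt c z j + 1)
      ≤ 2 * φ (cnt c z k) := by
  rw [sum_visits_cnt (fun i => etaW H (i + 1) (cnt c z k) * φ (i + 1))]
  exact sum_etaW_mul_le hH φ h0 hφ _

lemma le_sum_visits_etaW_mul {H : ℝ} (hH : 1 ≤ H) (φ : ℕ → ℝ) (k : ℕ) (hn : 1 ≤ cnt c z k)
    (hφ : ∀ n, 1 ≤ n → n ≤ cnt c z k → φ (cnt c z k) ≤ φ n) :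
    φ (cnt c z k)
      ≤ ∑ j ∈ visits c z k, etaW H (cnt c z j + 1) (cnt c z k) * φ (cnt c z j + 1) := by
  calc φ (cnt c z k) = ∑ j ∈ visits c z k,
        etaW H (cnt c z j + 1) (cnt c z k) * φ (cnt c z k) := by
        rw [← sum_mul, sum_visits_etaW hH hn, one_mul]
    _ ≤ _ := by
        refine sum_le_sum fun j hj => ?_
        exact mul_le_mul_of_nonneg_left (hφ _ (by omega) (cnt_lt_of_visit hj)) (etaW_nonneg hH _ _)

end visits

/-! ### Propagation of weighted errors along the horizon -/

section propagation
variable {Z : Type*}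

/-- If the error at step `h` is at most the average of earlier errors at step `h + 1` plus
`ε + ρ`, then sums of errors with weights in `[0, m]` are controlled by `ε` times the total weight
and by the sums of `ρ`: passing from step `h` to `h + 1` does not enlarge the total weight, and enlarges the
maximal weight by a factor `1 + 1 / H` only. -/
lemma weighted_error_le_aux {H ε R : ℝ} (hH : 1 ≤ H) (hε : 0 ≤ ε) {n K : ℕ} (c : ℕ → ℕ → Z)
    (E ρ : ℕ → ℕ → ℝ) (hρ : ∀ h j, 0 ≤ ρ h j) (hR0 : 0 ≤ R)
    (hR : ∀ h ∈ Icc 1 n, ∑ j ∈ range K, ρ h j ≤ R)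
    (hlast : ∀ j < K, E (n + 1) j ≤ 0)
    (hE : ∀ h ∈ Icc 1 n, ∀ j < K, E h j ≤ ∑ i ∈ visits (c h) (c h j) j,
      etaW H (cnt (c h) (c h j) i + 1) (cnt (c h) (c h j) j) * E (h + 1) i + (ε + ρ h j))
    (d : ℕ) : ∀ h, h + d = n + 1 → 1 ≤ h → ∀ (w : ℕ → ℝ) (m : ℝ), (∀ j, 0 ≤ w j) → (∀ j, w j ≤ m) →
      ∑ j ∈ range K, w j * E h j
        ≤ d * ε * ∑ j ∈ range K, w j + d * (1 + 1 / H) ^ d * m * R := by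
  have hH0 : 0 < H := by linarith
  induction d with
  | zero =>
    intro h hh _ w m hw _
    obtain rfl : h = n + 1 := by omega
    simp only [Nat.cast_zero, zero_mul, add_zero]
    exact sum_nonpos fun j hj => mul_nonpos_of_nonneg_of_nonpos (hw j) (hlast j (by simpa using hj))
  | succ d ih =>
    intro h hh h1 w m hw hwm
    have hm0 : 0 ≤ m := (hw 0).trans (hwm 0)
    have hmem : h ∈ Icc 1 n := by simp; omega
    set W : ℕ → ℕ → ℝ := fun j i => if i < j ∧ c h i = c h j then
      etaW H (cnt (c h) (c h j) i + 1) (cnt (c h) (c h j) j) else 0 with hW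
    have hW0 : ∀ j i, 0 ≤ W j i := by
      intro j i; simp only [hW]; split_ifs; exacts [etaW_nonneg hH _ _, le_rfl]
    have hvis : ∀ j < K, ∀ f : ℕ → ℝ, ∑ i ∈ visits (c h) (c h j) j,
        etaW H (cnt (c h) (c h j) i + 1) (cnt (c h) (c h j) j) * f i
          = ∑ i ∈ range K, W j i * f i := by
      intro j hj f
      simp only [hW, ite_mul, zero_mul]
      rw [← sum_filter]
      refine sum_congr ?_ fun _ _ => rfl
      ext i; simp only [mem_visits, mem_filter, mem_range]
      constructor
      · rintro ⟨a, b⟩; exact ⟨by omega, a, b⟩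
      · rintro ⟨_, a, b⟩; exact ⟨a, b⟩
    -- the weights at step `h + 1` which the recursion induces
    set w' : ℕ → ℝ := fun i => if i < K then ∑ j ∈ range K, w j * W j i else 0 with hw'
    have hw'0 : ∀ i, 0 ≤ w' i := by
      intro i; simp only [hw']; split_ifs
      · exact sum_nonneg fun j _ => mul_nonneg (hw j) (hW0 j i)
      · exact le_rfl
    have hw'm : ∀ i, w' i ≤ (1 + 1 / H) * m := by
      intro i; simp only [hw']; split_ifs with hi
      · calc ∑ j ∈ range K, w j * W j i ≤ ∑ j ∈ range K, m * W j i :=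
              sum_le_sum fun j _ => mul_le_mul_of_nonneg_right (hwm j) (hW0 j i)
          _ = m * ∑ j ∈ range K, W j i := by rw [mul_sum]
          _ ≤ m * (1 + 1 / H) := by
              refine mul_le_mul_of_nonneg_left ?_ hm0
              calc ∑ j ∈ range K, W j i
                  ≤ ∑ j ∈ visits (c h) (c h i) K,
                      etaW H (cnt (c h) (c h i) i + 1) (cnt (c h) (c h i) j) := by
                    unfold visits
                    rw [sum_filter]
                    refine sum_le_sum fun j _ => ?_
                    simp only [hW]
                    split_ifs with h1 h2 h2
                    · rw [h1.2]
                    · exact absurd h1.2.symm h2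
                    · exact etaW_nonneg hH _ _
                    · exact le_rfl
                _ ≤ 1 + 1 / H := by
                    rw [sum_visits_cnt (fun m => etaW H (cnt (c h) (c h i) i + 1) m)]
                    exact sum_etaW_right_le hH (by omega) _
          _ = _ := mul_comm _ _
      · positivity
    have hw'sum : ∑ i ∈ range K, w' i ≤ ∑ j ∈ range K, w j := by
      calc ∑ i ∈ range K, w' i = ∑ i ∈ range K, ∑ j ∈ range K, w j * W j i :=
            sum_congr rfl fun i hi => if_pos (by simpa using hi)
        _ = ∑ j ∈ range K, w j * ∑ i ∈ range K, W j i := by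
            rw [sum_comm]; simp only [mul_sum]
        _ ≤ ∑ j ∈ range K, w j * 1 := by
            refine sum_le_sum fun j hj => mul_le_mul_of_nonneg_left ?_ (hw j)
            have := hvis j (by simpa using hj) (fun _ => 1)
            simp only [mul_one] at this
            rw [← this]
            rcases Nat.eq_zero_or_pos (cnt (c h) (c h j) j) with h0 | h0
            · have : visits (c h) (c h j) j = ∅ := card_eq_zero.mp h0
              rw [this]; simp
            · exact (sum_visits_etaW hH h0).le
        _ = _ := by simp
    have hrec := ih (h + 1) (by omega) (by omega) w' ((1 + 1 / H) * m) hw'0 hw'm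
    have hmain : ∑ j ∈ range K, w j * E h j ≤ ∑ i ∈ range K, w' i * E (h + 1) i
        + ∑ j ∈ range K, w j * (ε + ρ h j) := by
      calc ∑ j ∈ range K, w j * E h j
          ≤ ∑ j ∈ range K, w j * (∑ i ∈ range K, W j i * E (h + 1) i + (ε + ρ h j)) := by
            refine sum_le_sum fun j hj => mul_le_mul_of_nonneg_left ?_ (hw j)
            have hj' : j < K := by simpa using hj
            have := hE h hmem j hj'
            rwa [hvis j hj'] at this
        _ = _ := by
            simp only [mul_add (w _) (∑ i ∈ range K, _) _, sum_add_distrib]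
            congr 1
            simp only [mul_sum]
            rw [sum_comm]
            refine sum_congr rfl fun i hi => ?_
            simp only [hw']
            rw [if_pos (by simpa using hi), sum_mul]
            exact sum_congr rfl fun j _ => by ring
    have hρsum : ∑ j ∈ range K, w j * (ε + ρ h j) ≤ ε * ∑ j ∈ range K, w j + m * R := by
      calc ∑ j ∈ range K, w j * (ε + ρ h j) ≤ ∑ j ∈ range K, (ε * w j + m * ρ h j) := by
            refine sum_le_sum fun j _ => ?_
            have := mul_le_mul_of_nonneg_right (hwm j) (hρ h j)
            linarith
        _ = ε * ∑ j ∈ range K, w j + m * ∑ j ∈ range K, ρ h j := by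
            rw [sum_add_distrib, mul_sum, mul_sum]
        _ ≤ _ := by
            have := mul_le_mul_of_nonneg_left (hR h hmem) hm0
            linarith
    have hpow : 1 ≤ (1 + 1 / H) ^ (d + 1) := one_le_pow₀ (by simp; positivity)
    have h2 : d * ε * ∑ i ∈ range K, w' i ≤ d * ε * ∑ i ∈ range K, w i :=
      mul_le_mul_of_nonneg_left hw'sum (by positivity)
    have h3 : m * R ≤ (1 + 1 / H) ^ (d + 1) * m * R := by
      have : 0 ≤ m * R := by positivity
      nlinarith
    calc _ ≤ _ := hmain
      _ ≤ (d * ε * ∑ j ∈ range K, w' j + d * (1 + 1 / H) ^ d * ((1 + 1 / H) * m) * R)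
          + (ε * ∑ j ∈ range K, w j + m * R) := add_le_add hrec hρsum
      _ ≤ _ := by
        push_cast
        rw [pow_succ] at h3 ⊢
        linarith

lemma one_add_inv_pow_le (n : ℕ) (hn : 1 ≤ n) : (1 + 1 / (n : ℝ)) ^ n ≤ 3 := by
  have h : (1 + 1 / (n : ℝ)) ^ n ≤ Real.exp 1 := by
    have hn' : (0 : ℝ) < n := by exact_mod_cast hn
    calc (1 + 1 / (n : ℝ)) ^ n ≤ (Real.exp (1 / n)) ^ n := by
          gcongr; rw [add_comm]; exact Real.add_one_le_exp _
      _ = Real.exp 1 := by rw [← Real.exp_nat_mul]; congr 1; field_simp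
  linarith [Real.exp_one_lt_d9]

/-- The error at any step, summed with weights in `[0, 1]`; the steps are `1, …, n` and the
learning rates are those of horizon `n`. -/
lemma weighted_error_le {n K : ℕ} (hn : 1 ≤ n) {ε R : ℝ} (hε : 0 ≤ ε) (c : ℕ → ℕ → Z)
    (E ρ : ℕ → ℕ → ℝ) (hρ : ∀ h j, 0 ≤ ρ h j) (hR0 : 0 ≤ R)
    (hR : ∀ h ∈ Icc 1 n, ∑ j ∈ range K, ρ h j ≤ R)
    (hlast : ∀ j < K, E (n + 1) j ≤ 0)
    (hE : ∀ h ∈ Icc 1 n, ∀ j < K, E h j ≤ ∑ i ∈ visits (c h) (c h j) j,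
      etaW n (cnt (c h) (c h j) i + 1) (cnt (c h) (c h j) j) * E (h + 1) i + (ε + ρ h j))
    {h : ℕ} (hh : h ∈ Icc 1 n) (w : ℕ → ℝ) (hw : ∀ j, 0 ≤ w j) (hw1 : ∀ j, w j ≤ 1) :
    ∑ j ∈ range K, w j * E h j ≤ n * ε * ∑ j ∈ range K, w j + 3 * n * R := by
  simp only [mem_Icc] at hh
  have hn' : (1 : ℝ) ≤ n := by exact_mod_cast hn
  obtain ⟨d, hd⟩ : ∃ d, h + d = n + 1 := ⟨n + 1 - h, by omega⟩
  have hdn : d ≤ n := by omega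
  have hdn' : (d : ℝ) ≤ n := by exact_mod_cast hdn
  have := weighted_error_le_aux hn' hε c E ρ hρ hR0 hR hlast hE d h hd hh.1 w 1 hw hw1
  have hp : (1 + 1 / (n : ℝ)) ^ d ≤ 3 :=
    (pow_le_pow_right₀ (by simp) hdn).trans (one_add_inv_pow_le n hn)
  have hs : 0 ≤ ∑ j ∈ range K, w j := sum_nonneg fun j _ => hw j
  calc _ ≤ _ := this
    _ ≤ n * ε * ∑ j ∈ range K, w j + n * 3 * 1 * R := by gcongr
    _ = _ := by ring

end propagation

/-! ### Sums over clipped powers of the visit count -/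

section clipped

lemma sqrt_sub_le (i : ℕ) : 1 / √((i + 1 : ℕ) : ℝ) ≤ 2 * (√((i + 1 : ℕ) : ℝ) - √(i : ℝ)) := by
  have h1 : (0 : ℝ) < √((i + 1 : ℕ) : ℝ) := Real.sqrt_pos.mpr (by positivity)
  have h2 := Real.sqrt_nonneg (i : ℝ)
  have e1 := Real.sq_sqrt (show (0 : ℝ) ≤ ((i + 1 : ℕ) : ℝ) by positivity)
  have e2 := Real.sq_sqrt (show (0 : ℝ) ≤ (i : ℝ) by positivity)
  push_cast at *
  rw [div_le_iff₀ h1]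
  nlinarith [sq_nonneg (√((i : ℝ) + 1) - √(i : ℝ))]

lemma sum_clipped_inv_sqrt_le {x : ℝ} (hx : 0 ≤ x) (N : ℕ) :
    ∑ i ∈ range N, (if √((i + 1 : ℕ) : ℝ) < x then 1 / √((i + 1 : ℕ) : ℝ) else 0) ≤ 2 * x := by
  have key : ∑ i ∈ range N, (if √((i + 1 : ℕ) : ℝ) < x then 1 / √((i + 1 : ℕ) : ℝ) else 0)
      ≤ 2 * min (√(N : ℝ)) x := by
    induction N with
    | zero => simp [hx]
    | succ N ih =>
      rw [sum_range_succ]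
      have hmono : √(N : ℝ) ≤ √((N + 1 : ℕ) : ℝ) := Real.sqrt_le_sqrt (by push_cast; linarith)
      split_ifs with h
      · rw [min_eq_left h.le]
        have := min_le_left (√(N : ℝ)) x
        linarith [sqrt_sub_le N]
      · have : min (√(N : ℝ)) x ≤ min (√((N + 1 : ℕ) : ℝ)) x := min_le_min_right _ hmono
        linarith
  exact key.trans (by linarith [min_le_right (√(N : ℝ)) x])

lemma sqrt_sqrt_sub_le (i : ℕ) :
    1 / (√(√((i + 1 : ℕ) : ℝ))) ^ 3 ≤ 4 * (√(√((i + 1 : ℕ) : ℝ)) - √(√(i : ℝ))) := by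
  have h1 : (0 : ℝ) < √√((i + 1 : ℕ) : ℝ) := by positivity
  have h2 := Real.sqrt_nonneg √(i : ℝ)
  have e1 : √√((i + 1 : ℕ) : ℝ) ^ 4 = ((i + 1 : ℕ) : ℝ) := by
    rw [show 4 = 2 * 2 by norm_num, pow_mul, Real.sq_sqrt (by positivity),
      Real.sq_sqrt (by positivity)]
  have e2 : √√(i : ℝ) ^ 4 = (i : ℝ) := by
    rw [show 4 = 2 * 2 by norm_num, pow_mul, Real.sq_sqrt (by positivity),
      Real.sq_sqrt (by positivity)]
  have hle : √√(i : ℝ) ≤ √√((i + 1 : ℕ) : ℝ) :=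
    Real.sqrt_le_sqrt (Real.sqrt_le_sqrt (by push_cast; linarith))
  push_cast at *
  set y := √√((i : ℝ) + 1)
  set z := √√(i : ℝ)
  rw [div_le_iff₀ (by positivity)]
  have hd : (y - z) * (y ^ 3 + y ^ 2 * z + y * z ^ 2 + z ^ 3) = 1 := by
    have : (y - z) * (y ^ 3 + y ^ 2 * z + y * z ^ 2 + z ^ 3) = y ^ 4 - z ^ 4 := by ring
    rw [this, e1, e2]; ring
  rw [← hd]
  have hyz : 0 ≤ y - z := by linarith
  have a1 : y ^ 2 * z ≤ y ^ 2 * y := by gcongr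
  have a2 : y * z ^ 2 ≤ y * y ^ 2 := by gcongr
  have a3 : z ^ 3 ≤ y ^ 3 := by gcongr
  calc _ ≤ (y - z) * (4 * y ^ 3) := by gcongr; linarith
    _ = _ := by ring

lemma sum_clipped_inv_rpow_le {x : ℝ} (hx : 0 ≤ x) (N : ℕ) :
    ∑ i ∈ range N, (if √√((i + 1 : ℕ) : ℝ) < x then 1 / (√√((i + 1 : ℕ) : ℝ)) ^ 3 else 0)
      ≤ 4 * x := by
  have key : ∑ i ∈ range N,
      (if √√((i + 1 : ℕ) : ℝ) < x then 1 / (√√((i + 1 : ℕ) : ℝ)) ^ 3 else 0)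
      ≤ 4 * min (√√(N : ℝ)) x := by
    induction N with
    | zero => simp [hx]
    | succ N ih =>
      rw [sum_range_succ]
      have hmono : √√(N : ℝ) ≤ √√((N + 1 : ℕ) : ℝ) :=
        Real.sqrt_le_sqrt (Real.sqrt_le_sqrt (by push_cast; linarith))
      split_ifs with h
      · rw [min_eq_left h.le]
        have := min_le_left (√√(N : ℝ)) x
        linarith [sqrt_sqrt_sub_le N]
      · have : min (√√(N : ℝ)) x ≤ min (√√((N + 1 : ℕ) : ℝ)) x := min_le_min_right _ hmono
        linarith
  exact key.trans (by linarith [min_le_right (√√(N : ℝ)) x])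

lemma sum_inv_le_log {N K : ℕ} (h : N ≤ K) :
    ∑ i ∈ range N, 1 / ((i + 1 : ℕ) : ℝ) ≤ 1 + Real.log K := by
  have h1 : ∑ i ∈ range N, 1 / ((i + 1 : ℕ) : ℝ) = (harmonic N : ℝ) := by
    simp [harmonic]
  rw [h1]
  refine (harmonic_le_one_add_log N).trans ?_
  rcases Nat.eq_zero_or_pos N with rfl | hN
  · simp [Real.log_natCast_nonneg]
  · gcongr

end clipped

end QESA

namespace EpisodicMDP
open scoped Classical

variable {S A : Type*} [Fintype S] (M : EpisodicMDP S A)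

/-! ### Means and variances at the next state -/

section moments
variable {M} {h : ℕ} {s : S} {a : A} {f g : S → ℝ}

lemma nextMean_const (b : ℝ) : M.nextMean h s a (fun _ => b) = b := by
  unfold nextMean; rw [← sum_mul]; simp

lemma nextMean_add : M.nextMean h s a (fun y => f y + g y)
    = M.nextMean h s a f + M.nextMean h s a g := by
  unfold nextMean; rw [← sum_add_distrib]; simp only [mul_add]

lemma nextMean_sub : M.nextMean h s a (fun y => f y - g y)
    = M.nextMean h s a f - M.nextMean h s a g := by
  unfold nextMean; rw [← sum_sub_distrib]; simp only [mul_sub]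

lemma nextMean_const_mul (b : ℝ) : M.nextMean h s a (fun y => b * f y)
    = b * M.nextMean h s a f := by
  unfold nextMean; rw [mul_sum]; exact sum_congr rfl fun _ _ => by ring

lemma nextMean_neg : M.nextMean h s a (fun y => - f y) = - M.nextMean h s a f := by
  have := nextMean_const_mul (M := M) (h := h) (s := s) (a := a) (f := f) (-1)
  simpa using this

lemma nextMean_mono (hfg : ∀ y, f y ≤ g y) : M.nextMean h s a f ≤ M.nextMean h s a g :=
  sum_le_sum fun y _ => mul_le_mul_of_nonneg_left (hfg y) (by simp)

lemma nextMean_le {b : ℝ} (hf : ∀ y, f y ≤ b) : M.nextMean h s a f ≤ b :=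
  (nextMean_mono hf).trans_eq (nextMean_const b)

lemma le_nextMean {b : ℝ} (hf : ∀ y, b ≤ f y) : b ≤ M.nextMean h s a f :=
  (nextMean_const b).symm.trans_le (nextMean_mono hf)

lemma nextVar_eq_sub (b : ℝ) : M.nextVar h s a f
    = M.nextMean h s a (fun y => (f y - b) ^ 2) - (M.nextMean h s a f - b) ^ 2 := by
  have : M.nextMean h s a (fun y => (f y - b) ^ 2)
      = M.nextMean h s a (fun y => f y ^ 2) - 2 * b * M.nextMean h s a f + b ^ 2 := by
    rw [← nextMean_const_mul, ← nextMean_sub, ← nextMean_const (M := M) (h := h) (s := s) (a := a)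
      (b ^ 2), ← nextMean_add]
    congr 1; ext y; ring
  rw [this]; unfold nextVar; ring

lemma nextVar_eq : M.nextVar h s a f
    = M.nextMean h s a (fun y => (f y - M.nextMean h s a f) ^ 2) := by
  rw [nextVar_eq_sub (M.nextMean h s a f)]; ring

lemma nextVar_nonneg : 0 ≤ M.nextVar h s a f := by
  rw [nextVar_eq]; exact le_nextMean fun y => sq_nonneg _

lemma nextVar_le_sub (b : ℝ) : M.nextVar h s a f ≤ M.nextMean h s a (fun y => (f y - b) ^ 2) := by
  rw [nextVar_eq_sub b]; linarith [sq_nonneg (M.nextMean h s a f - b)]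

lemma nextVar_le_sq {B : ℝ} (hf : ∀ y y', |f y - f y'| ≤ B) : M.nextVar h s a f ≤ B ^ 2 := by
  refine (nextVar_le_sub (f s)).trans (nextMean_le fun y => ?_)
  exact sq_le_sq' (by linarith [abs_le.mp (hf y s)]) (abs_le.mp (hf y s)).2

lemma nextVar_const_mul (b : ℝ) : M.nextVar h s a (fun y => b * f y) = b ^ 2 * M.nextVar h s a f := by
  unfold nextVar; rw [nextMean_const_mul]; simp only [mul_pow]; rw [nextMean_const_mul]; ring

lemma nextVar_neg : M.nextVar h s a (fun y => - f y) = M.nextVar h s a f := by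
  have := nextVar_const_mul (M := M) (h := h) (s := s) (a := a) (f := f) (-1)
  simpa using this

lemma nextVar_le_mul_mean {B : ℝ} (h0 : ∀ y, 0 ≤ f y) (hB : ∀ y, f y ≤ B) :
    M.nextVar h s a f ≤ B * M.nextMean h s a f := by
  unfold nextVar
  have : M.nextMean h s a (fun y => f y ^ 2) ≤ M.nextMean h s a (fun y => B * f y) :=
    nextMean_mono fun y => by rw [sq]; exact mul_le_mul_of_nonneg_right (hB y) (h0 y)
  rw [nextMean_const_mul] at this
  linarith [sq_nonneg (M.nextMean h s a f)]

lemma nextVar_le_two_mul {B : ℝ} (hB : ∀ y, |f y - g y| ≤ B) :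
    M.nextVar h s a f ≤ 2 * M.nextVar h s a g + 2 * B ^ 2 := by
  refine (nextVar_le_sub (M.nextMean h s a g)).trans ?_
  rw [nextVar_eq (f := g), ← nextMean_const_mul, ← nextMean_const (M := M) (h := h) (s := s) (a := a)
      (2 * B ^ 2), ← nextMean_add]
  refine nextMean_mono fun y => ?_
  have h1 : (f y - g y) ^ 2 ≤ B ^ 2 := sq_le_sq' (by linarith [abs_le.mp (hB y)]) (abs_le.mp (hB y)).2
  nlinarith [sq_nonneg ((f y - g y) - (g y - M.nextMean h s a g))]

lemma abs_sub_nextMean_le {B : ℝ} (hf : ∀ y y', |f y - f y'| ≤ B) (y : S) :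
    |f y - M.nextMean h s a f| ≤ B := by
  rw [abs_le]
  constructor
  · have : M.nextMean h s a f ≤ f y + B := nextMean_le fun y' => by linarith [abs_le.mp (hf y y')]
    linarith
  · have : f y - B ≤ M.nextMean h s a f := le_nextMean fun y' => by linarith [abs_le.mp (hf y y')]
    linarith

end moments

variable [Fintype A]

/-! ### Bellman equations -/

lemma value_of_lt (π : MDPPolicy S A) {h : ℕ} (hh : M.H < h) (s : S) : M.value π h s = 0 := by
  unfold value; rw [Icc_eq_empty (by omega)]; simp

lemma stateLaw_succ' (π : MDPPolicy S A) (h : ℕ) (s : S) (n : ℕ) (y : S) :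
    M.stateLaw π h s (n + 1) y
      = ∑ b, π h s b * M.nextMean h s b (fun x => M.stateLaw π (h + 1) x n y) := by
  induction n generalizing y with
  | zero =>
    simp [stateLaw, nextMean]
  | succ n ih =>
    rw [stateLaw]
    simp only [ih]
    simp only [stateLaw, nextMean, mul_sum, sum_mul]
    have e : h + (n + 1) = h + 1 + n := by omega
    simp only [e]
    calc ∑ x, ∑ a, ∑ b, ∑ w, π h s b * (M.P h s b w * M.stateLaw π (h + 1) w n x) *
          π (h + 1 + n) x a * M.P (h + 1 + n) x a y
        = ∑ x, ∑ b, ∑ w, ∑ a, π h s b * (M.P h s b w * M.stateLaw π (h + 1) w n x) *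
          π (h + 1 + n) x a * M.P (h + 1 + n) x a y := by
          refine sum_congr rfl fun x _ => ?_
          rw [sum_comm]
          refine sum_congr rfl fun b _ => ?_
          rw [sum_comm]
      _ = _ := by
          rw [sum_comm]
          refine sum_congr rfl fun b _ => ?_
          rw [sum_comm]
          refine sum_congr rfl fun w _ => sum_congr rfl fun x _ => sum_congr rfl fun a _ => ?_
          ring

lemma value_eq (π : MDPPolicy S A) {h : ℕ} (hh : h ≤ M.H) (s : S) :
    M.value π h s = ∑ a, π h s a * (M.r h s a + M.nextMean h s a (M.value π (h + 1))) := by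
  have hI : Icc h M.H = insert h (Icc (h + 1) M.H) := by ext; simp; omega
  unfold value
  rw [hI, sum_insert (by simp)]
  simp only [mul_add, sum_add_distrib]
  congr 1
  · simp [stateLaw]
  · have : ∀ h' ∈ Icc (h + 1) M.H, ∑ x, ∑ a, M.stateLaw π h s (h' - h) x * π h' x a * M.r h' x a
        = ∑ b, π h s b * M.nextMean h s b (fun y =>
          ∑ x, ∑ a, M.stateLaw π (h + 1) y (h' - (h + 1)) x * π h' x a * M.r h' x a) := by
      intro h' hh'
      simp only [mem_Icc] at hh'
      obtain ⟨n, rfl⟩ : ∃ n, h' = h + 1 + n := ⟨h' - (h + 1), by omega⟩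
      rw [show h + 1 + n - h = n + 1 by omega, show h + 1 + n - (h + 1) = n by omega]
      simp only [stateLaw_succ', nextMean, mul_sum, sum_mul]
      calc ∑ x, ∑ a, ∑ b, ∑ w, π h s b * (M.P h s b w * M.stateLaw π (h + 1) w n x) *
            π (h + 1 + n) x a * M.r (h + 1 + n) x a
          = ∑ x, ∑ b, ∑ w, ∑ a, π h s b * (M.P h s b w * M.stateLaw π (h + 1) w n x) *
            π (h + 1 + n) x a * M.r (h + 1 + n) x a := by
            refine sum_congr rfl fun x _ => ?_
            rw [sum_comm]
            refine sum_congr rfl fun b _ => ?_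
            rw [sum_comm]
        _ = _ := by
            rw [sum_comm]
            refine sum_congr rfl fun b _ => ?_
            rw [sum_comm]
            refine sum_congr rfl fun w _ => sum_congr rfl fun x _ => sum_congr rfl fun a _ => ?_
            ring
    rw [sum_congr rfl this, sum_comm]
    refine sum_congr rfl fun b _ => ?_
    rw [← mul_sum]
    congr 1
    simp only [nextMean]
    rw [sum_comm]
    refine sum_congr rfl fun y _ => ?_
    rw [mul_sum]

lemma value_mem (π : MDPPolicy S A) (d : ℕ) : ∀ h, h + d = M.H + 1 → 1 ≤ h → ∀ s,
    0 ≤ M.value π h s ∧ M.value π h s ≤ d := by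
  induction d with
  | zero => intro h hh _ s; rw [value_of_lt M π (by omega)]; simp
  | succ d ih =>
    intro h hh h1 s
    have ih' := ih (h + 1) (by omega) (by omega)
    have hr : ∀ a, 0 ≤ M.r h s a ∧ M.r h s a ≤ 1 := fun a => M.r_mem h (by simp; omega) s a
    rw [value_eq M π (by omega)]
    constructor
    · refine sum_nonneg fun a _ => mul_nonneg (by simp) (add_nonneg (hr a).1 ?_)
      exact le_nextMean fun y => (ih' y).1
    · calc _ ≤ ∑ a, π h s a * ((d + 1 : ℕ) : ℝ) := by
            refine sum_le_sum fun a _ => mul_le_mul_of_nonneg_left ?_ (by simp)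
            have := nextMean_le (M := M) (h := h) (s := s) (a := a) fun y => (ih' y).2
            push_cast; linarith [(hr a).2]
        _ = _ := by rw [← sum_mul]; simp

lemma value_nonneg (π : MDPPolicy S A) {h : ℕ} (h1 : 1 ≤ h) (s : S) : 0 ≤ M.value π h s := by
  rcases le_or_gt h (M.H + 1) with hh | hh
  · exact (value_mem M π (M.H + 1 - h) h (by omega) h1 s).1
  · rw [value_of_lt M π (by omega)]

lemma value_le (π : MDPPolicy S A) {h : ℕ} (h1 : 1 ≤ h) (s : S) : M.value π h s ≤ M.H := by
  rcases le_or_gt h (M.H + 1) with hh | hh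
  · refine (value_mem M π (M.H + 1 - h) h (by omega) h1 s).2.trans ?_
    exact_mod_cast (by omega : M.H + 1 - h ≤ M.H)
  · rw [value_of_lt M π (by omega)]; positivity

lemma bddAbove_value {h : ℕ} (h1 : 1 ≤ h) (s : S) :
    BddAbove (Set.range fun π : MDPPolicy S A => M.value π h s) :=
  ⟨M.H, by rintro _ ⟨π, rfl⟩; exact value_le M π h1 s⟩

lemma value_le_optValue (π : MDPPolicy S A) {h : ℕ} (h1 : 1 ≤ h) (s : S) :
    M.value π h s ≤ M.optValue h s := le_ciSup (bddAbove_value M h1 s) π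

omit [Fintype S] in
lemma detPolicy_sum (d : ℕ → S → A) (h : ℕ) (s : S) (f : A → ℝ) :
    ∑ a, detPolicy d h s a * f a = f (d h s) := by
  have : ∀ a, (detPolicy d h s a : ℝ) = if a = d h s then 1 else 0 := by
    intro a
    change (Pi.single (d h s) (1 : ℝ) : A → ℝ) a = _
    rw [Pi.single_apply]
  simp [this]

lemma value_detPolicy (d : ℕ → S → A) {h : ℕ} (hh : h ≤ M.H) (s : S) :
    M.value (detPolicy d) h s
      = M.r h s (d h s) + M.nextMean h s (d h s) (M.value (detPolicy d) (h + 1)) := by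
  rw [value_eq M _ hh, detPolicy_sum d h s]

variable [Nonempty A]

instance : Nonempty (MDPPolicy S A) := ⟨detPolicy fun _ _ => Classical.arbitrary A⟩

lemma optValue_of_lt {h : ℕ} (hh : M.H < h) (s : S) : M.optValue h s = 0 := by
  unfold optValue; simp [value_of_lt M _ hh]

lemma optValue_nonneg {h : ℕ} (h1 : 1 ≤ h) (s : S) : 0 ≤ M.optValue h s :=
  (value_nonneg M (Classical.arbitrary _) h1 s).trans (value_le_optValue M _ h1 s)

lemma optValue_le {h : ℕ} (h1 : 1 ≤ h) (s : S) : M.optValue h s ≤ M.H :=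
  ciSup_le fun π => value_le M π h1 s

/-- The greedy action with respect to `Q^⋆`. -/
noncomputable def optAction (h : ℕ) (s : S) : A :=
  (Finite.exists_max (M.optQ h s)).choose

lemma optQ_le_optAction (h : ℕ) (s : S) (a : A) : M.optQ h s a ≤ M.optQ h s (M.optAction h s) :=
  (Finite.exists_max (M.optQ h s)).choose_spec a

lemma optValue_le_optQ {h : ℕ} (h1 : 1 ≤ h) (hh : h ≤ M.H) (s : S) :
    M.optValue h s ≤ M.optQ h s (M.optAction h s) := by
  refine ciSup_le fun π => ?_
  rw [value_eq M π hh]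
  calc _ ≤ ∑ a, π h s a * M.optQ h s (M.optAction h s) := by
        refine sum_le_sum fun a _ => mul_le_mul_of_nonneg_left ?_ (by simp)
        refine le_trans ?_ (optQ_le_optAction M h s a)
        unfold optQ
        gcongr
        exact nextMean_mono fun y => value_le_optValue M π (by omega) y
    _ = _ := by rw [← sum_mul]; simp

/-- The greedy policy with respect to `Q^⋆` is optimal at all states simultaneously. -/
lemma value_optAction (d : ℕ) : ∀ h, h + d = M.H + 1 → 1 ≤ h → ∀ s,
    M.value (detPolicy M.optAction) h s = M.optValue h s := by
  induction d with
  | zero => intro h hh _ s; rw [value_of_lt M _ (by omega), optValue_of_lt M (by omega)]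
  | succ d ih =>
    intro h hh h1 s
    refine le_antisymm (value_le_optValue M _ h1 s) ?_
    refine (optValue_le_optQ M h1 (by omega) s).trans_eq ?_
    rw [value_detPolicy M _ (by omega)]
    unfold optQ
    rw [funext (ih (h + 1) (by omega) (by omega))]

lemma optValue_eq {h : ℕ} (h1 : 1 ≤ h) (hh : h ≤ M.H) (s : S) :
    M.optValue h s = M.optQ h s (M.optAction h s) := by
  refine le_antisymm (optValue_le_optQ M h1 hh s) ?_
  refine le_trans (le_of_eq ?_) (value_le_optValue M (detPolicy M.optAction) h1 s)
  rw [value_detPolicy M _ hh]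
  unfold optQ
  rw [funext (value_optAction M (M.H + 1 - (h + 1)) (h + 1) (by omega) (by omega))]

lemma optQ_le_optValue {h : ℕ} (h1 : 1 ≤ h) (hh : h ≤ M.H) (s : S) (a : A) :
    M.optQ h s a ≤ M.optValue h s :=
  (optQ_le_optAction M h s a).trans_eq (optValue_eq M h1 hh s).symm

lemma gap_nonneg {h : ℕ} (h1 : 1 ≤ h) (hh : h ≤ M.H) (s : S) (a : A) : 0 ≤ M.gap h s a :=
  sub_nonneg.mpr (optQ_le_optValue M h1 hh s a)

lemma optQ_nonneg {h : ℕ} (h1 : 1 ≤ h) (hh : h ≤ M.H) (s : S) (a : A) : 0 ≤ M.optQ h s a :=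
  add_nonneg (M.r_mem h (by simp; omega) s a).1
    (le_nextMean fun y => optValue_nonneg M (by omega) y)

lemma gap_le {h : ℕ} (h1 : 1 ≤ h) (hh : h ≤ M.H) (s : S) (a : A) : M.gap h s a ≤ M.H := by
  unfold gap; linarith [optValue_le M h1 s, optQ_nonneg M h1 hh s a]

omit [Nonempty A] in
lemma finite_positiveGaps : M.positiveGaps.Finite := by
  refine Set.Finite.subset (((Icc 1 M.H) ×ˢ (univ : Finset (S × A))).image
    (fun q => M.gap q.1 q.2.1 q.2.2)).finite_toSet ?_
  rintro g ⟨_, h, hh, s, a, rfl⟩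
  simp only [coe_image, Set.mem_image, mem_coe]
  exact ⟨(h, s, a), by simpa using hh, rfl⟩

omit [Nonempty A] in
lemma minGap_mem (hM : M.positiveGaps.Nonempty) : M.minGap ∈ M.positiveGaps :=
  hM.csInf_mem (finite_positiveGaps M)

omit [Nonempty A] in
lemma minGap_pos (hM : M.positiveGaps.Nonempty) : 0 < M.minGap := (minGap_mem M hM).1

omit [Nonempty A] in
lemma minGap_le {h : ℕ} (h1 : 1 ≤ h) (hh : h ≤ M.H) (s : S) (a : A) (hpos : 0 < M.gap h s a) :
    M.minGap ≤ M.gap h s a :=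
  csInf_le (finite_positiveGaps M).bddBelow ⟨hpos, h, by simp; omega, s, a, rfl⟩

omit [Nonempty A] in
lemma nextVar_le_maxCondVar {h : ℕ} (h1 : 1 ≤ h) (hh : h ≤ M.H) (s : S) (a : A) :
    M.nextVar h s a (M.optValue (h + 1)) ≤ M.maxCondVar := by
  refine le_csSup ?_ ⟨h, by simp; omega, s, a, rfl⟩
  refine Set.Finite.bddAbove (Set.Finite.subset (((Icc 1 M.H) ×ˢ (univ : Finset (S × A))).image
    (fun q => M.nextVar q.1 q.2.1 q.2.2 (M.optValue (q.1 + 1)))).finite_toSet ?_)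
  rintro g ⟨h, hh, s, a, rfl⟩
  simp only [coe_image, Set.mem_image, mem_coe]
  exact ⟨(h, s, a), by simpa using hh, rfl⟩

/-- A positive gap needs a second action. -/
lemma two_le_card (hM : M.positiveGaps.Nonempty) : 2 ≤ Fintype.card A := by
  obtain ⟨g, hg, h, hh, s, a, rfl⟩ := hM
  simp only [mem_Icc] at hh
  by_contra hlt
  have : Subsingleton A := Fintype.card_le_one_iff_subsingleton.mp (by omega)
  have : M.gap h s a = 0 := by
    unfold gap
    rw [optValue_eq M hh.1 hh.2, Subsingleton.elim (M.optAction h s) a, sub_self]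
  linarith

end EpisodicMDP

namespace QESA
open scoped Classical

variable {S A : Type*}

/-! ### Dynamics of the tables -/

/-- The tables `t` and `t'` have the same entries at step `h`. -/
structure AgreeAt (h : ℕ) (t t' : QESATables S A) : Prop where
  N : t.N h = t'.N h
  Q : t.Q h = t'.Q h
  QUCB : t.QUCB h = t'.QUCB h
  QLCB : t.QLCB h = t'.QLCB h
  QR : t.QR h = t'.QR h
  μref : t.μref h = t'.μref h
  σref : t.σref h = t'.σref h
  μadv : t.μadv h = t'.μadv h
  σadv : t.σadv h = t'.σadv h
  BR : t.BR h = t'.BR h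
  V : t.V h = t'.V h
  VLCB : t.VLCB h = t'.VLCB h
  VR : t.VR h = t'.VR h
  u : t.u h = t'.u h

lemma AgreeAt.refl (h : ℕ) (t : QESATables S A) : AgreeAt h t t := by
  constructor <;> rfl

lemma AgreeAt.trans {h : ℕ} {t t' t'' : QESATables S A} (h1 : AgreeAt h t t')
    (h2 : AgreeAt h t' t'') : AgreeAt h t t'' := by
  cases h1; cases h2; constructor <;> (simp_all only)

variable [Fintype S] [Fintype A] (M : EpisodicMDP S A) (p : QESAParams)

omit [Fintype S] [Fintype A] in
lemma writeStateAction_of_ne {α : Type*} (f : ℕ → S → A → α) {h h' : ℕ} (hh : h' ≠ h) (s : S)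
    (a : A) (v : α) : writeStateAction f h s a v h' = f h' := by
  funext s' a'; simp [writeStateAction, hh]

omit [Fintype S] in
lemma writeState_of_ne {α : Type*} (f : ℕ → S → α) {h h' : ℕ} (hh : h' ≠ h) (s : S) (v : α) :
    writeState f h s v h' = f h' := by
  funext s'; simp [writeState, hh]

omit [Fintype S] [Fintype A] in
lemma writeStateAction_congr {α : Type*} {f g : ℕ → S → A → α} {h : ℕ} (hfg : f h = g h) (s : S)
    (a : A) (v : α) : writeStateAction f h s a v h = writeStateAction g h s a v h := by
  funext s' a'; simp [writeStateAction, hfg]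

omit [Fintype S] in
lemma writeState_congr {α : Type*} {f g : ℕ → S → α} {h : ℕ} (hfg : f h = g h) (s : S) (v : α) :
    writeState f h s v h = writeState g h s v h := by
  funext s'; simp [writeState, hfg]

lemma step_agreeAt_of_ne {h h' : ℕ} (hh : h' ≠ h) (t : QESATables S A) (s : S) (a : A) (s' : S) :
    AgreeAt h' (step M p t h s a s') t := by
  constructor <;> simp only [step] <;> first
    | exact writeStateAction_of_ne _ hh _ _ _
    | exact writeState_of_ne _ hh _ _
    | (split_ifs <;> first | rfl | exact writeState_of_ne _ hh _ _)

lemma step_congr {h : ℕ} {t t' : QESATables S A} (h0 : AgreeAt h t t') (h1 : AgreeAt (h + 1) t t')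
    (s : S) (a : A) (s' : S) : AgreeAt h (step M p t h s a s') (step M p t' h s a s') := by
  have e2 := fun v => writeStateAction_congr h0.Q s a v
  have e4 := fun v => writeStateAction_congr h0.QLCB s a v
  constructor <;> simp only [step, h0.N, h0.Q, h0.QUCB, h0.QLCB, h0.QR, h0.μref, h0.σref, h0.μadv,
    h0.σadv, h0.BR, h0.VLCB, h0.u, h1.V, h1.VLCB, h1.VR, e2, e4]
  · exact writeStateAction_congr h0.N _ _ _
  · exact writeStateAction_congr h0.QUCB _ _ _
  · exact writeStateAction_congr h0.QR _ _ _
  · exact writeStateAction_congr h0.μref _ _ _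
  · exact writeStateAction_congr h0.σref _ _ _
  · exact writeStateAction_congr h0.μadv _ _ _
  · exact writeStateAction_congr h0.σadv _ _ _
  · exact writeStateAction_congr h0.BR _ _ _
  · exact writeState_congr h0.V _ _
  · exact writeState_congr h0.VLCB _ _
  · split_ifs
    · exact writeState_congr h0.VR _ _
    · exact h0.VR
  · split_ifs
    · exact h0.u
    · exact writeState_congr h0.u _ _

variable (x : ℕ → ℕ → S) (d : ℕ → ℕ → S → A)

lemma afterSteps_agreeAt_of_lt (t : QESATables S A) (y : ℕ → S) (e : ℕ → S → A) {m h : ℕ}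
    (hh : m < h) : AgreeAt h (afterSteps M p t y e m) t := by
  induction m with
  | zero => exact AgreeAt.refl _ _
  | succ m ih => exact (step_agreeAt_of_ne M p (by omega) _ _ _ _).trans (ih (by omega))

lemma afterSteps_agreeAt (t : QESATables S A) (y : ℕ → S) (e : ℕ → S → A) {m h : ℕ}
    (h1 : 1 ≤ h) (hh : h ≤ m) :
    AgreeAt h (afterSteps M p t y e m) (step M p t h (y h) (e h (y h)) (y (h + 1))) := by
  induction m, hh using Nat.le_induction with
  | base =>
    obtain ⟨m, rfl⟩ : ∃ m, h = m + 1 := ⟨h - 1, by omega⟩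
    exact step_congr M p (afterSteps_agreeAt_of_lt M p t y e (by omega))
      (afterSteps_agreeAt_of_lt M p t y e (by omega)) _ _ _
  | succ m hm ih => exact (step_agreeAt_of_ne M p (by omega) _ _ _ _).trans ih

/-- The state-action pair visited at step `h` of episode `j + 1`. -/
def cell (h j : ℕ) : S × A := (x (j + 1) h, d (j + 1) h (x (j + 1) h))

local notation "T" => tables M p x d

/-- During an episode, the entries at step `h` change only by the update at step `h`, which reads
the tables held at the start of the episode. -/
lemma tables_succ_agreeAt (k : ℕ) {h : ℕ} (hh : h ∈ Icc 1 M.H) :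
    AgreeAt h (T (k + 1)) (step M p (T k) h (cell x d h k).1 (cell x d h k).2 (x (k + 1) (h + 1))) := by
  simp only [mem_Icc] at hh
  exact afterSteps_agreeAt M p (T k) (x (k + 1)) (d (k + 1)) hh.1 hh.2

lemma tables_last (k : ℕ) : AgreeAt (M.H + 1) (T k) (init M) := by
  induction k with
  | zero => exact AgreeAt.refl _ _
  | succ k ih => exact (afterSteps_agreeAt_of_lt M p _ _ _ (by omega)).trans ih

lemma V_last (k : ℕ) (s : S) : (T k).V (M.H + 1) s = 0 := by
  rw [(tables_last M p x d k).V]; simp [init]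

lemma VLCB_last (k : ℕ) (s : S) : (T k).VLCB (M.H + 1) s = 0 := by
  rw [(tables_last M p x d k).VLCB]; simp [init]

lemma VR_last (k : ℕ) (s : S) : (T k).VR (M.H + 1) s = 0 := by
  rw [(tables_last M p x d k).VR]; simp [init]

section unvisited
variable {M p x d} {k h : ℕ} (hh : h ∈ Icc 1 M.H)
include hh

lemma entries_of_ne {z : S × A} (hz : cell x d h k ≠ z) :
    (T (k + 1)).N h z.1 z.2 = (T k).N h z.1 z.2 ∧ (T (k + 1)).Q h z.1 z.2 = (T k).Q h z.1 z.2 ∧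
    (T (k + 1)).QUCB h z.1 z.2 = (T k).QUCB h z.1 z.2 ∧
    (T (k + 1)).QLCB h z.1 z.2 = (T k).QLCB h z.1 z.2 ∧
    (T (k + 1)).QR h z.1 z.2 = (T k).QR h z.1 z.2 ∧
    (T (k + 1)).μref h z.1 z.2 = (T k).μref h z.1 z.2 ∧
    (T (k + 1)).σref h z.1 z.2 = (T k).σref h z.1 z.2 ∧
    (T (k + 1)).μadv h z.1 z.2 = (T k).μadv h z.1 z.2 ∧
    (T (k + 1)).σadv h z.1 z.2 = (T k).σadv h z.1 z.2 ∧
    (T (k + 1)).BR h z.1 z.2 = (T k).BR h z.1 z.2 := by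
  have e := tables_succ_agreeAt M p x d k hh
  have hne : ¬ (z.1 = (cell x d h k).1 ∧ z.2 = (cell x d h k).2) := fun h' =>
    hz (Prod.ext h'.1.symm h'.2.symm)
  rw [e.N, e.Q, e.QUCB, e.QLCB, e.QR, e.μref, e.σref, e.μadv, e.σadv, e.BR]
  simp only [step, writeStateAction, true_and, hne, if_false, and_self]

lemma state_entries_of_ne {s : S} (hs : x (k + 1) h ≠ s) :
    (T (k + 1)).V h s = (T k).V h s ∧ (T (k + 1)).VLCB h s = (T k).VLCB h s ∧
    (T (k + 1)).VR h s = (T k).VR h s ∧ (T (k + 1)).u h s = (T k).u h s := by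
  have e := tables_succ_agreeAt M p x d k hh
  have hne : ¬ (s = (cell x d h k).1) := fun h' => hs h'.symm
  rw [e.V, e.VLCB, e.VR, e.u]
  refine ⟨?_, ?_, ?_, ?_⟩
  · simp only [step, writeState, hne, and_false, if_false]
  · simp only [step, writeState, hne, and_false, if_false]
  · simp only [step]; split_ifs <;> simp only [writeState, hne, and_false, if_false]
  · simp only [step]; split_ifs <;> simp only [writeState, hne, and_false, if_false]

end unvisited

lemma N_eq_cnt {h : ℕ} (hh : h ∈ Icc 1 M.H) (z : S × A) (k : ℕ) :
    (T k).N h z.1 z.2 = cnt (cell x d h) z k := by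
  induction k with
  | zero => simp [tables, init]
  | succ k ih =>
    by_cases hz : cell x d h k = z
    · rw [cnt_succ_of_eq hz, ← ih, (tables_succ_agreeAt M p x d k hh).N]
      simp [step, writeStateAction, hz]
    · rw [cnt_succ_of_ne hz, ← ih, (entries_of_ne hh hz).1]

/-- The bonus `B_h^R` computed from the moments held in the tables `t` after `n` visits. -/
noncomputable def bonus (t : QESATables S A) (h : ℕ) (z : S × A) (n : ℕ) : ℝ :=
  p.cb * √(iota M p / n) * (√(t.σref h z.1 z.2 - t.μref h z.1 z.2 ^ 2)
    + √M.H * √(t.σadv h z.1 z.2 - t.μadv h z.1 z.2 ^ 2))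

section visited
variable {M p x d} {k h : ℕ} (hh : h ∈ Icc 1 M.H) {z : S × A} (hz : cell x d h k = z)
include hh hz

lemma QUCB_visit : (T (k + 1)).QUCB h z.1 z.2
    = (1 - lr M.H (cnt (cell x d h) z k + 1)) * (T k).QUCB h z.1 z.2
      + lr M.H (cnt (cell x d h) z k + 1) * (M.r h z.1 z.2 + (T k).V (h + 1) (x (k + 1) (h + 1))
        + p.cb * √((M.H : ℝ) ^ 3 * iota M p / (cnt (cell x d h) z k + 1 : ℕ))) := by
  rw [(tables_succ_agreeAt M p x d k hh).QUCB, ← N_eq_cnt M p x d hh, hz]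
  simp only [step, writeStateAction, and_self, if_true, lr]

lemma QLCB_visit : (T (k + 1)).QLCB h z.1 z.2
    = (1 - lr M.H (cnt (cell x d h) z k + 1)) * (T k).QLCB h z.1 z.2
      + lr M.H (cnt (cell x d h) z k + 1) * (M.r h z.1 z.2 + (T k).VLCB (h + 1) (x (k + 1) (h + 1))
        - p.cb * √((M.H : ℝ) ^ 3 * iota M p / (cnt (cell x d h) z k + 1 : ℕ))) := by
  rw [(tables_succ_agreeAt M p x d k hh).QLCB, ← N_eq_cnt M p x d hh, hz]
  simp only [step, writeStateAction, and_self, if_true, lr]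

lemma μref_visit : (T (k + 1)).μref h z.1 z.2
    = (1 - 1 / ((cnt (cell x d h) z k + 1 : ℕ) : ℝ)) * (T k).μref h z.1 z.2
      + 1 / ((cnt (cell x d h) z k + 1 : ℕ) : ℝ) * (T k).VR (h + 1) (x (k + 1) (h + 1)) := by
  rw [(tables_succ_agreeAt M p x d k hh).μref, ← N_eq_cnt M p x d hh, hz]
  simp only [step, writeStateAction, and_self, if_true]

lemma σref_visit : (T (k + 1)).σref h z.1 z.2
    = (1 - 1 / ((cnt (cell x d h) z k + 1 : ℕ) : ℝ)) * (T k).σref h z.1 z.2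
      + 1 / ((cnt (cell x d h) z k + 1 : ℕ) : ℝ) * (T k).VR (h + 1) (x (k + 1) (h + 1)) ^ 2 := by
  rw [(tables_succ_agreeAt M p x d k hh).σref, ← N_eq_cnt M p x d hh, hz]
  simp only [step, writeStateAction, and_self, if_true]

lemma μadv_visit : (T (k + 1)).μadv h z.1 z.2
    = (1 - lr M.H (cnt (cell x d h) z k + 1)) * (T k).μadv h z.1 z.2
      + lr M.H (cnt (cell x d h) z k + 1) * ((T k).V (h + 1) (x (k + 1) (h + 1))
        - (T k).VR (h + 1) (x (k + 1) (h + 1))) := by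
  rw [(tables_succ_agreeAt M p x d k hh).μadv, ← N_eq_cnt M p x d hh, hz]
  simp only [step, writeStateAction, and_self, if_true, lr]

lemma σadv_visit : (T (k + 1)).σadv h z.1 z.2
    = (1 - lr M.H (cnt (cell x d h) z k + 1)) * (T k).σadv h z.1 z.2
      + lr M.H (cnt (cell x d h) z k + 1) * ((T k).V (h + 1) (x (k + 1) (h + 1))
        - (T k).VR (h + 1) (x (k + 1) (h + 1))) ^ 2 := by
  rw [(tables_succ_agreeAt M p x d k hh).σadv, ← N_eq_cnt M p x d hh, hz]
  simp only [step, writeStateAction, and_self, if_true, lr]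

lemma BR_visit : (T (k + 1)).BR h z.1 z.2
    = bonus M p (T (k + 1)) h z (cnt (cell x d h) z k + 1) := by
  have e := tables_succ_agreeAt M p x d k hh
  unfold bonus
  rw [e.BR, e.σref, e.μref, e.σadv, e.μadv, ← N_eq_cnt M p x d hh, hz]
  simp only [step, writeStateAction, and_self, if_true]

lemma QR_visit (hH : 1 ≤ (M.H : ℝ)) : (T (k + 1)).QR h z.1 z.2 - (T (k + 1)).BR h z.1 z.2
    = (1 - lr M.H (cnt (cell x d h) z k + 1)) * ((T k).QR h z.1 z.2 - (T k).BR h z.1 z.2)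
      + lr M.H (cnt (cell x d h) z k + 1) * (M.r h z.1 z.2 + (T k).V (h + 1) (x (k + 1) (h + 1))
        - (T k).VR (h + 1) (x (k + 1) (h + 1)) + (T (k + 1)).μref h z.1 z.2
        + p.cb * ((M.H : ℝ) ^ 2 * iota M p
          / ((cnt (cell x d h) z k + 1 : ℕ) : ℝ) ^ (3 / 4 : ℝ))) := by
  have e := tables_succ_agreeAt M p x d k hh
  have hl := (lr_pos hH (cnt (cell x d h) z k + 1)).ne'
  rw [← N_eq_cnt M p x d hh] at hl ⊢
  rw [e.QR, e.BR, e.μref, hz]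
  simp only [step, writeStateAction, and_self, if_true]
  unfold lr at hl ⊢
  field_simp
  ring

lemma Q_visit : (T (k + 1)).Q h z.1 z.2
    = min (min ((T (k + 1)).QR h z.1 z.2) ((T (k + 1)).QUCB h z.1 z.2)) ((T k).Q h z.1 z.2) := by
  have e := tables_succ_agreeAt M p x d k hh
  rw [e.Q, e.QR, e.QUCB, hz]
  simp only [step, writeStateAction, and_self, if_true]

end visited

section visitedState
variable {M p x d} {k h : ℕ} (hh : h ∈ Icc 1 M.H) {s : S} (hs : x (k + 1) h = s)
include hh hs

lemma V_visit : (T (k + 1)).V h s = ⨆ a, (T (k + 1)).Q h s a := by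
  have e := tables_succ_agreeAt M p x d k hh
  have hs' : s = (cell x d h k).1 := hs.symm
  rw [e.V, e.Q, hs']
  simp only [step, writeState, and_self, if_true]

lemma VLCB_visit : (T (k + 1)).VLCB h s
    = max (⨆ a, (T (k + 1)).QLCB h s a) ((T k).VLCB h s) := by
  have e := tables_succ_agreeAt M p x d k hh
  have hs' : s = (cell x d h k).1 := hs.symm
  rw [e.VLCB, e.QLCB, hs']
  simp only [step, writeState, and_self, if_true]

lemma VR_visit : (T (k + 1)).VR h s = if (T (k + 1)).V h s - (T (k + 1)).VLCB h s > p.β ∨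
    (T k).u h s = true then (T (k + 1)).V h s else (T k).VR h s := by
  have e := tables_succ_agreeAt M p x d k hh
  have hs' : s = (cell x d h k).1 := hs.symm
  rw [e.V, e.VLCB, e.VR, hs']
  simp only [step, writeState, and_self, if_true]
  split_ifs <;> simp only [writeState, and_self, if_true]

lemma u_visit : (T (k + 1)).u h s = if (T (k + 1)).V h s - (T (k + 1)).VLCB h s > p.β
    then (T k).u h s else false := by
  have e := tables_succ_agreeAt M p x d k hh
  have hs' : s = (cell x d h k).1 := hs.symm
  rw [e.V, e.VLCB, e.u, hs']
  simp only [step, writeState, and_self, if_true]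
  split_ifs <;> simp only [writeState, and_self, if_true]

end visitedState

/-! ### Invariants of the tables -/

section invariants
variable {M p x d} {h : ℕ} (hh : h ∈ Icc 1 M.H)
include hh

lemma Q_succ_le (k : ℕ) (s : S) (a : A) : (T (k + 1)).Q h s a ≤ (T k).Q h s a := by
  by_cases hz : cell x d h k = (s, a)
  · rw [Q_visit hh hz]; exact min_le_right _ _
  · exact (entries_of_ne hh hz).2.1.le

lemma Q_le_QUCB_QR (k : ℕ) (s : S) (a : A) :
    (T k).Q h s a ≤ (T k).QUCB h s a ∧ (T k).Q h s a ≤ (T k).QR h s a := by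
  induction k with
  | zero => simp [tables, init]
  | succ k ih =>
    by_cases hz : cell x d h k = (s, a)
    · rw [Q_visit hh hz]
      exact ⟨(min_le_left _ _).trans (min_le_right _ _), (min_le_left _ _).trans (min_le_left _ _)⟩
    · have e := entries_of_ne (p := p) hh hz
      rw [e.2.1, e.2.2.1, e.2.2.2.2.1]; exact ih

variable [Nonempty A]

lemma V_eq_iSup (k : ℕ) (s : S) : (T k).V h s = ⨆ a, (T k).Q h s a := by
  induction k with
  | zero =>
    simp only [mem_Icc] at hh
    simp [tables, init, hh.2]
  | succ k ih =>
    by_cases hs : x (k + 1) h = s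
    · exact V_visit hh hs
    · rw [(state_entries_of_ne hh hs).1, ih]
      congr 1; funext a
      exact (entries_of_ne hh (z := (s, a)) fun hc => hs (congrArg Prod.fst hc)).2.1.symm

lemma V_succ_le (k : ℕ) (s : S) : (T (k + 1)).V h s ≤ (T k).V h s := by
  rw [V_eq_iSup hh, V_eq_iSup hh]
  exact ciSup_mono (Set.finite_range _).bddAbove fun a => Q_succ_le hh k s a

lemma V_anti {k k' : ℕ} (hk : k ≤ k') (s : S) : (T k').V h s ≤ (T k).V h s :=
  antitone_nat_of_succ_le (f := fun k => (T k).V h s) (fun k => V_succ_le hh k s) hk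

lemma V_le (k : ℕ) (s : S) : (T k).V h s ≤ M.H := by
  refine (V_anti hh (Nat.zero_le k) s).trans ?_
  simp only [mem_Icc] at hh
  simp [tables, init, hh.2]

omit [Nonempty A] in
lemma VLCB_le_succ (k : ℕ) (s : S) : (T k).VLCB h s ≤ (T (k + 1)).VLCB h s := by
  by_cases hs : x (k + 1) h = s
  · rw [VLCB_visit hh hs]; exact le_max_right _ _
  · exact (state_entries_of_ne hh hs).2.1.ge

omit [Nonempty A] in
lemma VLCB_mono {k k' : ℕ} (hk : k ≤ k') (s : S) : (T k).VLCB h s ≤ (T k').VLCB h s :=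
  monotone_nat_of_le_succ (f := fun k => (T k).VLCB h s) (fun k => VLCB_le_succ hh k s) hk

omit [Nonempty A] in
lemma VLCB_nonneg (k : ℕ) (s : S) : 0 ≤ (T k).VLCB h s := by
  refine le_trans ?_ (VLCB_mono hh (Nat.zero_le k) s)
  simp [tables, init]

omit [Nonempty A] in
lemma QLCB_le_VLCB (k : ℕ) (s : S) (a : A) : (T k).QLCB h s a ≤ (T k).VLCB h s := by
  induction k with
  | zero => simp [tables, init]
  | succ k ih =>
    by_cases hs : x (k + 1) h = s
    · rw [VLCB_visit hh hs]
      exact (le_ciSup (Set.finite_range _).bddAbove a).trans (le_max_left _ _)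
    · rw [(state_entries_of_ne hh hs).2.1,
        (entries_of_ne hh (z := (s, a)) fun hc => hs (congrArg Prod.fst hc)).2.2.2.1]
      exact ih

/-- Before settling, the reference value is the current value; a settled reference value exceeds
the current value, and exceeds the lower confidence value by at most `β`. -/
lemma VR_cases (k : ℕ) (s : S) :
    ((T k).u h s = true ∧ (T k).VR h s = (T k).V h s) ∨
    ((T k).u h s = false ∧ (T k).V h s ≤ (T k).VR h s ∧
      (T k).VR h s ≤ (T k).VLCB h s + p.β) := by
  induction k with
  | zero => left; simp [tables, init]
  | succ k ih =>
    by_cases hs : x (k + 1) h = s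
    · have hV := V_succ_le (p := p) (x := x) (d := d) hh k s
      have hL := VLCB_le_succ (p := p) (x := x) (d := d) hh k s
      rw [VR_visit hh hs, u_visit hh hs]
      by_cases hβ : (T (k + 1)).V h s - (T (k + 1)).VLCB h s > p.β
      · left
        rcases ih with ⟨h1, h2⟩ | ⟨h1, h2, h3⟩
        · simp [hβ, h1]
        · exfalso; linarith
      · right
        rcases ih with ⟨h1, h2⟩ | ⟨h1, h2, h3⟩
        · simp only [hβ, h1, or_true, if_true, if_false, le_refl, true_and]
          linarith
        · simp only [hβ, h1, if_false, true_and, Bool.false_eq_true, or_self]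
          constructor <;> linarith
    · have e := state_entries_of_ne (p := p) (d := d) hh hs
      rw [e.1, e.2.1, e.2.2.1, e.2.2.2]; exact ih

omit [Nonempty A] in
lemma u_succ (k : ℕ) (s : S) (hu : (T (k + 1)).u h s = true) : (T k).u h s = true := by
  by_cases hs : x (k + 1) h = s
  · rw [u_visit hh hs] at hu
    split_ifs at hu; exact hu
  · rw [← (state_entries_of_ne hh hs).2.2.2]; exact hu

/-- Settled reference values do not change. -/
lemma VR_succ_of_settled (k : ℕ) (s : S) (hu : (T k).u h s = false) :
    (T (k + 1)).VR h s = (T k).VR h s ∧ (T (k + 1)).u h s = false := by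
  by_cases hs : x (k + 1) h = s
  · have hu' : (T (k + 1)).u h s = false := by
      by_contra hc
      have := u_succ hh k s (by simpa using hc)
      simp [this] at hu
    refine ⟨?_, hu'⟩
    rw [VR_visit hh hs, if_neg]
    rintro (hβ | hc)
    · rcases VR_cases (p := p) (x := x) (d := d) hh k s with ⟨h1, _⟩ | ⟨_, h2, h3⟩
      · simp [h1] at hu
      · linarith [V_succ_le (p := p) (x := x) (d := d) hh k s,
          VLCB_le_succ (p := p) (x := x) (d := d) hh k s]
    · simp [hc] at hu
  · have e := state_entries_of_ne (p := p) (d := d) hh hs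
    exact ⟨e.2.2.1, by rw [e.2.2.2]; exact hu⟩

lemma VR_of_settled {k k' : ℕ} (hk : k ≤ k') (s : S) (hu : (T k).u h s = false) :
    (T k').VR h s = (T k).VR h s := by
  have : (T k').VR h s = (T k).VR h s ∧ (T k').u h s = false := by
    induction k', hk using Nat.le_induction with
    | base => exact ⟨rfl, hu⟩
    | succ m _ ih =>
      have := VR_succ_of_settled hh m s ih.2
      exact ⟨this.1.trans ih.1, this.2⟩
  exact this.1

lemma V_le_VR (k : ℕ) (s : S) : (T k).V h s ≤ (T k).VR h s := by
  rcases VR_cases (p := p) (x := x) (d := d) hh k s with ⟨_, h2⟩ | ⟨_, h2, _⟩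
  exacts [h2.ge, h2]

lemma VR_succ_le (k : ℕ) (s : S) : (T (k + 1)).VR h s ≤ (T k).VR h s := by
  by_cases hs : x (k + 1) h = s
  · rw [VR_visit hh hs]
    split_ifs
    · exact (V_succ_le hh k s).trans (V_le_VR hh k s)
    · exact le_rfl
  · exact (state_entries_of_ne hh hs).2.2.1.le

lemma VR_anti {k k' : ℕ} (hk : k ≤ k') (s : S) :
    (T k').VR h s ≤ (T k).VR h s :=
  antitone_nat_of_succ_le (f := fun k => (T k).VR h s) (fun k => VR_succ_le hh k s) hk

lemma VR_le (k : ℕ) (s : S) : (T k).VR h s ≤ M.H := by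
  refine (VR_anti hh (Nat.zero_le k) s).trans ?_
  simp only [mem_Icc] at hh
  simp [tables, init, hh.2]

end invariants

/-! ### Explicit form of the estimates -/

section explicit
variable {M p x d} {h : ℕ} (hh : h ∈ Icc 1 M.H)
include hh

lemma QUCB_eq (z : S × A) (k : ℕ) : (T k).QUCB h z.1 z.2
    = etaW M.H 0 (cnt (cell x d h) z k) * M.H + ∑ j ∈ visits (cell x d h) z k,
        etaW M.H (cnt (cell x d h) z j + 1) (cnt (cell x d h) z k) *
          (M.r h z.1 z.2 + (T j).V (h + 1) (x (j + 1) (h + 1))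
            + p.cb * √((M.H : ℝ) ^ 3 * iota M p / (cnt (cell x d h) z j + 1 : ℕ))) :=
  eta_recursion (F := fun k => (T k).QUCB h z.1 z.2) (fun _ hk => QUCB_visit hh hk)
    (fun _ hk => (entries_of_ne hh hk).2.2.1) k

lemma QLCB_eq (z : S × A) (k : ℕ) : (T k).QLCB h z.1 z.2
    = ∑ j ∈ visits (cell x d h) z k,
        etaW M.H (cnt (cell x d h) z j + 1) (cnt (cell x d h) z k) *
          (M.r h z.1 z.2 + (T j).VLCB (h + 1) (x (j + 1) (h + 1))
            - p.cb * √((M.H : ℝ) ^ 3 * iota M p / (cnt (cell x d h) z j + 1 : ℕ))) := by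
  have := eta_recursion (F := fun k => (T k).QLCB h z.1 z.2) (fun _ hk => QLCB_visit hh hk)
    (fun _ hk => (entries_of_ne hh hk).2.2.2.1) k
  rw [this]
  simp [tables, init]

lemma μref_eq (z : S × A) (k : ℕ) : cnt (cell x d h) z k * (T k).μref h z.1 z.2
    = ∑ j ∈ visits (cell x d h) z k, (T j).VR (h + 1) (x (j + 1) (h + 1)) :=
  avg_recursion (F := fun k => (T k).μref h z.1 z.2) (fun _ hk => μref_visit hh hk)
    (fun _ hk => (entries_of_ne hh hk).2.2.2.2.2.1) k

lemma σref_eq (z : S × A) (k : ℕ) : cnt (cell x d h) z k * (T k).σref h z.1 z.2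
    = ∑ j ∈ visits (cell x d h) z k, (T j).VR (h + 1) (x (j + 1) (h + 1)) ^ 2 :=
  avg_recursion (F := fun k => (T k).σref h z.1 z.2)
    (y := fun j => (T j).VR (h + 1) (x (j + 1) (h + 1)) ^ 2) (fun _ hk => σref_visit hh hk)
    (fun _ hk => (entries_of_ne hh hk).2.2.2.2.2.2.1) k

lemma μadv_eq (z : S × A) (k : ℕ) : (T k).μadv h z.1 z.2
    = ∑ j ∈ visits (cell x d h) z k,
        etaW M.H (cnt (cell x d h) z j + 1) (cnt (cell x d h) z k) *
          ((T j).V (h + 1) (x (j + 1) (h + 1)) - (T j).VR (h + 1) (x (j + 1) (h + 1))) := by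
  have := eta_recursion (F := fun k => (T k).μadv h z.1 z.2) (fun _ hk => μadv_visit hh hk)
    (fun _ hk => (entries_of_ne hh hk).2.2.2.2.2.2.2.1) k
  rw [this]
  simp [tables, init]

lemma σadv_eq (z : S × A) (k : ℕ) : (T k).σadv h z.1 z.2
    = ∑ j ∈ visits (cell x d h) z k,
        etaW M.H (cnt (cell x d h) z j + 1) (cnt (cell x d h) z k) *
          ((T j).V (h + 1) (x (j + 1) (h + 1)) - (T j).VR (h + 1) (x (j + 1) (h + 1))) ^ 2 := by
  have := eta_recursion (F := fun k => (T k).σadv h z.1 z.2)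
    (y := fun j => ((T j).V (h + 1) (x (j + 1) (h + 1)) - (T j).VR (h + 1) (x (j + 1) (h + 1))) ^ 2)
    (fun _ hk => σadv_visit hh hk)
    (fun _ hk => (entries_of_ne hh hk).2.2.2.2.2.2.2.2.1) k
  rw [this]
  simp [tables, init]

lemma BR_eq (z : S × A) (k : ℕ) (hn : 1 ≤ cnt (cell x d h) z k) :
    (T k).BR h z.1 z.2 = bonus M p (T k) h z (cnt (cell x d h) z k) := by
  induction k with
  | zero => simp at hn
  | succ k ih =>
    by_cases hz : cell x d h k = z
    · rw [BR_visit hh hz, cnt_succ_of_eq hz]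
    · have e := entries_of_ne (p := p) hh hz
      rw [cnt_succ_of_ne hz] at hn ⊢
      unfold bonus at ih ⊢
      rw [e.2.2.2.2.2.1, e.2.2.2.2.2.2.1, e.2.2.2.2.2.2.2.1, e.2.2.2.2.2.2.2.2.1,
        e.2.2.2.2.2.2.2.2.2, ih hn]

/-- The reference-advantage estimate: the increments `δ^R` of the bonus are weighted so that their
average telescopes to the current bonus `B^R`. -/
lemma QR_eq (z : S × A) (k : ℕ) : (T k).QR h z.1 z.2
    = (T k).BR h z.1 z.2 + (etaW M.H 0 (cnt (cell x d h) z k) * M.H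
      + ∑ j ∈ visits (cell x d h) z k,
        etaW M.H (cnt (cell x d h) z j + 1) (cnt (cell x d h) z k) *
          (M.r h z.1 z.2 + (T j).V (h + 1) (x (j + 1) (h + 1))
            - (T j).VR (h + 1) (x (j + 1) (h + 1)) + (T (j + 1)).μref h z.1 z.2
            + p.cb * ((M.H : ℝ) ^ 2 * iota M p
              / ((cnt (cell x d h) z j + 1 : ℕ) : ℝ) ^ (3 / 4 : ℝ)))) := by
  have hH : 1 ≤ (M.H : ℝ) := by
    simp only [mem_Icc] at hh
    exact_mod_cast hh.1.trans hh.2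
  have := eta_recursion (F := fun k => (T k).QR h z.1 z.2 - (T k).BR h z.1 z.2)
    (fun _ hk => QR_visit hh hk hH)
    (fun _ hk => by rw [(entries_of_ne hh hk).2.2.2.2.1, (entries_of_ne hh hk).2.2.2.2.2.2.2.2.2]) k
  rw [← sub_eq_iff_eq_add', this]
  simp [tables, init]

end explicit

end QESA

namespace QESA
open scoped Classical

/-! ### Counting unsettled visits -/

lemma sum_cnt_le {Z : Type*} [Fintype Z] (c : ℕ → Z) (φ : ℕ → ℝ) (K : ℕ) (B : ℝ)
    (hB : ∀ n ≤ K, ∑ i ∈ range n, φ i ≤ B) :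
    ∑ j ∈ range K, φ (cnt c (c j) j) ≤ Fintype.card Z * B := by
  rw [sum_cells_visits (c := c)]
  calc ∑ z, ∑ j ∈ visits c z K, φ (cnt c (c j) j)
      = ∑ z, ∑ i ∈ range (cnt c z K), φ i := by
        refine sum_congr rfl fun z _ => ?_
        rw [← sum_visits_cnt φ K]
        refine sum_congr rfl fun j hj => ?_
        rw [(mem_visits.mp hj).2]
    _ ≤ ∑ _z : Z, B := sum_le_sum fun z _ => hB _ (cnt_le K)
    _ = _ := by simp

lemma sum_range_le_zero_add {φ : ℕ → ℝ} (h0 : ∀ i, 0 ≤ φ i) (n : ℕ) :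
    ∑ i ∈ range n, φ i ≤ φ 0 + ∑ i ∈ range n, φ (i + 1) := by
  rw [add_comm, ← sum_range_succ' φ n]
  exact sum_le_sum_of_subset_of_nonneg (by simp) fun i _ _ => h0 i

/-- Clipping of `C / √n` at the level `ε`. -/
noncomputable def clipSqrt (C ε : ℝ) (n : ℕ) : ℝ :=
  if √(n : ℝ) < C / ε then C * (1 / √(n : ℝ)) else 0

lemma clipSqrt_nonneg {C ε : ℝ} (hC : 0 ≤ C) (n : ℕ) : 0 ≤ clipSqrt C ε n := by
  unfold clipSqrt; split_ifs <;> positivity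

lemma le_add_clipSqrt {C ε : ℝ} (hε : 0 < ε) {n : ℕ} (hn : 1 ≤ n) :
    C / √(n : ℝ) ≤ ε + clipSqrt C ε n := by
  have : 0 < √(n : ℝ) := Real.sqrt_pos.mpr (by exact_mod_cast hn)
  unfold clipSqrt
  split_ifs with h
  · rw [mul_one_div]; linarith
  · rw [not_lt, div_le_iff₀ hε] at h
    rw [div_le_iff₀ this]; linarith

lemma sum_clipSqrt_le {C ε : ℝ} (hC : 0 ≤ C) (hε : 0 < ε) (n : ℕ) :
    ∑ i ∈ range n, clipSqrt C ε (i + 1) ≤ 2 * C ^ 2 / ε := by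
  calc ∑ i ∈ range n, clipSqrt C ε (i + 1)
      = C * ∑ i ∈ range n, (if √((i + 1 : ℕ) : ℝ) < C / ε then 1 / √((i + 1 : ℕ) : ℝ) else 0) := by
        unfold clipSqrt; rw [mul_sum]; simp only [mul_ite, mul_zero]
    _ ≤ C * (2 * (C / ε)) :=
        mul_le_mul_of_nonneg_left (sum_clipped_inv_sqrt_le (by positivity) n) hC
    _ = _ := by ring

variable {S A : Type*} [Fintype S] [Fintype A] {M : EpisodicMDP S A} {p : QESAParams}
  {x : ℕ → ℕ → S} {d : ℕ → ℕ → S → A}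

local notation "T" => tables M p x d

/-- The policies are greedy and the parameters are in the range of the analysis; `1 / 2 ≤ ι` holds
because a positive gap requires two actions.  Index conventions: `tables M p x d k` are the tables
after `k` episodes, while `x (k + 1)` and `d (k + 1)` belong to the episode played with them. -/
structure Admissible (M : EpisodicMDP S A) (p : QESAParams) (x : ℕ → ℕ → S)
    (d : ℕ → ℕ → S → A) : Prop where
  hH : 1 ≤ M.H
  hβ : 0 < p.β
  hβH : p.β ≤ M.H
  hcb : 1 ≤ p.cb
  hι : 1 / 2 ≤ iota M p
  greedy : ∀ k < p.K, ∀ h ∈ Icc 1 M.H, ∀ s a,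
    (tables M p x d k).Q h s a ≤ (tables M p x d k).Q h s (d (k + 1) h s)

namespace Admissible

variable (ad : Admissible M p x d)
include ad

lemma one_le_H : (1 : ℝ) ≤ M.H := by exact_mod_cast ad.hH

lemma V_eq_Q [Nonempty A] {k : ℕ} (hk : k < p.K) {h : ℕ} (hh : h ∈ Icc 1 M.H) :
    (T k).V h (x (k + 1) h) = (T k).Q h (cell x d h k).1 (cell x d h k).2 := by
  rw [V_eq_iSup hh]
  exact le_antisymm (ciSup_le fun a => ad.greedy k hk h hh _ a)
    (le_ciSup (f := fun a => (T k).Q h (x (k + 1) h) a) (Set.finite_range _).bddAbove _)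

omit ad in
lemma sqrt_div_mul_le {b : ℝ} (hb : 0 ≤ b) (n : ℕ) :
    n * √(b / n) ≤ (n + 1 : ℕ) * √(b / (n + 1 : ℕ)) := by
  have key : ∀ m : ℕ, m * √(b / m) = √(b * m) := by
    intro m
    rcases Nat.eq_zero_or_pos m with rfl | hm
    · simp
    · have : (0 : ℝ) < m := by exact_mod_cast hm
      rw [← Real.sqrt_sq this.le, ← Real.sqrt_mul (by positivity), Real.sqrt_sq this.le]
      congr 1; field_simp
  rw [key, key]
  apply Real.sqrt_le_sqrt
  gcongr; omega

/-- The width of the confidence interval at the visited state, in terms of the widths observed at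
the next step. -/
lemma width_le [Nonempty A] {k : ℕ} (hk : k < p.K) {h : ℕ} (hh : h ∈ Icc 1 M.H) :
    (T k).V h (x (k + 1) h) - (T k).VLCB h (x (k + 1) h)
      ≤ ∑ j ∈ visits (cell x d h) (cell x d h k) k,
          etaW M.H (cnt (cell x d h) (cell x d h k) j + 1) (cnt (cell x d h) (cell x d h k) k) *
            ((T j).V (h + 1) (x (j + 1) (h + 1)) - (T j).VLCB (h + 1) (x (j + 1) (h + 1)))
        + (etaW M.H 0 (cnt (cell x d h) (cell x d h k) k) * M.H
          + 4 * p.cb * √((M.H : ℝ) ^ 3 * iota M p / cnt (cell x d h) (cell x d h k) k)) := by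
  set z := cell x d h k with hz
  have hι := ad.hι
  have h1 : (T k).V h (x (k + 1) h) ≤ (T k).QUCB h z.1 z.2 := by
    rw [ad.V_eq_Q hk hh]; exact (Q_le_QUCB_QR hh k _ _).1
  have h2 : (T k).QLCB h z.1 z.2 ≤ (T k).VLCB h (x (k + 1) h) := QLCB_le_VLCB hh k z.1 z.2
  rw [QUCB_eq hh] at h1
  rw [QLCB_eq hh] at h2
  have h3 := sum_visits_etaW_mul_le (c := cell x d h) (z := z) ad.one_le_H
    (fun n => √((M.H : ℝ) ^ 3 * iota M p / n)) (fun n => Real.sqrt_nonneg _)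
    (fun n => sqrt_div_mul_le (by positivity) n) k
  have h4 : ∀ b : ℕ → ℝ, ∑ j ∈ visits (cell x d h) z k,
        etaW M.H (cnt (cell x d h) z j + 1) (cnt (cell x d h) z k) *
          (M.r h z.1 z.2 + (T j).V (h + 1) (x (j + 1) (h + 1)) + p.cb * b j)
      - ∑ j ∈ visits (cell x d h) z k,
        etaW M.H (cnt (cell x d h) z j + 1) (cnt (cell x d h) z k) *
          (M.r h z.1 z.2 + (T j).VLCB (h + 1) (x (j + 1) (h + 1)) - p.cb * b j)
      = ∑ j ∈ visits (cell x d h) z k,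
          etaW M.H (cnt (cell x d h) z j + 1) (cnt (cell x d h) z k) *
            ((T j).V (h + 1) (x (j + 1) (h + 1)) - (T j).VLCB (h + 1) (x (j + 1) (h + 1)))
        + 2 * p.cb * ∑ j ∈ visits (cell x d h) z k,
          etaW M.H (cnt (cell x d h) z j + 1) (cnt (cell x d h) z k) * b j := by
    intro b
    rw [mul_sum, ← sum_sub_distrib, ← sum_add_distrib]
    exact sum_congr rfl fun j _ => by ring
  have h5 := h4 fun j => √((M.H : ℝ) ^ 3 * iota M p / (cnt (cell x d h) z j + 1 : ℕ))
  have hcb := ad.hcb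
  have h6 := mul_le_mul_of_nonneg_left h3 (by linarith : 0 ≤ 2 * p.cb)
  linarith

/-- The total width at visits where it exceeds `β`.  This bound is deterministic: the widths obey
a recursion along the horizon. -/
lemma sum_width_le [Nonempty A] {h : ℕ} (hh : h ∈ Icc 1 M.H) :
    ∑ j ∈ range p.K, (if p.β < (T j).V h (x (j + 1) h) - (T j).VLCB h (x (j + 1) h) then
        (T j).V h (x (j + 1) h) - (T j).VLCB h (x (j + 1) h) else 0)
      ≤ 400 * p.cb ^ 2 * M.H ^ 5 * (Fintype.card S * Fintype.card A) * iota M p / p.β := by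
  have hH := ad.one_le_H
  have hβ := ad.hβ
  have hι := ad.hι
  have hcb := ad.hcb
  have hH0 : (0 : ℝ) < M.H := by linarith
  set E : ℕ → ℕ → ℝ := fun h j => (T j).V h (x (j + 1) h) - (T j).VLCB h (x (j + 1) h) with hE
  -- `H` contributions `ε` to a width `> β` amount to at most half of it
  set ε : ℝ := p.β / (2 * M.H) with hε
  have hε0 : 0 < ε := by positivity
  set C : ℝ := 4 * p.cb * √((M.H : ℝ) ^ 3 * iota M p) with hC
  have hC0 : 0 ≤ C := by positivity
  set φ : ℕ → ℝ := fun n => if n = 0 then (M.H : ℝ) else clipSqrt C ε n with hφ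
  have hφ0 : ∀ n, 0 ≤ φ n := by
    intro n; simp only [hφ]; split_ifs; exacts [hH0.le, clipSqrt_nonneg hC0 n]
  set R : ℝ := (Fintype.card S * Fintype.card A) * (M.H + 2 * C ^ 2 / ε) with hR
  have hR0 : 0 ≤ R := by positivity
  have hφsum : ∀ n ≤ p.K, ∑ i ∈ range n, φ i ≤ M.H + 2 * C ^ 2 / ε := by
    intro n _
    refine (sum_range_le_zero_add hφ0 n).trans ?_
    have : ∑ i ∈ range n, φ (i + 1) = ∑ i ∈ range n, clipSqrt C ε (i + 1) :=
      sum_congr rfl fun i _ => by simp [hφ]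
    rw [this]
    have h0 : φ 0 = M.H := by simp [hφ]
    linarith [sum_clipSqrt_le hC0 hε0 n]
  have hrec := weighted_error_le (n := M.H) (K := p.K) ad.hH hε0.le (cell x d) E
    (fun h j => φ (cnt (cell x d h) (cell x d h j) j)) (fun h j => hφ0 _) hR0
    (fun h _ => by
      refine (sum_cnt_le (cell x d h) φ p.K _ hφsum).trans_eq ?_
      rw [Fintype.card_prod]; push_cast; rfl)
    (fun j _ => by simp only [hE]; rw [V_last, VLCB_last]; simp)
    (fun h hh j hj => by
      refine (ad.width_le hj hh).trans (add_le_add le_rfl ?_)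
      set n := cnt (cell x d h) (cell x d h j) j
      simp only [hφ]
      rcases Nat.eq_zero_or_pos n with hn | hn
      · rw [hn]; simp [etaW]; linarith
      · rw [etaW_zero_left hH hn, if_neg (by omega), zero_mul, zero_add,
          Real.sqrt_div (by positivity), ← mul_div_assoc]
        exact le_add_clipSqrt hε0 hn)
    hh (fun j => if p.β < E h j then 1 else 0) (fun j => by split_ifs <;> norm_num)
    (fun j => by split_ifs <;> norm_num)
  set W := ∑ j ∈ range p.K, (if p.β < E h j then (1 : ℝ) else 0) with hW
  have hleft : ∑ j ∈ range p.K, (if p.β < E h j then (1 : ℝ) else 0) * E h j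
      = ∑ j ∈ range p.K, (if p.β < E h j then E h j else 0) :=
    sum_congr rfl fun j _ => by split_ifs <;> simp
  rw [hleft] at hrec
  have hWle : p.β * W ≤ ∑ j ∈ range p.K, (if p.β < E h j then E h j else 0) := by
    rw [hW, mul_sum]
    refine sum_le_sum fun j _ => ?_
    split_ifs with h <;> simp; exact h.le
  -- the contribution of `ε` is absorbed into the left-hand side
  have hεW : (M.H : ℝ) * ε * W = p.β * W / 2 := by rw [hε]; field_simp
  have hfin : ∑ j ∈ range p.K, (if p.β < E h j then E h j else 0) ≤ 6 * M.H * R := by linarith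
  refine hfin.trans ?_
  have hC2 : C ^ 2 = 16 * p.cb ^ 2 * (M.H ^ 3 * iota M p) := by
    rw [hC, mul_pow, Real.sq_sqrt (by positivity)]; ring
  have e1 : 2 * C ^ 2 / ε = 64 * p.cb ^ 2 * (M.H ^ 4 * iota M p / p.β) := by
    rw [hC2, hε]; field_simp; ring
  have e2 : (M.H : ℝ) ≤ 2 * p.cb ^ 2 * (M.H ^ 4 * iota M p / p.β) := by
    have hx : 1 ≤ (M.H : ℝ) / p.β := by rw [le_div_iff₀ hβ]; linarith [ad.hβH]
    have hc2 : 1 ≤ p.cb ^ 2 := one_le_pow₀ hcb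
    have hH3 : (M.H : ℝ) ^ 1 ≤ (M.H : ℝ) ^ 3 := pow_le_pow_right₀ hH (by norm_num)
    calc (M.H : ℝ) = 2 * 1 * (M.H ^ 1 * (1 / 2) * 1) := by ring
      _ ≤ 2 * p.cb ^ 2 * (M.H ^ 3 * iota M p * (M.H / p.β)) := by gcongr
      _ = _ := by ring
  rw [hR, e1]
  have hSA : (0 : ℝ) ≤ (Fintype.card S * Fintype.card A : ℝ) := by positivity
  calc 6 * (M.H : ℝ) * ((Fintype.card S * Fintype.card A)
          * (M.H + 64 * p.cb ^ 2 * (M.H ^ 4 * iota M p / p.β)))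
      ≤ 6 * (M.H : ℝ) * ((Fintype.card S * Fintype.card A)
          * (2 * p.cb ^ 2 * (M.H ^ 4 * iota M p / p.β)
            + 64 * p.cb ^ 2 * (M.H ^ 4 * iota M p / p.β))) := by gcongr
    _ = 396 * p.cb ^ 2 * M.H ^ 5 * (Fintype.card S * Fintype.card A) * iota M p / p.β := by ring
    _ ≤ _ := by gcongr; norm_num

end Admissible

/-! ### Empirical means and variances -/

section empirical
variable {ι : Type*} {J : Finset ι} {w a m q : ι → ℝ}

lemma sq_sum_mul_le (hw : ∀ j ∈ J, 0 ≤ w j) (hw1 : ∑ j ∈ J, w j = 1) :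
    (∑ j ∈ J, w j * m j) ^ 2 ≤ ∑ j ∈ J, w j * m j ^ 2 := by
  have h0 : 0 ≤ ∑ j ∈ J, w j * (m j - ∑ i ∈ J, w i * m i) ^ 2 :=
    sum_nonneg fun j hj => mul_nonneg (hw j hj) (sq_nonneg _)
  have h1 : ∑ j ∈ J, w j * (m j - ∑ i ∈ J, w i * m i) ^ 2
      = ∑ j ∈ J, w j * m j ^ 2 - (∑ j ∈ J, w j * m j) ^ 2 := by
    set b := ∑ i ∈ J, w i * m i with hb
    have : ∀ j ∈ J, w j * (m j - b) ^ 2 = w j * m j ^ 2 - 2 * b * (w j * m j) + b ^ 2 * w j :=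
      fun j _ => by ring
    rw [sum_congr rfl this, sum_add_distrib, sum_sub_distrib, ← mul_sum, ← mul_sum, hw1, ← hb]
    ring
  linarith

/-- The average conditional variance is at most the empirical variance, up to the deviations of
the empirical first and second moments. -/
lemma sum_var_le_empirical {B : ℝ} (hw : ∀ j ∈ J, 0 ≤ w j) (hw1 : ∑ j ∈ J, w j = 1)
    (ha : ∀ j ∈ J, |a j| ≤ B) (hm : ∀ j ∈ J, |m j| ≤ B) :
    ∑ j ∈ J, w j * (q j - m j ^ 2) ≤ (∑ j ∈ J, w j * a j ^ 2 - (∑ j ∈ J, w j * a j) ^ 2)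
      + ∑ j ∈ J, w j * (q j - a j ^ 2) + 2 * B * |∑ j ∈ J, w j * (a j - m j)| := by
  have hbound : ∀ f : ι → ℝ, (∀ j ∈ J, |f j| ≤ B) → |∑ j ∈ J, w j * f j| ≤ B := by
    intro f hf
    calc |∑ j ∈ J, w j * f j| ≤ ∑ j ∈ J, |w j * f j| := abs_sum_le_sum_abs _ _
      _ ≤ ∑ j ∈ J, w j * B := by
          refine sum_le_sum fun j hj => ?_
          rw [abs_mul, abs_of_nonneg (hw j hj)]
          exact mul_le_mul_of_nonneg_left (hf j hj) (hw j hj)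
      _ = B := by rw [← sum_mul, hw1, one_mul]
  have h1 := sq_sum_mul_le (m := m) hw hw1
  have h2 := hbound a ha
  have h3 := hbound m hm
  have e1 : ∑ j ∈ J, w j * (a j - m j) = ∑ j ∈ J, w j * a j - ∑ j ∈ J, w j * m j := by
    rw [← sum_sub_distrib]; exact sum_congr rfl fun j _ => by ring
  have e2 : ∑ j ∈ J, w j * (q j - a j ^ 2) = ∑ j ∈ J, w j * q j - ∑ j ∈ J, w j * a j ^ 2 := by
    rw [← sum_sub_distrib]; exact sum_congr rfl fun j _ => by ring
  have e3 : ∑ j ∈ J, w j * (q j - m j ^ 2) = ∑ j ∈ J, w j * q j - ∑ j ∈ J, w j * m j ^ 2 := by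
    rw [← sum_sub_distrib]; exact sum_congr rfl fun j _ => by ring
  rw [e1, e2, e3]
  set a' := ∑ j ∈ J, w j * a j
  set m' := ∑ j ∈ J, w j * m j
  have h4 : a' ^ 2 - m' ^ 2 ≤ 2 * B * |a' - m'| := by
    calc a' ^ 2 - m' ^ 2 ≤ |(a' + m') * (a' - m')| := by
          rw [show a' ^ 2 - m' ^ 2 = (a' + m') * (a' - m') by ring]; exact le_abs_self _
      _ = |a' + m'| * |a' - m'| := abs_mul _ _
      _ ≤ 2 * B * |a' - m'| := by
          gcongr; exact (abs_add_le _ _).trans (by linarith)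
  linarith

lemma sqrt_add_le_of_sq {e f : ℝ} (hf : 0 ≤ f) : √(e + f) ≤ √e + √f := by
  have he := Real.sqrt_nonneg e
  have hf' := Real.sqrt_nonneg f
  apply Real.sqrt_le_iff.mpr ⟨by positivity, ?_⟩
  have h1 : e ≤ √e ^ 2 := by
    rcases le_or_gt 0 e with h | h
    · rw [Real.sq_sqrt h]
    · exact h.le.trans (sq_nonneg _)
  have h2 := Real.sq_sqrt hf
  nlinarith [mul_nonneg he hf']

end empirical

/-! ### Concentration inequalities along a trajectory -/

section concentration
variable (M p x d)

/-- Bernstein inequality for the averages with weights `η_i^n`, at all times at which `z` has been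
visited.  `F` is a function of the next state which depends on the tables held at the start of the
episode, and `B` bounds its oscillation. -/
def BernEta (h : ℕ) (z : S × A) (F : QESATables S A → S → ℝ) (B : ℝ) : Prop :=
  ∀ k ≤ p.K, 1 ≤ cnt (cell x d h) z k →
    ∑ j ∈ visits (cell x d h) z k, etaW M.H (cnt (cell x d h) z j + 1) (cnt (cell x d h) z k) *
        (F (tables M p x d j) (x (j + 1) (h + 1)) - M.nextMean h z.1 z.2 (F (tables M p x d j)))
      ≤ 4 * √(iota M p * ∑ j ∈ visits (cell x d h) z k,
          etaW M.H (cnt (cell x d h) z j + 1) (cnt (cell x d h) z k) ^ 2 *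
            M.nextVar h z.1 z.2 (F (tables M p x d j)))
        + 16 * iota M p * (2 * M.H / cnt (cell x d h) z k * B)

/-- Bernstein inequality for the unweighted sums, at all times at which `z` has been visited. -/
def BernOne (h : ℕ) (z : S × A) (F : QESATables S A → S → ℝ) (B : ℝ) : Prop :=
  ∀ k ≤ p.K, 1 ≤ cnt (cell x d h) z k →
    ∑ j ∈ visits (cell x d h) z k,
        (F (tables M p x d j) (x (j + 1) (h + 1)) - M.nextMean h z.1 z.2 (F (tables M p x d j)))
      ≤ 4 * √(iota M p * ∑ j ∈ visits (cell x d h) z k,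
            M.nextVar h z.1 z.2 (F (tables M p x d j))) + 16 * iota M p * B

/-- The advantage `V_{h+1} - V^R_{h+1}`, clamped to `[-H, 0]`. -/
noncomputable def advF (h : ℕ) (t : QESATables S A) (y : S) : ℝ :=
  max (-(M.H : ℝ)) (min 0 (t.V (h + 1) y - t.VR (h + 1) y))

/-- The reference function `V^R_{h+1}`, clamped to `[0, H]`. -/
noncomputable def refF (h : ℕ) (t : QESATables S A) (y : S) : ℝ :=
  max 0 (min (M.H : ℝ) (t.VR (h + 1) y))

/-- The reference function `V^R_{h+1}`, clamped to `[V^⋆_{h+1}, V^⋆_{h+1} + β]`. -/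
noncomputable def setF (h : ℕ) (t : QESATables S A) (y : S) : ℝ :=
  max (M.optValue (h + 1) y) (min (M.optValue (h + 1) y + p.β) (t.VR (h + 1) y))

/-- `β` times the indicator that the reference value at step `h + 1 ≤ H` is not settled. -/
noncomputable def unsF (h : ℕ) (t : QESATables S A) (y : S) : ℝ :=
  if h + 1 ≤ M.H ∧ t.u (h + 1) y = true then p.β else 0

/-- The squared deviation of `V^⋆_{h+1}` from its mean. -/
noncomputable def optSqF (h : ℕ) (z : S × A) (y : S) : ℝ :=
  (M.optValue (h + 1) y - M.nextMean h z.1 z.2 (M.optValue (h + 1))) ^ 2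

/-- The concentration inequalities at the cell `(h, z)` on which the analysis rests. -/
structure GoodAt (h : ℕ) (z : S × A) : Prop where
  opt_pos : BernEta M p x d h z (fun _ => M.optValue (h + 1)) M.H
  opt_neg : BernEta M p x d h z (fun _ y => -M.optValue (h + 1) y) M.H
  adv_pos : BernEta M p x d h z (advF M h) M.H
  adv_neg : BernEta M p x d h z (fun t y => -advF M h t y) M.H
  adv_sq : BernEta M p x d h z (fun t y => -advF M h t y ^ 2) (M.H ^ 2)
  set_eta : BernEta M p x d h z (fun t y => M.optValue (h + 1) y - setF M p h t y) p.β
  ref_neg : BernOne M p x d h z (fun t y => -refF M h t y) M.H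
  ref_pos : BernOne M p x d h z (refF M h) M.H
  ref_sq : BernOne M p x d h z (fun t y => -refF M h t y ^ 2) (M.H ^ 2)
  opt_sq : BernOne M p x d h z (fun _ => optSqF M h z) (M.H ^ 2)
  set_one : BernOne M p x d h z (setF M p h) (2 * M.H)
  uns : BernOne M p x d h z (fun t y => -unsF M p h t y) p.β

end concentration

section oscillation
variable (M p)

omit [Fintype A] in
lemma advF_mem (h : ℕ) (t : QESATables S A) (y : S) :
    -(M.H : ℝ) ≤ advF M h t y ∧ advF M h t y ≤ 0 :=
  ⟨le_max_left _ _, max_le (by simp) (min_le_left _ _)⟩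

omit [Fintype A] in
lemma refF_mem (h : ℕ) (t : QESATables S A) (y : S) :
    0 ≤ refF M h t y ∧ refF M h t y ≤ M.H :=
  ⟨le_max_left _ _, max_le (by simp) (min_le_left _ _)⟩

lemma setF_mem (hβ : 0 ≤ p.β) (h : ℕ) (t : QESATables S A) (y : S) :
    M.optValue (h + 1) y ≤ setF M p h t y ∧ setF M p h t y ≤ M.optValue (h + 1) y + p.β :=
  ⟨le_max_left _ _, max_le (by linarith) (min_le_left _ _)⟩

omit [Fintype A] in
lemma unsF_mem (hβ : 0 ≤ p.β) (h : ℕ) (t : QESATables S A) (y : S) :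
    0 ≤ unsF M p h t y ∧ unsF M p h t y ≤ p.β := by
  unfold unsF; split_ifs <;> simp [hβ]

lemma abs_sub_le_of_mem {a b u v : ℝ} (hu : a ≤ u ∧ u ≤ b) (hv : a ≤ v ∧ v ≤ b) :
    |u - v| ≤ b - a := by
  rw [abs_le]; constructor <;> linarith [hu.1, hu.2, hv.1, hv.2]

end oscillation

section consequences
variable {h : ℕ} {z : S × A} {F : QESATables S A → S → ℝ} {B : ℝ}

/-- Hoeffding-type consequence of the Bernstein inequality for the weights `η_i^n`. -/
lemma BernEta.le_sqrt (hb : BernEta M p x d h z F B) (hH : (1 : ℝ) ≤ M.H) (hι : 0 ≤ iota M p)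
    (hB : 0 ≤ B) (hF : ∀ t y y', |F t y - F t y'| ≤ B) {k : ℕ} (hk : k ≤ p.K)
    (hn : 1 ≤ cnt (cell x d h) z k) :
    ∑ j ∈ visits (cell x d h) z k, etaW M.H (cnt (cell x d h) z j + 1) (cnt (cell x d h) z k) *
        (F (T j) (x (j + 1) (h + 1)) - M.nextMean h z.1 z.2 (F (T j)))
      ≤ 38 * B * √(M.H * iota M p / cnt (cell x d h) z k) := by
  have h1 := hb k hk hn
  have hsum := sum_visits_etaW (c := cell x d h) (z := z) hH hn
  set n := cnt (cell x d h) z k with hn'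
  have hn0 : (0 : ℝ) < n := by exact_mod_cast hn
  set D := ∑ j ∈ visits (cell x d h) z k, etaW M.H (cnt (cell x d h) z j + 1) n *
        (F (T j) (x (j + 1) (h + 1)) - M.nextMean h z.1 z.2 (F (T j))) with hD
  set X := √(M.H * iota M p / n) with hX
  have hX2 : X ^ 2 = M.H * iota M p / n := Real.sq_sqrt (by positivity)
  have hX0 : 0 ≤ X := Real.sqrt_nonneg _
  have hDB : D ≤ B := by
    calc D ≤ ∑ j ∈ visits (cell x d h) z k, etaW M.H (cnt (cell x d h) z j + 1) n * B := by
          refine sum_le_sum fun j _ => mul_le_mul_of_nonneg_left ?_ (etaW_nonneg hH _ _)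
          exact (le_abs_self _).trans (EpisodicMDP.abs_sub_nextMean_le (hF _) _)
      _ = B := by rw [← sum_mul, hsum, one_mul]
  have hV : ∑ j ∈ visits (cell x d h) z k, etaW M.H (cnt (cell x d h) z j + 1) n ^ 2 *
            M.nextVar h z.1 z.2 (F (T j)) ≤ 2 * M.H / n * B ^ 2 := by
    calc _ ≤ ∑ j ∈ visits (cell x d h) z k, etaW M.H (cnt (cell x d h) z j + 1) n *
              (2 * M.H / n * B ^ 2) := by
          refine sum_le_sum fun j _ => ?_
          have e1 := etaW_nonneg hH (cnt (cell x d h) z j + 1) n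
          have e2 := etaW_le hH (i := cnt (cell x d h) z j + 1) (by omega) hn
          have e3 := EpisodicMDP.nextVar_le_sq (M := M) (h := h) (s := z.1) (a := z.2) (hF (T j))
          have e4 := EpisodicMDP.nextVar_nonneg (M := M) (h := h) (s := z.1) (a := z.2)
            (f := F (T j))
          rw [sq, mul_assoc]
          gcongr
      _ = _ := by rw [← sum_mul, hsum, one_mul]
  have hsq : √(iota M p * ∑ j ∈ visits (cell x d h) z k,
      etaW M.H (cnt (cell x d h) z j + 1) n ^ 2 * M.nextVar h z.1 z.2 (F (T j)))
      ≤ 1.5 * (B * X) := by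
    apply Real.sqrt_le_iff.mpr ⟨by positivity, ?_⟩
    calc _ ≤ iota M p * (2 * M.H / n * B ^ 2) := mul_le_mul_of_nonneg_left hV hι
      _ = 2 * B ^ 2 * X ^ 2 := by rw [hX2]; ring
      _ ≤ (1.5 * (B * X)) ^ 2 := by nlinarith [sq_nonneg (B * X)]
  have hlin : 16 * iota M p * (2 * M.H / n * B) = 32 * B * X ^ 2 := by rw [hX2]; ring
  rw [hlin] at h1
  rcases le_or_gt X 1 with hx | hx
  · have : B * X ^ 2 ≤ B * X := by
      rw [sq]; exact mul_le_mul_of_nonneg_left (by nlinarith) hB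
    nlinarith
  · have : B ≤ B * X := le_mul_of_one_le_right hB hx.le
    nlinarith

/-- Hoeffding-type consequence of the Bernstein inequality for unweighted sums. -/
lemma BernOne.le_sqrt (hb : BernOne M p x d h z F B) (hι : 0 ≤ iota M p)
    (hB : 0 ≤ B) (hF : ∀ t y y', |F t y - F t y'| ≤ B) {k : ℕ} (hk : k ≤ p.K)
    (hn : 1 ≤ cnt (cell x d h) z k) :
    ∑ j ∈ visits (cell x d h) z k,
        (F (T j) (x (j + 1) (h + 1)) - M.nextMean h z.1 z.2 (F (T j)))
      ≤ cnt (cell x d h) z k * (20 * B * √(iota M p / cnt (cell x d h) z k)) := by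
  have h1 := hb k hk hn
  set n := cnt (cell x d h) z k with hn'
  have hcard : (visits (cell x d h) z k).card = n := rfl
  have hn0 : (0 : ℝ) < n := by exact_mod_cast hn
  set D := ∑ j ∈ visits (cell x d h) z k,
        (F (T j) (x (j + 1) (h + 1)) - M.nextMean h z.1 z.2 (F (T j))) with hD
  set X := √(iota M p / n) with hX
  have hX2 : X ^ 2 = iota M p / n := Real.sq_sqrt (by positivity)
  have hX0 : 0 ≤ X := Real.sqrt_nonneg _
  have hDB : D ≤ n * B := by
    calc D ≤ ∑ j ∈ visits (cell x d h) z k, B := sum_le_sum fun j _ =>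
          (le_abs_self _).trans (EpisodicMDP.abs_sub_nextMean_le (hF _) _)
      _ = n * B := by rw [sum_const, hcard, nsmul_eq_mul]
  have hV : ∑ j ∈ visits (cell x d h) z k, M.nextVar h z.1 z.2 (F (T j)) ≤ n * B ^ 2 := by
    calc _ ≤ ∑ j ∈ visits (cell x d h) z k, B ^ 2 :=
          sum_le_sum fun j _ => EpisodicMDP.nextVar_le_sq (hF (T j))
      _ = n * B ^ 2 := by rw [sum_const, hcard, nsmul_eq_mul]
  have hsq : √(iota M p * ∑ j ∈ visits (cell x d h) z k, M.nextVar h z.1 z.2 (F (T j)))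
      ≤ n * (B * X) := by
    apply Real.sqrt_le_iff.mpr ⟨by positivity, ?_⟩
    calc _ ≤ iota M p * (n * B ^ 2) := mul_le_mul_of_nonneg_left hV hι
      _ = (n * (B * X)) ^ 2 := by rw [mul_pow, mul_pow, hX2]; field_simp
  have hlin : 16 * iota M p * B = n * (16 * B * X ^ 2) := by rw [hX2]; field_simp
  rw [hlin] at h1
  rcases le_or_gt X 1 with hx | hx
  · have : B * X ^ 2 ≤ B * X := by
      rw [sq]; exact mul_le_mul_of_nonneg_left (by nlinarith) hB
    have := mul_le_mul_of_nonneg_left this hn0.le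
    nlinarith
  · have : n * B ≤ n * (B * X) :=
      mul_le_mul_of_nonneg_left (le_mul_of_one_le_right hB hx.le) hn0.le
    nlinarith [mul_nonneg hn0.le (mul_nonneg hB hX0)]

end consequences

/-! ### Optimism -/

/-- The tables `T j` bracket the optimal values: `V^LCB ≤ V^⋆ ≤ V`. -/
def Bracket (M : EpisodicMDP S A) (p : QESAParams) (x : ℕ → ℕ → S) (d : ℕ → ℕ → S → A)
    (j : ℕ) : Prop :=
  ∀ h ∈ Icc 1 (M.H + 1), ∀ s, M.optValue h s ≤ (tables M p x d j).V h s ∧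
    (tables M p x d j).VLCB h s ≤ M.optValue h s

section facts
variable [Nonempty A] (ad : Admissible M p x d) {j : ℕ} (hb : Bracket M p x d j) {h : ℕ}
  (hh : h ∈ Icc 1 M.H)
include ad hb hh

lemma Bracket.facts (y : S) : M.optValue (h + 1) y ≤ (T j).V (h + 1) y ∧
    (T j).V (h + 1) y ≤ (T j).VR (h + 1) y ∧ (T j).VR (h + 1) y - (T j).V (h + 1) y ≤ p.β ∧
    0 ≤ (T j).VLCB (h + 1) y ∧ (T j).VLCB (h + 1) y ≤ M.optValue (h + 1) y ∧
    (T j).VR (h + 1) y ≤ M.H := by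
  simp only [mem_Icc] at hh
  have h1 := hb (h + 1) (by simp; omega) y
  have hβ := ad.hβ
  rcases Nat.lt_or_ge h M.H with hlt | hge
  · have hh' : h + 1 ∈ Icc 1 M.H := by simp; omega
    refine ⟨h1.1, V_le_VR hh' j y, ?_, VLCB_nonneg hh' j y, h1.2, VR_le hh' j y⟩
    rcases VR_cases (p := p) (x := x) (d := d) hh' j y with ⟨_, h2⟩ | ⟨_, _, h3⟩ <;> linarith
  · obtain rfl : h = M.H := by omega
    rw [V_last, VLCB_last, VR_last] at *
    simp only [le_refl, sub_self, true_and]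
    exact ⟨h1.1, hβ.le, h1.2, by positivity⟩

lemma Bracket.advF_eq (y : S) : advF M h (T j) y = (T j).V (h + 1) y - (T j).VR (h + 1) y := by
  obtain ⟨h1, h2, h3, h4, h5, h6⟩ := hb.facts ad hh y
  have := ad.hβH
  unfold advF
  rw [min_eq_right (by linarith), max_eq_right (by linarith)]

lemma Bracket.refF_eq (y : S) : refF M h (T j) y = (T j).VR (h + 1) y := by
  obtain ⟨h1, h2, h3, h4, h5, h6⟩ := hb.facts ad hh y
  unfold refF
  rw [min_eq_right (by linarith), max_eq_right (by linarith)]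

end facts

lemma VR_anti' [Nonempty A] {h : ℕ} (hh : h ∈ Icc 1 M.H) {i j : ℕ} (hij : i ≤ j) (y : S) :
    (T j).VR (h + 1) y ≤ (T i).VR (h + 1) y := by
  simp only [mem_Icc] at hh
  rcases Nat.lt_or_ge h M.H with hlt | hge
  · exact VR_anti (by simp; omega) hij y
  · obtain rfl : h = M.H := by omega
    rw [VR_last, VR_last]

section rates

lemma rpow_three_quarters (n : ℝ) (hn : 0 ≤ n) : n ^ (3 / 4 : ℝ) = √√n ^ 3 := by
  rw [Real.sqrt_eq_rpow, Real.sqrt_eq_rpow, ← Real.rpow_mul hn, ← Real.rpow_natCast,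
    ← Real.rpow_mul hn]
  norm_num

lemma pow_four_sqrt_sqrt {n : ℝ} (hn : 0 ≤ n) : √√n ^ 4 = n := by
  rw [show 4 = 2 * 2 by norm_num, pow_mul, Real.sq_sqrt (by positivity), Real.sq_sqrt hn]

/-- Lower-order terms of the deviations are dominated by `ι / n^{3/4}`. -/
lemma rate_le {i n : ℝ} (hi : 1 / 2 ≤ i) (hn : 1 ≤ n) :
    √(i / n) * √√(i / n) ≤ 2 * (i / n ^ (3 / 4 : ℝ)) ∧ i / n ≤ i / n ^ (3 / 4 : ℝ) := by
  rw [rpow_three_quarters n (by linarith), Real.sqrt_div (by linarith), Real.sqrt_div (by positivity)]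
  have hg4 := pow_four_sqrt_sqrt (n := i) (by linarith)
  have hm4 := pow_four_sqrt_sqrt (n := n) (by linarith)
  have hg2 := Real.sq_sqrt (Real.sqrt_nonneg i)
  have hm2 := Real.sq_sqrt (Real.sqrt_nonneg n)
  have hg0 : 0 ≤ √√i := Real.sqrt_nonneg _
  have hm0 : 1 ≤ √√n := by
    rw [Real.one_le_sqrt, Real.one_le_sqrt]; exact hn
  have hg1 : 1 / 2 ≤ √√i := by
    apply Real.le_sqrt_of_sq_le; apply Real.le_sqrt_of_sq_le; norm_num; linarith
  set g := √√i
  set m := √√n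
  constructor
  · rw [← hg2, ← hm2, ← hg4]
    have : g ^ 2 / m ^ 2 * (g / m) = g ^ 3 / m ^ 3 := by field_simp
    rw [this, ← mul_div_assoc]
    gcongr
    nlinarith [pow_nonneg hg0 3]
  · rw [← hg4, ← hm4]
    gcongr 2
    norm_num

lemma advantage_rate_le {H i n e V : ℝ} (hH : 1 ≤ H) (hi : 1 / 2 ≤ i) (hn : 1 ≤ n)
    (h0 : 0 ≤ e + 114 * H ^ 2 * √(H * i / n))
    (hV : V ≤ 2 * H / n * (e + 114 * H ^ 2 * √(H * i / n))) :
    4 * √(i * V) + 16 * i * (2 * H / n * H)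
      ≤ 6 * √(i / n) * (√H * √e) + 170 * (H ^ 2 * i / n ^ (3 / 4 : ℝ)) := by
  have hrate := rate_le hi hn
  have hH0 : 0 ≤ H := by linarith
  set X := √(H * i / n) with hX
  set y := √(i / n) with hy
  have hy0 : 0 ≤ y := Real.sqrt_nonneg _
  have hy2 : y ^ 2 = i / n := Real.sq_sqrt (by positivity)
  set b := √√H with hbdef
  have hb4 : b ^ 4 = H := pow_four_sqrt_sqrt hH0
  have hb2 : b ^ 2 = √H := Real.sq_sqrt (Real.sqrt_nonneg _)
  have hb1 : 1 ≤ b := by rw [hbdef, Real.one_le_sqrt, Real.one_le_sqrt]; exact hH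
  have hb0 : 0 ≤ b := by linarith
  have hXy : X = b ^ 2 * y := by
    rw [hX, mul_div_assoc, Real.sqrt_mul hH0, hb2]
  have hroot : √(i * V) ≤ 3 / 2 * (b ^ 2 * y) * (√e + 11 * (b ^ 5 * √y)) := by
    calc √(i * V) ≤ √((3 / 2 * (b ^ 2 * y)) ^ 2 * (e + 114 * H ^ 2 * X)) := by
          apply Real.sqrt_le_sqrt
          calc _ ≤ i * (2 * H / n * (e + 114 * H ^ 2 * X)) :=
                mul_le_mul_of_nonneg_left hV (by linarith)
            _ = 2 * (b ^ 4 * y ^ 2) * (e + 114 * H ^ 2 * X) := by rw [hy2, hb4]; ring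
            _ ≤ _ := by
                refine mul_le_mul_of_nonneg_right ?_ h0
                nlinarith [sq_nonneg (b ^ 2 * y)]
      _ = 3 / 2 * (b ^ 2 * y) * √(e + 114 * H ^ 2 * X) := by
          rw [Real.sqrt_mul (sq_nonneg _), Real.sqrt_sq (by positivity)]
      _ ≤ _ := by
          refine mul_le_mul_of_nonneg_left ?_ (by positivity)
          refine (sqrt_add_le_of_sq (by positivity)).trans (add_le_add le_rfl ?_)
          apply Real.sqrt_le_iff.mpr ⟨by positivity, ?_⟩
          rw [hXy, ← hb4, mul_pow, mul_pow, Real.sq_sqrt hy0]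
          have hp : 0 ≤ b ^ 10 * y := by positivity
          calc 114 * (b ^ 4) ^ 2 * (b ^ 2 * y) = 114 * (b ^ 10 * y) := by ring
            _ ≤ 121 * (b ^ 10 * y) := by linarith
            _ = _ := by ring
  have hb78 : b ^ 7 ≤ H ^ 2 := by
    rw [← hb4, ← pow_mul]; exact pow_le_pow_right₀ hb1 (by norm_num)
  have h1 : b ^ 7 * (y * √y) ≤ H ^ 2 * (2 * (i / n ^ (3 / 4 : ℝ))) := by
    exact mul_le_mul hb78 hrate.1 (by positivity) (by positivity)
  have h2 : H ^ 2 * y ^ 2 ≤ H ^ 2 * (i / n ^ (3 / 4 : ℝ)) := by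
    rw [hy2]; exact mul_le_mul_of_nonneg_left hrate.2 (by positivity)
  have h3 : 0 ≤ H ^ 2 * (i / n ^ (3 / 4 : ℝ)) := by positivity
  calc _ ≤ 4 * (3 / 2 * (b ^ 2 * y) * (√e + 11 * (b ^ 5 * √y))) + 32 * (H ^ 2 * y ^ 2) := by
        rw [hy2]
        have : 16 * i * (2 * H / n * H) = 32 * (H ^ 2 * (i / n)) := by ring
        linarith
    _ = 6 * y * (√H * √e) + 66 * (b ^ 7 * (y * √y)) + 32 * (H ^ 2 * y ^ 2) := by
        rw [← hb2]; ring
    _ ≤ _ := by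
        rw [mul_div_assoc]; linarith

lemma reference_rate_le {H i n e V : ℝ} (hH : 1 ≤ H) (hi : 1 / 2 ≤ i) (hn : 1 ≤ n)
    (hV : V ≤ n * (e + 60 * H ^ 2 * √(i / n))) :
    2 / n * (4 * √(i * V) + 16 * i * H)
      ≤ 8 * √(i / n) * √e + 170 * (H ^ 2 * i / n ^ (3 / 4 : ℝ)) := by
  have hrate := rate_le hi hn
  have hH0 : 0 ≤ H := by linarith
  have hn0 : 0 < n := by linarith
  set y := √(i / n) with hy
  have hy0 : 0 ≤ y := Real.sqrt_nonneg _
  have hy2 : y ^ 2 = i / n := Real.sq_sqrt (by positivity)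
  have hroot : √(i * V) ≤ n * y * (√e + 8 * (H * √y)) := by
    calc √(i * V) ≤ √((n * y) ^ 2 * (e + 60 * H ^ 2 * y)) := by
          apply Real.sqrt_le_sqrt
          calc _ ≤ i * (n * (e + 60 * H ^ 2 * y)) := mul_le_mul_of_nonneg_left hV (by linarith)
            _ = _ := by rw [mul_pow, hy2]; field_simp
      _ = n * y * √(e + 60 * H ^ 2 * y) := by
          rw [Real.sqrt_mul (sq_nonneg _), Real.sqrt_sq (by positivity)]
      _ ≤ _ := by
          refine mul_le_mul_of_nonneg_left ?_ (by positivity)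
          refine (sqrt_add_le_of_sq (by positivity)).trans (add_le_add le_rfl ?_)
          apply Real.sqrt_le_iff.mpr ⟨by positivity, ?_⟩
          rw [mul_pow, mul_pow, Real.sq_sqrt hy0]
          have hp : 0 ≤ H ^ 2 * y := by positivity
          linarith
  have hHH : H ≤ H ^ 2 := by nlinarith
  have h1 : H * (y * √y) ≤ H ^ 2 * (2 * (i / n ^ (3 / 4 : ℝ))) := by
    exact mul_le_mul hHH hrate.1 (by positivity) (by positivity)
  have h2 : H * y ^ 2 ≤ H ^ 2 * (i / n ^ (3 / 4 : ℝ)) := by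
    rw [hy2]; exact mul_le_mul hHH hrate.2 (by positivity) (by positivity)
  have h3 : 0 ≤ H ^ 2 * (i / n ^ (3 / 4 : ℝ)) := by positivity
  calc _ ≤ 2 / n * (4 * (n * y * (√e + 8 * (H * √y))) + 16 * i * H) := by gcongr
    _ = 8 * y * √e + 64 * (H * (y * √y)) + 32 * (H * y ^ 2) := by
        rw [hy2]; field_simp; ring
    _ ≤ _ := by
        rw [mul_div_assoc]; linarith

end rates

section optimism
variable [Nonempty A] (ad : Admissible M p x d) {h : ℕ} (hh : h ∈ Icc 1 M.H) {z : S × A}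
  (hg : GoodAt M p x d h z) {k : ℕ} (hk : k ≤ p.K) (hn : 1 ≤ cnt (cell x d h) z k)
  (hb : ∀ j < k, Bracket M p x d j)
include ad hh hg hk hn

omit hh in
lemma opt_dev_le :
    |∑ j ∈ visits (cell x d h) z k, etaW M.H (cnt (cell x d h) z j + 1) (cnt (cell x d h) z k) *
        (M.optValue (h + 1) (x (j + 1) (h + 1)) - M.nextMean h z.1 z.2 (M.optValue (h + 1)))|
      ≤ 38 * √((M.H : ℝ) ^ 3 * iota M p / cnt (cell x d h) z k) := by
  have hι : 0 ≤ iota M p := by linarith [ad.hι]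
  have hosc : ∀ (t : QESATables S A) (y y' : S),
      |M.optValue (h + 1) y - M.optValue (h + 1) y'| ≤ M.H := fun t y y' => by
    have := abs_sub_le_of_mem
      ⟨EpisodicMDP.optValue_nonneg M (by omega : 1 ≤ h + 1) y, EpisodicMDP.optValue_le M (by omega) y⟩
      ⟨EpisodicMDP.optValue_nonneg M (by omega : 1 ≤ h + 1) y', EpisodicMDP.optValue_le M (by omega) y'⟩
    linarith
  have h1 := hg.opt_pos.le_sqrt ad.one_le_H hι (by positivity) hosc hk hn
  have h2 := hg.opt_neg.le_sqrt ad.one_le_H hι (by positivity)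
    (fun t y y' => by rw [← abs_neg]; convert hosc t y y' using 2; ring) hk hn
  have e : 38 * (M.H : ℝ) * √(M.H * iota M p / cnt (cell x d h) z k)
      = 38 * √((M.H : ℝ) ^ 3 * iota M p / cnt (cell x d h) z k) := by
    rw [mul_assoc]
    congr 1
    rw [show (M.H : ℝ) ^ 3 * iota M p / cnt (cell x d h) z k
      = (M.H : ℝ) ^ 2 * (M.H * iota M p / cnt (cell x d h) z k) by ring,
      Real.sqrt_mul (by positivity), Real.sqrt_sq (by positivity)]
  rw [e] at h1 h2
  rw [abs_le]
  refine ⟨?_, h1⟩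
  have : ∑ j ∈ visits (cell x d h) z k, etaW M.H (cnt (cell x d h) z j + 1) (cnt (cell x d h) z k) *
      (-M.optValue (h + 1) (x (j + 1) (h + 1))
        - M.nextMean h z.1 z.2 (fun y => -M.optValue (h + 1) y))
      = - ∑ j ∈ visits (cell x d h) z k,
        etaW M.H (cnt (cell x d h) z j + 1) (cnt (cell x d h) z k) *
        (M.optValue (h + 1) (x (j + 1) (h + 1)) - M.nextMean h z.1 z.2 (M.optValue (h + 1))) := by
    rw [← sum_neg_distrib, EpisodicMDP.nextMean_neg]
    exact sum_congr rfl fun j _ => by ring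
  rw [this] at h2
  linarith

omit [Nonempty A] hh hg hk in
lemma optQ_eq_sum : M.optQ h z.1 z.2 = ∑ j ∈ visits (cell x d h) z k,
    etaW M.H (cnt (cell x d h) z j + 1) (cnt (cell x d h) z k) *
      (M.r h z.1 z.2 + M.nextMean h z.1 z.2 (M.optValue (h + 1))) := by
  rw [← sum_mul, sum_visits_etaW ad.one_le_H hn, one_mul]; rfl

omit [Nonempty A] hg hk hh in
lemma bonus_sum_ge : √((M.H : ℝ) ^ 3 * iota M p / cnt (cell x d h) z k)
    ≤ ∑ j ∈ visits (cell x d h) z k, etaW M.H (cnt (cell x d h) z j + 1) (cnt (cell x d h) z k) *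
      √((M.H : ℝ) ^ 3 * iota M p / (cnt (cell x d h) z j + 1 : ℕ)) := by
  have hι : 0 ≤ iota M p := by linarith [ad.hι]
  refine le_sum_visits_etaW_mul ad.one_le_H
    (fun n => √((M.H : ℝ) ^ 3 * iota M p / n)) k hn fun n h1 h2 => ?_
  apply Real.sqrt_le_sqrt
  have : (0 : ℝ) < n := by exact_mod_cast h1
  gcongr

include hb

/-- Optimism of the upper confidence estimate, once `z` has been visited. -/
lemma optQ_le_QUCB (hc : 38 ≤ p.cb) : M.optQ h z.1 z.2 ≤ (T k).QUCB h z.1 z.2 := by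
  have h1 := (abs_le.mp (opt_dev_le ad hg hk hn)).1
  have h2 := bonus_sum_ge ad (p := p) (h := h) hn
  rw [QUCB_eq hh, etaW_zero_left ad.one_le_H hn, optQ_eq_sum ad (h := h) hn, zero_mul, zero_add,
    ← sub_nonneg, ← sum_sub_distrib]
  calc (0 : ℝ) ≤ ∑ j ∈ visits (cell x d h) z k,
        etaW M.H (cnt (cell x d h) z j + 1) (cnt (cell x d h) z k) *
        (M.optValue (h + 1) (x (j + 1) (h + 1)) - M.nextMean h z.1 z.2 (M.optValue (h + 1)))
        + p.cb * ∑ j ∈ visits (cell x d h) z k,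
          etaW M.H (cnt (cell x d h) z j + 1) (cnt (cell x d h) z k) *
          √((M.H : ℝ) ^ 3 * iota M p / (cnt (cell x d h) z j + 1 : ℕ)) := by
        have h3 := mul_le_mul_of_nonneg_left h2 (by linarith : 0 ≤ p.cb)
        have h4 := mul_le_mul_of_nonneg_right hc
          (Real.sqrt_nonneg ((M.H : ℝ) ^ 3 * iota M p / cnt (cell x d h) z k))
        linarith
    _ ≤ _ := by
        rw [mul_sum, ← sum_add_distrib]
        refine sum_le_sum fun j hj => ?_
        have hj' := (hb j (mem_visits.mp hj).1 (h + 1) (by simp at hh ⊢; omega)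
          (x (j + 1) (h + 1))).1
        have := mul_le_mul_of_nonneg_left hj'
          (etaW_nonneg ad.one_le_H (cnt (cell x d h) z j + 1) (cnt (cell x d h) z k))
        linarith

/-- Pessimism of the lower confidence estimate, once `z` has been visited. -/
lemma QLCB_le_optQ (hc : 38 ≤ p.cb) : (T k).QLCB h z.1 z.2 ≤ M.optQ h z.1 z.2 := by
  have h1 := (abs_le.mp (opt_dev_le ad hg hk hn)).2
  have h2 := bonus_sum_ge ad (p := p) (h := h) hn
  rw [QLCB_eq hh, optQ_eq_sum ad (h := h) hn, ← sub_nonpos, ← sum_sub_distrib]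
  calc _ ≤ ∑ j ∈ visits (cell x d h) z k,
        etaW M.H (cnt (cell x d h) z j + 1) (cnt (cell x d h) z k) *
        (M.optValue (h + 1) (x (j + 1) (h + 1)) - M.nextMean h z.1 z.2 (M.optValue (h + 1)))
        - p.cb * ∑ j ∈ visits (cell x d h) z k,
          etaW M.H (cnt (cell x d h) z j + 1) (cnt (cell x d h) z k) *
          √((M.H : ℝ) ^ 3 * iota M p / (cnt (cell x d h) z j + 1 : ℕ)) := by
        rw [mul_sum, ← sum_sub_distrib]
        refine sum_le_sum fun j hj => ?_
        have hj' := (hb j (mem_visits.mp hj).1 (h + 1) (by simp at hh ⊢; omega)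
          (x (j + 1) (h + 1))).2
        have := mul_le_mul_of_nonneg_left hj'
          (etaW_nonneg ad.one_le_H (cnt (cell x d h) z j + 1) (cnt (cell x d h) z k))
        linarith
    _ ≤ 0 := by
        have h3 := mul_le_mul_of_nonneg_left h2 (by linarith : 0 ≤ p.cb)
        have h4 := mul_le_mul_of_nonneg_right hc
          (Real.sqrt_nonneg ((M.H : ℝ) ^ 3 * iota M p / cnt (cell x d h) z k))
        linarith

/-- The deviation of the averaged advantages, in terms of their empirical variance. -/
lemma adv_dev_le : -(∑ j ∈ visits (cell x d h) z k,
      etaW M.H (cnt (cell x d h) z j + 1) (cnt (cell x d h) z k) *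
        (advF M h (T j) (x (j + 1) (h + 1)) - M.nextMean h z.1 z.2 (advF M h (T j))))
      ≤ 6 * √(iota M p / cnt (cell x d h) z k) * (√M.H *
          √((T k).σadv h z.1 z.2 - (T k).μadv h z.1 z.2 ^ 2))
        + 170 * ((M.H : ℝ) ^ 2 * iota M p / (cnt (cell x d h) z k : ℝ) ^ (3 / 4 : ℝ)) := by
  have hι : 0 ≤ iota M p := by linarith [ad.hι]
  have hH := ad.one_le_H
  have hmem := advF_mem M h
  have hosc : ∀ (t : QESATables S A) (y y' : S), |advF M h t y - advF M h t y'| ≤ M.H :=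
    fun t y y' => by have := abs_sub_le_of_mem (hmem t y) (hmem t y'); linarith
  have hposdev := hg.adv_pos.le_sqrt hH hι (by positivity) hosc hk hn
  have hnegdev := hg.adv_neg.le_sqrt hH hι (by positivity)
    (fun t y y' => by rw [← abs_neg]; convert hosc t y y' using 2; ring) hk hn
  have hsqdev := hg.adv_sq.le_sqrt hH hι (by positivity) (fun t y y' => by
    have h1 : ∀ y, -((M.H : ℝ) ^ 2) ≤ -advF M h t y ^ 2 ∧ -advF M h t y ^ 2 ≤ 0 := fun y => by
      have := hmem t y
      constructor <;> nlinarith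
    have := abs_sub_le_of_mem (h1 y) (h1 y'); linarith) hk hn
  have hbern := hg.adv_neg k hk hn
  have hσ : (T k).σadv h z.1 z.2 = ∑ j ∈ visits (cell x d h) z k,
      etaW M.H (cnt (cell x d h) z j + 1) (cnt (cell x d h) z k) *
        advF M h (T j) (x (j + 1) (h + 1)) ^ 2 := by
    rw [σadv_eq hh]
    refine sum_congr rfl fun j hj => ?_
    rw [(hb j (mem_visits.mp hj).1).advF_eq ad hh]
  have hμ : (T k).μadv h z.1 z.2 = ∑ j ∈ visits (cell x d h) z k,
      etaW M.H (cnt (cell x d h) z j + 1) (cnt (cell x d h) z k) *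
        advF M h (T j) (x (j + 1) (h + 1)) := by
    rw [μadv_eq hh]
    refine sum_congr rfl fun j hj => ?_
    rw [(hb j (mem_visits.mp hj).1).advF_eq ad hh]
  have hsum := sum_visits_etaW (c := cell x d h) (z := z) hH hn
  have hrate := rate_le ad.hι (n := cnt (cell x d h) z k) (by exact_mod_cast hn)
  set n := cnt (cell x d h) z k with hn'
  have hn0 : (0 : ℝ) < n := by exact_mod_cast hn
  set w : ℕ → ℝ := fun j => etaW M.H (cnt (cell x d h) z j + 1) n with hw
  have hw0 : ∀ j, 0 ≤ w j := fun j => etaW_nonneg hH _ _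
  have hwle : ∀ j, w j ≤ 2 * M.H / n := fun j => etaW_le hH (by omega) hn
  set a : ℕ → ℝ := fun j => advF M h (T j) (x (j + 1) (h + 1)) with ha
  set m : ℕ → ℝ := fun j => M.nextMean h z.1 z.2 (advF M h (T j)) with hm
  set q : ℕ → ℝ := fun j => M.nextMean h z.1 z.2 (fun y => advF M h (T j) y ^ 2) with hq
  have habs : ∀ j, |a j| ≤ M.H := fun j => abs_le.mpr
    ⟨(hmem _ _).1, (hmem _ _).2.trans (by positivity)⟩
  have hmabs : ∀ j, |m j| ≤ M.H := fun j => abs_le.mpr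
    ⟨EpisodicMDP.le_nextMean fun y => (hmem _ _).1,
      EpisodicMDP.nextMean_le fun y => (hmem _ _).2.trans (by positivity)⟩
  have hvar := sum_var_le_empirical (J := visits (cell x d h) z k) (w := w) (a := a) (m := m)
    (q := q) (fun j _ => hw0 j) hsum (fun j _ => habs j) (fun j _ => hmabs j)
  set X := √(M.H * iota M p / n) with hX
  have hX0 : 0 ≤ X := Real.sqrt_nonneg _
  have hneg_eq : ∀ j, M.nextMean h z.1 z.2 (fun y => -advF M h (T j) y) = - m j := fun j =>
    EpisodicMDP.nextMean_neg
  have hvneg_eq : ∀ j, M.nextVar h z.1 z.2 (fun y => -advF M h (T j) y)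
      = q j - m j ^ 2 := fun j => EpisodicMDP.nextVar_neg
  have hsqneg_eq : ∀ j, M.nextMean h z.1 z.2 (fun y => -advF M h (T j) y ^ 2) = - q j := fun j =>
    EpisodicMDP.nextMean_neg
  simp only [hneg_eq] at hnegdev
  simp only [hsqneg_eq] at hsqdev
  simp only [hneg_eq, hvneg_eq] at hbern
  change ∑ j ∈ visits (cell x d h) z k, w j * (a j - m j) ≤ _ at hposdev
  change ∑ j ∈ visits (cell x d h) z k, w j * (-a j - -m j) ≤ _ at hnegdev
  change ∑ j ∈ visits (cell x d h) z k, w j * (-a j ^ 2 - -q j) ≤ _ at hsqdev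
  change ∑ j ∈ visits (cell x d h) z k, w j * (-a j - -m j)
    ≤ 4 * √(iota M p * ∑ j ∈ visits (cell x d h) z k, w j ^ 2 * (q j - m j ^ 2)) + _ at hbern
  change -(∑ j ∈ visits (cell x d h) z k, w j * (a j - m j)) ≤ _
  have e1 : ∑ j ∈ visits (cell x d h) z k, w j * (-a j - -m j)
      = -∑ j ∈ visits (cell x d h) z k, w j * (a j - m j) := by
    rw [← sum_neg_distrib]; exact sum_congr rfl fun j _ => by ring
  have e2 : ∑ j ∈ visits (cell x d h) z k, w j * (-a j ^ 2 - -q j)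
      = ∑ j ∈ visits (cell x d h) z k, w j * (q j - a j ^ 2) :=
    sum_congr rfl fun j _ => by ring
  rw [e1] at hnegdev hbern
  rw [e2] at hsqdev
  rw [hσ, hμ]
  change _ ≤ 6 * √(iota M p / n) * (√M.H * √(∑ j ∈ visits (cell x d h) z k, w j * a j ^ 2
    - (∑ j ∈ visits (cell x d h) z k, w j * a j) ^ 2)) + _
  set emp := ∑ j ∈ visits (cell x d h) z k, w j * a j ^ 2
    - (∑ j ∈ visits (cell x d h) z k, w j * a j) ^ 2 with hemp
  set D := ∑ j ∈ visits (cell x d h) z k, w j * (a j - m j) with hD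
  have habsD : |D| ≤ 38 * M.H * X := abs_le.mpr ⟨by linarith, hposdev⟩
  have hvar2 : ∑ j ∈ visits (cell x d h) z k, w j * (q j - m j ^ 2)
      ≤ emp + 114 * M.H ^ 2 * X := by
    have : 2 * (M.H : ℝ) * |D| ≤ 2 * M.H * (38 * M.H * X) := by gcongr
    nlinarith
  have hv0 : ∀ j, 0 ≤ q j - m j ^ 2 := fun j => by
    rw [← hvneg_eq]; exact EpisodicMDP.nextVar_nonneg
  have hvar3 : ∑ j ∈ visits (cell x d h) z k, w j ^ 2 * (q j - m j ^ 2)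
      ≤ 2 * M.H / n * (emp + 114 * M.H ^ 2 * X) := by
    calc _ ≤ ∑ j ∈ visits (cell x d h) z k, 2 * M.H / n * (w j * (q j - m j ^ 2)) := by
          refine sum_le_sum fun j _ => ?_
          rw [sq, mul_assoc]
          exact mul_le_mul_of_nonneg_right (hwle j) (mul_nonneg (hw0 j) (hv0 j))
      _ ≤ _ := by rw [← mul_sum]; exact mul_le_mul_of_nonneg_left hvar2 (by positivity)
  refine (hbern.trans (advantage_rate_le hH ad.hι (by exact_mod_cast hn) ?_ hvar3))
  exact (sum_nonneg fun j _ => mul_nonneg (hw0 j) (hv0 j)).trans hvar2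

omit hn in
/-- Running means of the reference function nearly dominate its current conditional mean, because
the reference function decreases over time. -/
lemma ref_dev_le {j : ℕ} (hj : j ∈ visits (cell x d h) z k) :
    M.nextMean h z.1 z.2 (refF M h (T j)) - (T (j + 1)).μref h z.1 z.2
      ≤ 1 / ((cnt (cell x d h) z j + 1 : ℕ) : ℝ) * (4 * √(iota M p *
          ∑ i ∈ visits (cell x d h) z k, M.nextVar h z.1 z.2 (refF M h (T i)))
        + 16 * iota M p * M.H) := by
  have hι : 0 ≤ iota M p := by linarith [ad.hι]
  obtain ⟨hjk, hjz⟩ := mem_visits.mp hj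
  have hcnt : cnt (cell x d h) z (j + 1) = cnt (cell x d h) z j + 1 := cnt_succ_of_eq hjz
  have h1 := hg.ref_neg (j + 1) (by omega) (by omega)
  have h2 := μref_eq (p := p) (x := x) (d := d) hh z (j + 1)
  have hi0 : (0 : ℝ) < ((cnt (cell x d h) z j + 1 : ℕ) : ℝ) := by positivity
  have h3 : ∑ i ∈ visits (cell x d h) z (j + 1), (T i).VR (h + 1) (x (i + 1) (h + 1))
      = ∑ i ∈ visits (cell x d h) z (j + 1), refF M h (T i) (x (i + 1) (h + 1)) := by
    refine sum_congr rfl fun i hi => ?_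
    have := (mem_visits.mp hi).1
    rw [(hb i (by omega)).refF_eq ad hh]
  have h4 : ∑ i ∈ visits (cell x d h) z (j + 1), M.nextVar h z.1 z.2 (refF M h (T i))
      ≤ ∑ i ∈ visits (cell x d h) z k, M.nextVar h z.1 z.2 (refF M h (T i)) :=
    sum_le_sum_of_subset_of_nonneg (visits_mono (by omega)) fun _ _ _ =>
      EpisodicMDP.nextVar_nonneg
  have h5 : ((cnt (cell x d h) z j + 1 : ℕ) : ℝ) * M.nextMean h z.1 z.2 (refF M h (T j))
      ≤ ∑ i ∈ visits (cell x d h) z (j + 1), M.nextMean h z.1 z.2 (refF M h (T i)) := by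
    rw [← hcnt, cnt, ← nsmul_eq_mul, ← sum_const]
    refine sum_le_sum fun i hi => EpisodicMDP.nextMean_mono fun y => ?_
    have := (mem_visits.mp hi).1
    rw [(hb i (by omega)).refF_eq ad hh, (hb j hjk).refF_eq ad hh]
    exact VR_anti' hh (by omega) y
  have h6 : ∑ i ∈ visits (cell x d h) z (j + 1), (-refF M h (T i) (x (i + 1) (h + 1))
        - M.nextMean h z.1 z.2 (fun y => -refF M h (T i) y))
      = ∑ i ∈ visits (cell x d h) z (j + 1), M.nextMean h z.1 z.2 (refF M h (T i))
        - ∑ i ∈ visits (cell x d h) z (j + 1), refF M h (T i) (x (i + 1) (h + 1)) := by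
    rw [← sum_sub_distrib]
    exact sum_congr rfl fun i _ => by rw [EpisodicMDP.nextMean_neg]; ring
  rw [h6] at h1
  simp only [EpisodicMDP.nextVar_neg] at h1
  have h7 : √(iota M p * ∑ i ∈ visits (cell x d h) z (j + 1), M.nextVar h z.1 z.2 (refF M h (T i)))
      ≤ √(iota M p * ∑ i ∈ visits (cell x d h) z k, M.nextVar h z.1 z.2 (refF M h (T i))) :=
    Real.sqrt_le_sqrt (mul_le_mul_of_nonneg_left h4 hι)
  rw [hcnt, h3] at h2
  rw [div_mul_eq_mul_div, one_mul, le_div_iff₀ hi0]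
  linarith

lemma ref_var_le : ∑ i ∈ visits (cell x d h) z k, M.nextVar h z.1 z.2 (refF M h (T i))
    ≤ cnt (cell x d h) z k * (((T k).σref h z.1 z.2 - (T k).μref h z.1 z.2 ^ 2)
      + 60 * (M.H : ℝ) ^ 2 * √(iota M p / cnt (cell x d h) z k)) := by
  have hι : 0 ≤ iota M p := by linarith [ad.hι]
  have hH := ad.one_le_H
  have hmem := refF_mem M h
  have hosc : ∀ (t : QESATables S A) (y y' : S), |refF M h t y - refF M h t y'| ≤ M.H :=
    fun t y y' => by have := abs_sub_le_of_mem (hmem t y) (hmem t y'); linarith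
  have hposdev := hg.ref_pos.le_sqrt hι (by positivity) hosc hk hn
  have hnegdev := hg.ref_neg.le_sqrt hι (by positivity)
    (fun t y y' => by rw [← abs_neg]; convert hosc t y y' using 2; ring) hk hn
  have hsqdev := hg.ref_sq.le_sqrt hι (by positivity) (fun t y y' => by
    have h1 : ∀ y, -((M.H : ℝ) ^ 2) ≤ -refF M h t y ^ 2 ∧ -refF M h t y ^ 2 ≤ 0 := fun y => by
      have := hmem t y
      constructor <;> nlinarith
    have := abs_sub_le_of_mem (h1 y) (h1 y'); linarith) hk hn
  have hσ := σref_eq (p := p) (x := x) (d := d) hh z k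
  have hμ := μref_eq (p := p) (x := x) (d := d) hh z k
  have hσ' : ∑ j ∈ visits (cell x d h) z k, (T j).VR (h + 1) (x (j + 1) (h + 1)) ^ 2
      = ∑ j ∈ visits (cell x d h) z k, refF M h (T j) (x (j + 1) (h + 1)) ^ 2 :=
    sum_congr rfl fun j hj => by rw [(hb j (mem_visits.mp hj).1).refF_eq ad hh]
  have hμ' : ∑ j ∈ visits (cell x d h) z k, (T j).VR (h + 1) (x (j + 1) (h + 1))
      = ∑ j ∈ visits (cell x d h) z k, refF M h (T j) (x (j + 1) (h + 1)) :=
    sum_congr rfl fun j hj => by rw [(hb j (mem_visits.mp hj).1).refF_eq ad hh]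
  rw [hσ'] at hσ
  rw [hμ'] at hμ
  have hcard : (visits (cell x d h) z k).card = cnt (cell x d h) z k := rfl
  set n := cnt (cell x d h) z k with hn'
  have hn0 : (0 : ℝ) < n := by exact_mod_cast hn
  set J := visits (cell x d h) z k with hJ
  set a : ℕ → ℝ := fun j => refF M h (T j) (x (j + 1) (h + 1)) with ha
  set m : ℕ → ℝ := fun j => M.nextMean h z.1 z.2 (refF M h (T j)) with hm
  set q : ℕ → ℝ := fun j => M.nextMean h z.1 z.2 (fun y => refF M h (T j) y ^ 2) with hq
  have habs : ∀ j, |a j| ≤ M.H := fun j => abs_le.mpr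
    ⟨by linarith [(hmem (T j) (x (j + 1) (h + 1))).1], (hmem _ _).2⟩
  have hmabs : ∀ j, |m j| ≤ M.H := fun j => abs_le.mpr
    ⟨EpisodicMDP.le_nextMean fun y => by linarith [(hmem (T j) y).1],
      EpisodicMDP.nextMean_le fun y => (hmem _ _).2⟩
  have hvar := sum_var_le_empirical (J := J) (w := fun _ => 1 / (n : ℝ)) (a := a) (m := m)
    (q := q) (fun j _ => by positivity)
    (by rw [sum_const, hcard, nsmul_eq_mul]; field_simp) (fun j _ => habs j) (fun j _ => hmabs j)
  have hneg_eq : ∀ j, M.nextMean h z.1 z.2 (fun y => -refF M h (T j) y) = - m j := fun j =>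
    EpisodicMDP.nextMean_neg
  have hsqneg_eq : ∀ j, M.nextMean h z.1 z.2 (fun y => -refF M h (T j) y ^ 2) = - q j := fun j =>
    EpisodicMDP.nextMean_neg
  simp only [hneg_eq] at hnegdev
  simp only [hsqneg_eq] at hsqdev
  simp only [← mul_sum] at hvar
  set y := √(iota M p / n) with hy
  have hy0 : 0 ≤ y := Real.sqrt_nonneg _
  have e1 : ∑ j ∈ J, (-a j - -m j) = -∑ j ∈ J, (a j - m j) := by
    rw [← sum_neg_distrib]; exact sum_congr rfl fun j _ => by ring
  have e2 : ∑ j ∈ J, (-a j ^ 2 - -q j) = ∑ j ∈ J, (q j - a j ^ 2) :=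
    sum_congr rfl fun j _ => by ring
  change ∑ j ∈ J, (-a j - -m j) ≤ _ at hnegdev
  change ∑ j ∈ J, (-a j ^ 2 - -q j) ≤ _ at hsqdev
  change ∑ j ∈ J, (a j - m j) ≤ _ at hposdev
  rw [e1] at hnegdev
  rw [e2] at hsqdev
  change ∑ j ∈ J, (q j - m j ^ 2) ≤ _
  have habsD : |∑ j ∈ J, (a j - m j)| ≤ n * (20 * M.H * y) := abs_le.mpr ⟨by linarith, hposdev⟩
  rw [abs_mul, abs_of_pos (by positivity : (0 : ℝ) < 1 / n)] at hvar
  rw [← hσ, ← hμ] at hvar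
  have f1 : 1 / (n : ℝ) * (n * (T k).σref h z.1 z.2) = (T k).σref h z.1 z.2 := by field_simp
  have f2 : 1 / (n : ℝ) * (n * (T k).μref h z.1 z.2) = (T k).μref h z.1 z.2 := by field_simp
  rw [f1, f2] at hvar
  have f3 : 1 / (n : ℝ) * ∑ j ∈ J, (q j - a j ^ 2) ≤ 20 * M.H ^ 2 * y := by
    rw [one_div, inv_mul_le_iff₀ hn0]; exact hsqdev
  have f4 : 1 / (n : ℝ) * |∑ j ∈ J, (a j - m j)| ≤ 20 * M.H * y := by
    rw [one_div, inv_mul_le_iff₀ hn0]; exact habsD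
  have f5 : 2 * (M.H : ℝ) * (1 / (n : ℝ) * |∑ j ∈ J, (a j - m j)|) ≤ 2 * M.H * (20 * M.H * y) :=
    mul_le_mul_of_nonneg_left f4 (by positivity)
  have f6 : 1 / (n : ℝ) * ∑ j ∈ J, (q j - m j ^ 2)
      ≤ ((T k).σref h z.1 z.2 - (T k).μref h z.1 z.2 ^ 2) + 60 * M.H ^ 2 * y := by linarith
  rwa [one_div, inv_mul_le_iff₀ hn0] at f6

omit [Nonempty A] hh hg hk hn hb in
lemma inv_cnt_sum_le : ∑ j ∈ visits (cell x d h) z k,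
    etaW M.H (cnt (cell x d h) z j + 1) (cnt (cell x d h) z k) *
      (1 / ((cnt (cell x d h) z j + 1 : ℕ) : ℝ)) ≤ 2 * (1 / (cnt (cell x d h) z k : ℝ)) := by
  refine sum_visits_etaW_mul_le ad.one_le_H (fun n => 1 / (n : ℝ)) (fun n => by positivity)
    (fun n => ?_) k
  rcases Nat.eq_zero_or_pos n with rfl | hn
  · simp
  · rw [mul_one_div_cancel (by positivity), mul_one_div_cancel (by positivity)]

/-- Optimism of the reference-advantage estimate, once `z` has been visited. -/
lemma optQ_le_QR (hc : 400 ≤ p.cb) : M.optQ h z.1 z.2 ≤ (T k).QR h z.1 z.2 := by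
  have hH := ad.one_le_H
  have hι : 0 ≤ iota M p := by linarith [ad.hι]
  have hadv := adv_dev_le ad hh hg hk hn hb
  have hrefd := fun j hj => ref_dev_le ad hh hg hk hb (j := j) hj
  have href := reference_rate_le hH ad.hι (n := cnt (cell x d h) z k) (by exact_mod_cast hn)
    (ref_var_le ad hh hg hk hn hb)
  have hinv := inv_cnt_sum_le ad (h := h) (z := z) (k := k)
  have hthree := le_sum_visits_etaW_mul (c := cell x d h) (z := z) hH
    (fun n => (M.H : ℝ) ^ 2 * iota M p / (n : ℝ) ^ (3 / 4 : ℝ)) k hn (fun n h1 h2 => by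
      have : (0 : ℝ) < n := by exact_mod_cast h1
      gcongr)
  rw [QR_eq hh, BR_eq hh z k hn, etaW_zero_left hH hn, optQ_eq_sum ad (h := h) hn, zero_mul,
    zero_add]
  unfold bonus
  set X := 4 * √(iota M p *
          ∑ i ∈ visits (cell x d h) z k, M.nextVar h z.1 z.2 (refF M h (T i)))
        + 16 * iota M p * M.H with hX
  have hX0 : 0 ≤ X := by positivity
  set n := cnt (cell x d h) z k with hn'
  set J := visits (cell x d h) z k with hJ
  set y := √(iota M p / n) with hy
  have hy0 : 0 ≤ y := Real.sqrt_nonneg _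
  set eR := √((T k).σref h z.1 z.2 - (T k).μref h z.1 z.2 ^ 2) with heR
  have heR0 : 0 ≤ eR := Real.sqrt_nonneg _
  set eA := √M.H * √((T k).σadv h z.1 z.2 - (T k).μadv h z.1 z.2 ^ 2) with heA
  have heA0 : 0 ≤ eA := by positivity
  set G := (M.H : ℝ) ^ 2 * iota M p / (n : ℝ) ^ (3 / 4 : ℝ) with hG
  have hG0 : 0 ≤ G := by positivity
  have key : ∑ j ∈ J, etaW M.H (cnt (cell x d h) z j + 1) n *
        (M.r h z.1 z.2 + M.nextMean h z.1 z.2 (M.optValue (h + 1)))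
      + (∑ j ∈ J, etaW M.H (cnt (cell x d h) z j + 1) n *
        (advF M h (T j) (x (j + 1) (h + 1)) - M.nextMean h z.1 z.2 (advF M h (T j)))
      - X * ∑ j ∈ J, etaW M.H (cnt (cell x d h) z j + 1) n *
          (1 / ((cnt (cell x d h) z j + 1 : ℕ) : ℝ))
      + p.cb * ∑ j ∈ J, etaW M.H (cnt (cell x d h) z j + 1) n *
          ((M.H : ℝ) ^ 2 * iota M p / ((cnt (cell x d h) z j + 1 : ℕ) : ℝ) ^ (3 / 4 : ℝ)))
      ≤ ∑ j ∈ J, etaW M.H (cnt (cell x d h) z j + 1) n *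
          (M.r h z.1 z.2 + (T j).V (h + 1) (x (j + 1) (h + 1))
            - (T j).VR (h + 1) (x (j + 1) (h + 1)) + (T (j + 1)).μref h z.1 z.2
            + p.cb * ((M.H : ℝ) ^ 2 * iota M p
              / ((cnt (cell x d h) z j + 1 : ℕ) : ℝ) ^ (3 / 4 : ℝ))) := by
    rw [mul_sum, mul_sum, ← sum_sub_distrib, ← sum_add_distrib, ← sum_add_distrib]
    refine sum_le_sum fun j hj => ?_
    have hbj := hb j (mem_visits.mp hj).1
    have hw := etaW_nonneg hH (cnt (cell x d h) z j + 1) n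
    have hd := hrefd j hj
    have hmean : M.nextMean h z.1 z.2 (M.optValue (h + 1))
        ≤ M.nextMean h z.1 z.2 (advF M h (T j)) + M.nextMean h z.1 z.2 (refF M h (T j)) := by
      rw [← EpisodicMDP.nextMean_add]
      refine EpisodicMDP.nextMean_mono fun y => ?_
      rw [hbj.advF_eq ad hh, hbj.refF_eq ad hh]
      linarith [(hbj.facts ad hh y).1]
    have hval := hbj.advF_eq ad hh (x (j + 1) (h + 1))
    rw [hval]
    have : M.nextMean h z.1 z.2 (M.optValue (h + 1)) - M.nextMean h z.1 z.2 (advF M h (T j))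
        - 1 / ((cnt (cell x d h) z j + 1 : ℕ) : ℝ) * X ≤ (T (j + 1)).μref h z.1 z.2 := by linarith
    have := mul_le_mul_of_nonneg_left this hw
    linarith
  refine le_trans ?_ (add_le_add le_rfl key)
  have k1 := mul_le_mul_of_nonneg_left hinv hX0
  have k2 := mul_le_mul_of_nonneg_left hthree (by linarith : 0 ≤ p.cb)
  have k3 : 2 / (n : ℝ) * X = X * (2 * (1 / n)) := by ring
  have k4 : 400 * G ≤ p.cb * G := mul_le_mul_of_nonneg_right hc hG0
  have k5 : 8 * (y * eR) ≤ p.cb * (y * eR) :=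
    mul_le_mul_of_nonneg_right (by linarith) (by positivity)
  have k6 : 6 * (y * eA) ≤ p.cb * (y * eA) :=
    mul_le_mul_of_nonneg_right (by linarith) (by positivity)
  have k7 : p.cb * y * (eR + eA) = p.cb * (y * eR) + p.cb * (y * eA) := by ring
  rw [k7]
  linarith

end optimism

/-- On the good event all tables bracket the optimal values. -/
lemma bracket [Nonempty A] (ad : Admissible M p x d) (hc : 400 ≤ p.cb)
    (hg : ∀ h ∈ Icc 1 M.H, ∀ z, GoodAt M p x d h z) (k : ℕ) (hk : k ≤ p.K) :
    Bracket M p x d k ∧ ∀ h ∈ Icc 1 M.H, ∀ s a, M.optQ h s a ≤ (T k).Q h s a := by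
  induction k using Nat.strong_induction_on with
  | _ k ih =>
  have hb : ∀ j < k, Bracket M p x d j := fun j hj => (ih j hj (by omega)).1
  have hQ : ∀ h ∈ Icc 1 M.H, ∀ s a, M.optQ h s a ≤ (T k).Q h s a := by
    intro h hh s a
    have hh' := hh
    simp only [mem_Icc] at hh'
    cases k with
    | zero =>
      simp only [tables, init]
      exact (EpisodicMDP.optQ_le_optValue M hh'.1 hh'.2 s a).trans
        (EpisodicMDP.optValue_le M hh'.1 s)
    | succ k =>
      have hprev := (ih k (by omega) (by omega)).2 h hh s a
      by_cases hz : cell x d h k = (s, a)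
      · have hn : 1 ≤ cnt (cell x d h) (s, a) (k + 1) := by rw [cnt_succ_of_eq hz]; omega
        rw [Q_visit hh hz]
        exact le_min (le_min (optQ_le_QR ad hh (hg h hh (s, a)) hk hn hb hc)
          (optQ_le_QUCB ad hh (hg h hh (s, a)) hk hn hb (by linarith))) hprev
      · rw [(entries_of_ne hh hz).2.1]; exact hprev
  refine ⟨fun h hh s => ?_, hQ⟩
  simp only [mem_Icc] at hh
  rcases Nat.lt_or_ge M.H h with hlt | hle
  · obtain rfl : h = M.H + 1 := by omega
    rw [V_last, VLCB_last, EpisodicMDP.optValue_of_lt M hlt]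
    exact ⟨le_rfl, le_rfl⟩
  · have hh' : h ∈ Icc 1 M.H := by simp; omega
    constructor
    · rw [EpisodicMDP.optValue_eq M hh.1 hle, V_eq_iSup hh']
      exact (hQ h hh' s _).trans
        (le_ciSup (f := fun a => (T k).Q h s a) (Set.finite_range _).bddAbove _)
    · cases k with
      | zero => simpa [tables, init] using EpisodicMDP.optValue_nonneg M hh.1 s
      | succ k =>
        have hprev := ((ih k (by omega) (by omega)).1 h (by simp; omega) s).2
        by_cases hs : x (k + 1) h = s
        · rw [VLCB_visit hh' hs]
          refine max_le (ciSup_le fun a => ?_) hprev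
          refine le_trans ?_ (EpisodicMDP.optQ_le_optValue M hh.1 hle s a)
          rcases Nat.eq_zero_or_pos (cnt (cell x d h) (s, a) (k + 1)) with h0 | h0
          · have hv : visits (cell x d h) (s, a) (k + 1) = ∅ := card_eq_zero.mp h0
            have := QLCB_eq (p := p) (x := x) (d := d) hh' (s, a) (k + 1)
            rw [hv, sum_empty] at this
            rw [this]; exact EpisodicMDP.optQ_nonneg M hh.1 hle s a
          · exact QLCB_le_optQ ad hh' (hg h hh' (s, a)) hk h0 hb (by linarith)
        · rw [(state_entries_of_ne hh' hs).2.1]; exact hprev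

/-! ### Upper bounds for the estimates -/

/-- The excess of the reference function over `V^⋆_{h+1} + β`. -/
noncomputable def excess (M : EpisodicMDP S A) (p : QESAParams) (h : ℕ) (t : QESATables S A)
    (y : S) : ℝ := t.VR (h + 1) y - setF M p h t y

/-- The width `V_h - V_h^LCB` at the state visited in episode `j + 1`, if it exceeds `β`, and `0`
otherwise. -/
noncomputable def wideWidth (M : EpisodicMDP S A) (p : QESAParams) (x : ℕ → ℕ → S)
    (d : ℕ → ℕ → S → A) (h j : ℕ) : ℝ :=
  if p.β < (tables M p x d j).V h (x (j + 1) h) - (tables M p x d j).VLCB h (x (j + 1) h) then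
    (tables M p x d j).V h (x (j + 1) h) - (tables M p x d j).VLCB h (x (j + 1) h) else 0

section excess
variable [Nonempty A] (ad : Admissible M p x d) {h : ℕ} (hh : h ∈ Icc 1 M.H)
include ad hh

lemma excess_nonneg {j : ℕ} (hb : Bracket M p x d j) (y : S) : 0 ≤ excess M p h (T j) y := by
  obtain ⟨h1, h2, h3, h4, h5, h6⟩ := hb.facts ad hh y
  unfold excess setF
  exact sub_nonneg.mpr (max_le (h1.trans h2) (min_le_right _ _))

lemma excess_le_wideWidth {j : ℕ} (hb : Bracket M p x d j) :
    excess M p h (T j) (x (j + 1) (h + 1)) ≤ wideWidth M p x d (h + 1) j := by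
  set y := x (j + 1) (h + 1) with hy
  obtain ⟨h1, h2, h3, h4, h5, h6⟩ := hb.facts ad hh y
  have hβ := ad.hβ
  have hw0 : 0 ≤ wideWidth M p x d (h + 1) j := by
    unfold wideWidth; split_ifs with hc
    · exact hβ.le.trans hc.le
    · exact le_rfl
  by_cases hle : (T j).VR (h + 1) y ≤ M.optValue (h + 1) y + p.β
  · refine le_trans (le_of_eq ?_) hw0
    unfold excess setF
    rw [min_eq_right hle, max_eq_right (h1.trans h2), sub_self]
  · rw [not_le] at hle
    simp only [mem_Icc] at hh
    rcases Nat.lt_or_ge h M.H with hlt | hge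
    · have hh' : h + 1 ∈ Icc 1 M.H := by simp; omega
      rcases VR_cases (p := p) (x := x) (d := d) hh' j y with ⟨_, e⟩ | ⟨_, _, e⟩
      · unfold excess setF wideWidth
        rw [min_eq_left hle.le, max_eq_right (by linarith), if_pos (by rw [← hy]; linarith), ← hy]
        linarith
      · exfalso; linarith
    · obtain rfl : h = M.H := by omega
      rw [VR_last, EpisodicMDP.optValue_of_lt M (by omega)] at hle
      exfalso; linarith

lemma excess_le_H {j : ℕ} (hb : Bracket M p x d j) (y : S) : excess M p h (T j) y ≤ M.H := by
  obtain ⟨h1, h2, h3, h4, h5, h6⟩ := hb.facts ad hh y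
  have := (setF_mem M p ad.hβ.le h (T j) y).1
  unfold excess
  linarith

omit ad in
/-- The clamped reference function changes by at most `β`, and only while it is not settled. -/
lemma setF_le_add (hβ : 0 ≤ p.β) {i j : ℕ} (hij : i ≤ j) (y : S) :
    setF M p h (T i) y ≤ setF M p h (T j) y + unsF M p h (T i) y := by
  have hi := setF_mem M p hβ h (T i) y
  have hj := setF_mem M p hβ h (T j) y
  unfold unsF
  split_ifs with hc
  · linarith
  · rw [add_zero]
    have : (T j).VR (h + 1) y = (T i).VR (h + 1) y := by
      simp only [mem_Icc] at hh
      rcases Nat.lt_or_ge h M.H with hlt | hge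
      · refine VR_of_settled (by simp; omega) hij y ?_
        by_contra hu
        exact hc ⟨by omega, by simpa using hu⟩
      · obtain rfl : h = M.H := by omega
        rw [VR_last, VR_last]
    unfold setF
    rw [this]

end excess

section rates
variable {H i n β Q U : ℝ}

lemma sqrt_reference_var_le {e : ℝ} (hQ : 0 ≤ Q) (hβ : 0 ≤ β) (hH : 0 ≤ H) (hi : 0 ≤ i)
    (hn : 0 < n) (hU : 0 ≤ U)
    (he : e ≤ 4 * Q + 4 * β ^ 2 + 40 * H ^ 2 * (i / n) + 4 * (U / n)) :
    √e ≤ 2 * √Q + 2 * β + 7 * H * √(i / n) + 2 * √U / √n := by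
  apply Real.sqrt_le_iff.mpr ⟨by positivity, he.trans ?_⟩
  have s1 : 4 * Q = (2 * √Q) ^ 2 := by
    rw [mul_pow, Real.sq_sqrt hQ]; ring
  have s2 : 4 * (U / n) = (2 * √U / √n) ^ 2 := by
    rw [div_pow, mul_pow, Real.sq_sqrt hU, Real.sq_sqrt hn.le]; ring
  have s3 : 40 * H ^ 2 * (i / n) ≤ (7 * H * √(i / n)) ^ 2 := by
    rw [mul_pow, Real.sq_sqrt (by positivity), mul_pow]
    have : 0 ≤ H ^ 2 * (i / n) := by positivity
    linarith
  rw [s1, s2]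
  have h1 : 0 ≤ 2 * √Q := by positivity
  have h2 : 0 ≤ 2 * √U / √n := by positivity
  have h3 : 0 ≤ 7 * H * √(i / n) := by positivity
  generalize 2 * √Q = a at *
  generalize 2 * √U / √n = b at *
  generalize 7 * H * √(i / n) = c at *
  have : (a + 2 * β + c + b) ^ 2 = a ^ 2 + 4 * β ^ 2 + c ^ 2 + b ^ 2
      + (4 * (a * β) + 2 * (a * c) + 2 * (a * b) + 4 * (β * c) + 4 * (β * b) + 2 * (c * b)) := by
    ring
  rw [this]
  have h4 : 0 ≤ 4 * (a * β) + 2 * (a * c) + 2 * (a * b) + 4 * (β * c) + 4 * (β * b)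
      + 2 * (c * b) := by positivity
  linarith

lemma sq_add_deviation_le {v o e c : ℝ} (h0 : o ≤ v) (h1 : v ≤ o + β) :
    (v + e - c) ^ 2 ≤ 2 * (o - c) ^ 2 + 4 * β ^ 2 + 4 * e ^ 2 := by
  have hvo : (v - o) ^ 2 ≤ β ^ 2 := sq_le_sq' (by linarith) (by linarith)
  have e1 := sq_nonneg ((o - c) - (v - o + e))
  have e2 := sq_nonneg ((v - o) - e)
  have e3 : (v + e - c) ^ 2 = 2 * (o - c) ^ 2 + 2 * (v - o + e) ^ 2
      - ((o - c) - (v - o + e)) ^ 2 := by ring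
  have e4 : (v - o + e) ^ 2 = 2 * (v - o) ^ 2 + 2 * e ^ 2 - ((v - o) - e) ^ 2 := by ring
  linarith

lemma reference_drift_le {G Un Ex : ℝ} (hQ : 0 ≤ Q) (hβH : β ≤ H) (hH : 1 ≤ H)
    (hi : 0 ≤ i) (hn : 0 < n) (hG : G ≤ 2 * Un + 48 * β * i) :
    (4 * √(i * (n * (2 * Q + 2 * β ^ 2))) + 32 * i * H + G + Ex) * (2 * (1 / n))
      ≤ 12 * (√((Q + β ^ 2 * H) * i) / √n) + (160 * (H * i) + 4 * Un + 2 * Ex) / n := by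
  set C := √((Q + β ^ 2 * H) * i) with hC
  have hC0 : 0 ≤ C := Real.sqrt_nonneg _
  have hsn : √n ^ 2 = n := Real.sq_sqrt hn.le
  have hsn0 : 0 < √n := Real.sqrt_pos.mpr hn
  have e1 : √(i * (n * (2 * Q + 2 * β ^ 2))) ≤ 3 / 2 * (C * √n) := by
    apply Real.sqrt_le_iff.mpr ⟨by positivity, ?_⟩
    rw [mul_pow, mul_pow, hsn, hC, Real.sq_sqrt (by positivity)]
    have h2 : β ^ 2 ≤ β ^ 2 * H := le_mul_of_one_le_right (sq_nonneg _) hH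
    have h0 : 0 ≤ i * n := by positivity
    have h1 : i * n * (2 * Q + 2 * β ^ 2) ≤ i * n * (9 / 4 * (Q + β ^ 2 * H)) :=
      mul_le_mul_of_nonneg_left (by linarith [sq_nonneg β]) h0
    linarith
  have e2 : β * i ≤ H * i := mul_le_mul_of_nonneg_right hβH hi
  have e3 : 4 * √(i * (n * (2 * Q + 2 * β ^ 2))) + 32 * i * H + G + Ex
      ≤ 6 * (C * √n) + (80 * (H * i) + 2 * Un + Ex) := by linarith
  refine (mul_le_mul_of_nonneg_right e3 (by positivity)).trans_eq ?_
  have e4 : C * √n * (1 / n) = C / √n := by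
    nth_rewrite 2 [← hsn]
    field_simp
  calc _ = 12 * (C * √n * (1 / n)) + (160 * (H * i) + 4 * Un + 2 * Ex) / n := by ring
    _ = _ := by rw [e4]

lemma settled_rate_le (hQ : 0 ≤ Q) (hβ : 0 ≤ β) (hH : 0 ≤ H) (hi : 0 ≤ i) :
    38 * β * √(H * i / n) ≤ 38 * (√((Q + β ^ 2 * H) * i) / √n) := by
  rw [Real.sqrt_div (by positivity), mul_assoc, ← mul_div_assoc]
  refine mul_le_mul_of_nonneg_left ?_ (by norm_num)
  refine div_le_div_of_nonneg_right ?_ (Real.sqrt_nonneg _)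
  rw [← Real.sqrt_sq hβ, ← Real.sqrt_mul (by positivity), Real.sqrt_sq hβ]
  apply Real.sqrt_le_sqrt
  linarith [mul_nonneg hQ hi]

lemma bonus_rate_le (hQ : 0 ≤ Q) (hβ : 0 ≤ β) (hH : 1 ≤ H) (hi : 0 ≤ i) (hn : 0 < n) :
    √(i / n) * (2 * √Q + 2 * β + 7 * H * √(i / n) + 2 * √U / √n + √H * β)
      ≤ 5 * (√((Q + β ^ 2 * H) * i) / √n) + (7 * (H * i) + 2 * √(i * U)) / n := by
  have hsn : √n ^ 2 = n := Real.sq_sqrt hn.le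
  have hsn0 : 0 < √n := Real.sqrt_pos.mpr hn
  have hi2 : √i ^ 2 = i := Real.sq_sqrt hi
  set C := √((Q + β ^ 2 * H) * i) with hC
  have hβi : 0 ≤ β ^ 2 * H * i := by positivity
  have c1 : √i * √Q ≤ C := by
    rw [← Real.sqrt_mul hi]; apply Real.sqrt_le_sqrt
    linarith
  have c3 : √i * (√H * β) ≤ C := by
    rw [← Real.sqrt_sq hβ, ← Real.sqrt_mul (by positivity), ← Real.sqrt_mul hi]
    apply Real.sqrt_le_sqrt
    linarith [mul_nonneg hQ hi]
  have c2 : √i * β ≤ C := by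
    refine le_trans ?_ c3
    refine mul_le_mul_of_nonneg_left ?_ (Real.sqrt_nonneg _)
    exact le_mul_of_one_le_left hβ (Real.one_le_sqrt.mpr hH)
  rw [Real.sqrt_div hi, Real.sqrt_mul hi]
  have e1 : √i / √n * (2 * √Q + 2 * β + 7 * H * (√i / √n) + 2 * √U / √n + √H * β)
      = (2 * (√i * √Q) + 2 * (√i * β) + √i * (√H * β)) / √n
        + (7 * (H * √i ^ 2) + 2 * (√i * √U)) / √n ^ 2 := by
    field_simp; ring
  rw [e1, hi2, hsn, ← mul_div_assoc]
  refine add_le_add (div_le_div_of_nonneg_right ?_ hsn0.le) le_rfl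
  linarith

end rates

section upper
variable [Nonempty A] (ad : Admissible M p x d) {h : ℕ} (hh : h ∈ Icc 1 M.H) {z : S × A}
  (hg : GoodAt M p x d h z) {k : ℕ} (hk : k ≤ p.K) (hn : 1 ≤ cnt (cell x d h) z k)
  (hb : ∀ j < k, Bracket M p x d j)
include ad hh hg hk hn

omit [Nonempty A] hh hn in
lemma uns_mean_le : ∑ j ∈ visits (cell x d h) z k, M.nextMean h z.1 z.2 (unsF M p h (T j))
    ≤ 2 * ∑ j ∈ visits (cell x d h) z k, unsF M p h (T j) (x (j + 1) (h + 1))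
      + 48 * p.β * iota M p := by
  have hι : 0 ≤ iota M p := by linarith [ad.hι]
  have hβ := ad.hβ.le
  have hmem := unsF_mem M p hβ h
  rcases Nat.eq_zero_or_pos (cnt (cell x d h) z k) with h0 | hn
  · have : visits (cell x d h) z k = ∅ := card_eq_zero.mp h0
    rw [this]; simp; positivity
  have h1 := hg.uns k hk hn
  simp only [EpisodicMDP.nextVar_neg] at h1
  have h2 : ∑ j ∈ visits (cell x d h) z k, (-unsF M p h (T j) (x (j + 1) (h + 1))
        - M.nextMean h z.1 z.2 (fun y => -unsF M p h (T j) y))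
      = ∑ j ∈ visits (cell x d h) z k, M.nextMean h z.1 z.2 (unsF M p h (T j))
        - ∑ j ∈ visits (cell x d h) z k, unsF M p h (T j) (x (j + 1) (h + 1)) := by
    rw [← sum_sub_distrib]
    exact sum_congr rfl fun i _ => by rw [EpisodicMDP.nextMean_neg]; ring
  rw [h2] at h1
  set G := ∑ j ∈ visits (cell x d h) z k, M.nextMean h z.1 z.2 (unsF M p h (T j)) with hG
  have hG0 : 0 ≤ G := sum_nonneg fun j _ => EpisodicMDP.le_nextMean fun y => (hmem _ y).1
  have h3 : ∑ j ∈ visits (cell x d h) z k, M.nextVar h z.1 z.2 (unsF M p h (T j)) ≤ p.β * G := by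
    rw [hG, mul_sum]
    exact sum_le_sum fun j _ => EpisodicMDP.nextVar_le_mul_mean (fun y => (hmem _ y).1)
      (fun y => (hmem _ y).2)
  have h4 : √(iota M p * ∑ j ∈ visits (cell x d h) z k, M.nextVar h z.1 z.2 (unsF M p h (T j)))
      ≤ G / 8 + 2 * (p.β * iota M p) := by
    apply Real.sqrt_le_iff.mpr ⟨by positivity, ?_⟩
    calc _ ≤ iota M p * (p.β * G) := mul_le_mul_of_nonneg_left h3 hι
      _ ≤ _ := by nlinarith [sq_nonneg (G / 8 - 2 * (p.β * iota M p))]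
  linarith

lemma optSq_sum_le : ∑ j ∈ visits (cell x d h) z k, optSqF M h z (x (j + 1) (h + 1))
    ≤ 2 * (cnt (cell x d h) z k * M.maxCondVar) + 20 * M.H ^ 2 * iota M p := by
  have hι : 0 ≤ iota M p := by linarith [ad.hι]
  have hh' := hh
  simp only [mem_Icc] at hh'
  have h1 := hg.opt_sq k hk hn
  have hmean : M.nextMean h z.1 z.2 (optSqF M h z) ≤ M.maxCondVar := by
    have := EpisodicMDP.nextVar_le_maxCondVar M hh'.1 hh'.2 z.1 z.2
    rwa [EpisodicMDP.nextVar_eq] at this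
  have hmean0 : 0 ≤ M.nextMean h z.1 z.2 (optSqF M h z) :=
    EpisodicMDP.le_nextMean fun y => sq_nonneg _
  have hcard : (visits (cell x d h) z k).card = cnt (cell x d h) z k := rfl
  rw [sum_sub_distrib, sum_const, sum_const, hcard, nsmul_eq_mul, nsmul_eq_mul] at h1
  have hmem : ∀ y, optSqF M h z y ≤ M.H ^ 2 := fun y => by
    have hV : ∀ y, 0 ≤ M.optValue (h + 1) y ∧ M.optValue (h + 1) y ≤ M.H := fun y =>
      ⟨EpisodicMDP.optValue_nonneg M (by omega) y, EpisodicMDP.optValue_le M (by omega) y⟩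
    have := abs_sub_le_of_mem (hV y)
      ⟨EpisodicMDP.le_nextMean (M := M) (h := h) (s := z.1) (a := z.2) fun y => (hV y).1,
        EpisodicMDP.nextMean_le fun y => (hV y).2⟩
    rw [sub_zero, abs_le] at this
    exact sq_le_sq' this.1 this.2
  have hvar := EpisodicMDP.nextVar_le_mul_mean (M := M) (h := h) (s := z.1) (a := z.2)
    (f := optSqF M h z) (fun y => sq_nonneg _) hmem
  have hn0 : (0 : ℝ) < cnt (cell x d h) z k := by exact_mod_cast hn
  set n : ℝ := (cnt (cell x d h) z k : ℝ) with hn'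
  set m := M.nextMean h z.1 z.2 (optSqF M h z) with hm
  have h4 : √(iota M p * (n * M.nextVar h z.1 z.2 (optSqF M h z)))
      ≤ n * m / 4 + M.H ^ 2 * iota M p := by
    apply Real.sqrt_le_iff.mpr ⟨by positivity, ?_⟩
    calc _ ≤ iota M p * (n * (M.H ^ 2 * m)) := by gcongr
      _ ≤ _ := by nlinarith [sq_nonneg (n * m / 4 - M.H ^ 2 * iota M p)]
  have h5 : n * m ≤ n * M.maxCondVar := by gcongr
  linarith

include hb

omit hn in
/-- Running means of the reference function, compared with its clamped conditional mean. -/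
lemma ref_upper {j : ℕ} (hj : j ∈ visits (cell x d h) z k) :
    (T (j + 1)).μref h z.1 z.2 - M.nextMean h z.1 z.2 (setF M p h (T j))
      ≤ 1 / ((cnt (cell x d h) z j + 1 : ℕ) : ℝ) * (4 * √(iota M p *
          (cnt (cell x d h) z k * (2 * M.maxCondVar + 2 * p.β ^ 2))) + 32 * iota M p * M.H
        + ∑ i ∈ visits (cell x d h) z k, M.nextMean h z.1 z.2 (unsF M p h (T i))
        + ∑ i ∈ visits (cell x d h) z k, excess M p h (T i) (x (i + 1) (h + 1))) := by
  have hι : 0 ≤ iota M p := by linarith [ad.hι]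
  have hβ := ad.hβ.le
  have hh' := hh
  simp only [mem_Icc] at hh'
  obtain ⟨hjk, hjz⟩ := mem_visits.mp hj
  have hcnt : cnt (cell x d h) z (j + 1) = cnt (cell x d h) z j + 1 := cnt_succ_of_eq hjz
  have hsub : visits (cell x d h) z (j + 1) ⊆ visits (cell x d h) z k := visits_mono (by omega)
  have h1 := hg.set_one (j + 1) (by omega) (by omega)
  have h2 := μref_eq (p := p) (x := x) (d := d) hh z (j + 1)
  have hi0 : (0 : ℝ) < ((cnt (cell x d h) z j + 1 : ℕ) : ℝ) := by positivity
  have h3 : ∑ i ∈ visits (cell x d h) z (j + 1), (T i).VR (h + 1) (x (i + 1) (h + 1))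
      = ∑ i ∈ visits (cell x d h) z (j + 1), setF M p h (T i) (x (i + 1) (h + 1))
        + ∑ i ∈ visits (cell x d h) z (j + 1), excess M p h (T i) (x (i + 1) (h + 1)) := by
    rw [← sum_add_distrib]
    exact sum_congr rfl fun i _ => by unfold excess; ring
  have h4 : ∑ i ∈ visits (cell x d h) z (j + 1), M.nextVar h z.1 z.2 (setF M p h (T i))
      ≤ cnt (cell x d h) z k * (2 * M.maxCondVar + 2 * p.β ^ 2) := by
    have hq : ∀ i, M.nextVar h z.1 z.2 (setF M p h (T i)) ≤ 2 * M.maxCondVar + 2 * p.β ^ 2 := by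
      intro i
      have e1 := EpisodicMDP.nextVar_le_two_mul (M := M) (h := h) (s := z.1) (a := z.2)
        (f := setF M p h (T i)) (g := M.optValue (h + 1)) (B := p.β) (fun y => by
          have := setF_mem M p hβ h (T i) y
          rw [abs_le]; constructor <;> linarith)
      have e2 := EpisodicMDP.nextVar_le_maxCondVar M hh'.1 hh'.2 z.1 z.2
      linarith
    calc _ ≤ ∑ i ∈ visits (cell x d h) z k, M.nextVar h z.1 z.2 (setF M p h (T i)) :=
          sum_le_sum_of_subset_of_nonneg hsub fun _ _ _ => EpisodicMDP.nextVar_nonneg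
      _ ≤ ∑ i ∈ visits (cell x d h) z k, (2 * M.maxCondVar + 2 * p.β ^ 2) :=
          sum_le_sum fun i _ => hq i
      _ = _ := by rw [sum_const, nsmul_eq_mul]; rfl
  have h5 : ∑ i ∈ visits (cell x d h) z (j + 1), M.nextMean h z.1 z.2 (setF M p h (T i))
      ≤ ((cnt (cell x d h) z j + 1 : ℕ) : ℝ) * M.nextMean h z.1 z.2 (setF M p h (T j))
        + ∑ i ∈ visits (cell x d h) z (j + 1), M.nextMean h z.1 z.2 (unsF M p h (T i)) := by
    rw [← hcnt, cnt, ← nsmul_eq_mul, ← sum_const, ← sum_add_distrib]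
    refine sum_le_sum fun i hi => ?_
    rw [← EpisodicMDP.nextMean_add]
    refine EpisodicMDP.nextMean_mono fun y => setF_le_add hh hβ ?_ y
    have := (mem_visits.mp hi).1
    omega
  have h6 : ∑ i ∈ visits (cell x d h) z (j + 1), M.nextMean h z.1 z.2 (unsF M p h (T i))
      ≤ ∑ i ∈ visits (cell x d h) z k, M.nextMean h z.1 z.2 (unsF M p h (T i)) :=
    sum_le_sum_of_subset_of_nonneg hsub fun i _ _ =>
      EpisodicMDP.le_nextMean fun y => (unsF_mem M p hβ h _ y).1
  have h7 : ∑ i ∈ visits (cell x d h) z (j + 1), excess M p h (T i) (x (i + 1) (h + 1))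
      ≤ ∑ i ∈ visits (cell x d h) z k, excess M p h (T i) (x (i + 1) (h + 1)) :=
    sum_le_sum_of_subset_of_nonneg hsub fun i hi _ =>
      excess_nonneg ad hh (hb i (mem_visits.mp hi).1) _
  have h8 := Real.sqrt_le_sqrt (mul_le_mul_of_nonneg_left h4 hι)
  rw [sum_sub_distrib] at h1
  rw [hcnt, h3] at h2
  rw [div_mul_eq_mul_div, one_mul, le_div_iff₀ hi0]
  linarith

/-- The bonus `B^R`, up to lower-order terms. -/
lemma bonus_le : bonus M p (T k) h z (cnt (cell x d h) z k)
    ≤ p.cb * √(iota M p / cnt (cell x d h) z k) * (2 * √M.maxCondVar + 2 * p.β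
      + 7 * M.H * √(iota M p / cnt (cell x d h) z k)
      + 2 * √(∑ i ∈ visits (cell x d h) z k, excess M p h (T i) (x (i + 1) (h + 1)) ^ 2)
        / √(cnt (cell x d h) z k) + √M.H * p.β) := by
  have hι : 0 ≤ iota M p := by linarith [ad.hι]
  have hβ := ad.hβ.le
  have hH := ad.one_le_H
  have hcb := ad.hcb
  have hh' := hh
  simp only [mem_Icc] at hh'
  have hQ0 : 0 ≤ M.maxCondVar :=
    EpisodicMDP.nextVar_nonneg.trans (EpisodicMDP.nextVar_le_maxCondVar M hh'.1 hh'.2 z.1 z.2)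
  have hσ := σref_eq (p := p) (x := x) (d := d) hh z k
  have hμ := μref_eq (p := p) (x := x) (d := d) hh z k
  have hopt := optSq_sum_le ad hh hg hk hn
  have hadv : (T k).σadv h z.1 z.2 - (T k).μadv h z.1 z.2 ^ 2 ≤ p.β ^ 2 := by
    have : (T k).σadv h z.1 z.2 ≤ p.β ^ 2 := by
      rw [σadv_eq hh]
      calc _ ≤ ∑ j ∈ visits (cell x d h) z k,
            etaW M.H (cnt (cell x d h) z j + 1) (cnt (cell x d h) z k) * p.β ^ 2 := by
            refine sum_le_sum fun j hj => mul_le_mul_of_nonneg_left ?_ (etaW_nonneg hH _ _)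
            obtain ⟨h1, h2, h3, h4, h5, h6⟩ :=
              (hb j (mem_visits.mp hj).1).facts ad hh (x (j + 1) (h + 1))
            exact sq_le_sq' (by linarith) (by linarith)
        _ = _ := by rw [← sum_mul, sum_visits_etaW hH hn, one_mul]
    linarith [sq_nonneg ((T k).μadv h z.1 z.2)]
  have hA : √((T k).σadv h z.1 z.2 - (T k).μadv h z.1 z.2 ^ 2) ≤ p.β :=
    (Real.sqrt_le_sqrt hadv).trans_eq (Real.sqrt_sq hβ)
  have hcard : (visits (cell x d h) z k).card = cnt (cell x d h) z k := rfl
  have hn0 : (0 : ℝ) < cnt (cell x d h) z k := by exact_mod_cast hn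
  set n : ℝ := (cnt (cell x d h) z k : ℝ) with hn'
  set c := M.nextMean h z.1 z.2 (M.optValue (h + 1)) with hc
  set U := ∑ i ∈ visits (cell x d h) z k, excess M p h (T i) (x (i + 1) (h + 1)) ^ 2 with hU
  have hU0 : 0 ≤ U := sum_nonneg fun _ _ => sq_nonneg _
  have hsq : ∑ j ∈ visits (cell x d h) z k, ((T j).VR (h + 1) (x (j + 1) (h + 1)) - c) ^ 2
      ≤ 2 * ∑ j ∈ visits (cell x d h) z k, optSqF M h z (x (j + 1) (h + 1))
        + n * (4 * p.β ^ 2) + 4 * U := by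
    rw [hU, mul_sum, mul_sum, hn', ← hcard, ← nsmul_eq_mul, ← sum_const, ← sum_add_distrib,
      ← sum_add_distrib]
    refine sum_le_sum fun j _ => ?_
    have hm := setF_mem M p hβ h (T j) (x (j + 1) (h + 1))
    have e : (T j).VR (h + 1) (x (j + 1) (h + 1)) = setF M p h (T j) (x (j + 1) (h + 1))
      + excess M p h (T j) (x (j + 1) (h + 1)) := by unfold excess; ring
    rw [e]
    unfold optSqF
    set v := setF M p h (T j) (x (j + 1) (h + 1))
    set e' := excess M p h (T j) (x (j + 1) (h + 1))
    set o := M.optValue (h + 1) (x (j + 1) (h + 1))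
    exact sq_add_deviation_le hm.1 hm.2
  have hexp : ∑ j ∈ visits (cell x d h) z k, ((T j).VR (h + 1) (x (j + 1) (h + 1)) - c) ^ 2
      = n * (T k).σref h z.1 z.2 - 2 * c * (n * (T k).μref h z.1 z.2) + n * c ^ 2 := by
    rw [hσ, hμ, mul_sum, hn', ← hcard, ← nsmul_eq_mul, ← sum_const, ← sum_sub_distrib,
      ← sum_add_distrib]
    exact sum_congr rfl fun j _ => by ring
  have hR : (T k).σref h z.1 z.2 - (T k).μref h z.1 z.2 ^ 2
      ≤ 4 * M.maxCondVar + 4 * p.β ^ 2 + 40 * M.H ^ 2 * (iota M p / n) + 4 * (U / n) := by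
    have e1 : n * ((T k).σref h z.1 z.2 - (T k).μref h z.1 z.2 ^ 2)
        ≤ n * (4 * M.maxCondVar + 4 * p.β ^ 2 + 40 * M.H ^ 2 * (iota M p / n) + 4 * (U / n)) := by
      have e2 : n * (4 * M.maxCondVar + 4 * p.β ^ 2 + 40 * M.H ^ 2 * (iota M p / n) + 4 * (U / n))
          = 4 * (n * M.maxCondVar) + n * (4 * p.β ^ 2) + 40 * M.H ^ 2 * iota M p + 4 * U := by
        field_simp
      rw [e2]
      have e3 : 0 ≤ n * ((T k).μref h z.1 z.2 - c) ^ 2 := by positivity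
      have e4 : n * ((T k).σref h z.1 z.2 - (T k).μref h z.1 z.2 ^ 2)
          = (n * (T k).σref h z.1 z.2 - 2 * c * (n * (T k).μref h z.1 z.2) + n * c ^ 2)
            - n * ((T k).μref h z.1 z.2 - c) ^ 2 := by ring
      rw [e4, ← hexp]
      linarith
    exact le_of_mul_le_mul_left e1 hn0
  have hRr := sqrt_reference_var_le hQ0 hβ (by linarith : (0 : ℝ) ≤ M.H) hι hn0 hU0 hR
  unfold bonus
  have hcb0 : 0 ≤ p.cb * √(iota M p / ((cnt (cell x d h) z k : ℕ) : ℝ)) := by positivity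
  refine mul_le_mul_of_nonneg_left ?_ hcb0
  have : √(M.H : ℝ) * √((T k).σadv h z.1 z.2 - (T k).μadv h z.1 z.2 ^ 2) ≤ √M.H * p.β :=
    mul_le_mul_of_nonneg_left hA (Real.sqrt_nonneg _)
  linarith

/-- The numerator of the `1 / n` term of the estimation error at the cell `z` after `k` episodes:
unsettled reference values and excesses of reference values over `V^⋆ + β`. -/
noncomputable def cellCost (M : EpisodicMDP S A) (p : QESAParams) (x : ℕ → ℕ → S)
    (d : ℕ → ℕ → S → A) (h : ℕ) (z : S × A) (k : ℕ) : ℝ :=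
  8 * M.H * iota M p
    + ∑ i ∈ visits (cell x d h) z k, unsF M p h (tables M p x d i) (x (i + 1) (h + 1))
    + ∑ i ∈ visits (cell x d h) z k, excess M p h (tables M p x d i) (x (i + 1) (h + 1))
    + 2 * √(iota M p * ∑ i ∈ visits (cell x d h) z k,
        excess M p h (tables M p x d i) (x (i + 1) (h + 1)) ^ 2)

omit [Nonempty A] hh hg hk hn hb in
lemma three_quarters_sum_le : ∑ j ∈ visits (cell x d h) z k,
    etaW M.H (cnt (cell x d h) z j + 1) (cnt (cell x d h) z k) *
      ((M.H : ℝ) ^ 2 * iota M p / ((cnt (cell x d h) z j + 1 : ℕ) : ℝ) ^ (3 / 4 : ℝ))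
      ≤ 2 * ((M.H : ℝ) ^ 2 * iota M p / (cnt (cell x d h) z k : ℝ) ^ (3 / 4 : ℝ)) := by
  have hι : 0 ≤ iota M p := by linarith [ad.hι]
  refine sum_visits_etaW_mul_le ad.one_le_H
    (fun n => (M.H : ℝ) ^ 2 * iota M p / (n : ℝ) ^ (3 / 4 : ℝ)) (fun n => by positivity)
    (fun n => ?_) k
  have key : ∀ m : ℕ, m * ((M.H : ℝ) ^ 2 * iota M p / (m : ℝ) ^ (3 / 4 : ℝ))
      = (M.H : ℝ) ^ 2 * iota M p * √√(m : ℝ) := by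
    intro m
    rw [rpow_three_quarters _ (Nat.cast_nonneg m)]
    rcases Nat.eq_zero_or_pos m with rfl | hm
    · simp
    · have h0 : 0 < √√(m : ℝ) := by
        have : (0 : ℝ) < m := by exact_mod_cast hm
        positivity
      have h4 := pow_four_sqrt_sqrt (n := (m : ℝ)) (Nat.cast_nonneg m)
      nth_rewrite 1 [← h4]
      field_simp
  rw [key, key]
  refine mul_le_mul_of_nonneg_left (Real.sqrt_le_sqrt (Real.sqrt_le_sqrt ?_)) (by positivity)
  push_cast; linarith

/-- Upper bound for the reference-advantage estimate, once `z` has been visited. -/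
lemma QR_le (hc : 400 ≤ p.cb) : (T k).QR h z.1 z.2 - M.optQ h z.1 z.2
    ≤ ∑ j ∈ visits (cell x d h) z k, etaW M.H (cnt (cell x d h) z j + 1) (cnt (cell x d h) z k) *
        ((T j).V (h + 1) (x (j + 1) (h + 1)) - M.optValue (h + 1) (x (j + 1) (h + 1)))
      + p.cb * (6 * √((M.maxCondVar + p.β ^ 2 * M.H) * iota M p) / √(cnt (cell x d h) z k)
        + 2 * ((M.H : ℝ) ^ 2 * iota M p / (cnt (cell x d h) z k : ℝ) ^ (3 / 4 : ℝ))
        + cellCost M p x d h z k / cnt (cell x d h) z k) := by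
  have hι : 0 ≤ iota M p := by linarith [ad.hι]
  have hβ := ad.hβ.le
  have hβH := ad.hβH
  have hH := ad.one_le_H
  have hh' := hh
  simp only [mem_Icc] at hh'
  have hQ0 : 0 ≤ M.maxCondVar :=
    EpisodicMDP.nextVar_nonneg.trans (EpisodicMDP.nextVar_le_maxCondVar M hh'.1 hh'.2 z.1 z.2)
  have hbonus := bonus_le ad hh hg hk hn hb
  have hrefu := fun j hj => ref_upper ad hh hg hk hb (j := j) hj
  have huns := uns_mean_le ad hg hk
  have hinv := inv_cnt_sum_le ad (h := h) (z := z) (k := k)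
  have hthree := three_quarters_sum_le ad (h := h) (z := z) (k := k)
  have hset := hg.set_eta.le_sqrt hH hι hβ (fun t y y' => by
    have h1 : ∀ y, -p.β ≤ M.optValue (h + 1) y - setF M p h t y ∧
        M.optValue (h + 1) y - setF M p h t y ≤ 0 := fun y => by
      have := setF_mem M p hβ h t y
      constructor <;> linarith
    have := abs_sub_le_of_mem (h1 y) (h1 y'); linarith) hk hn
  rw [QR_eq hh, BR_eq hh z k hn, etaW_zero_left hH hn, optQ_eq_sum ad (h := h) hn, zero_mul,
    zero_add]
  unfold cellCost
  set Un := ∑ i ∈ visits (cell x d h) z k, unsF M p h (T i) (x (i + 1) (h + 1)) with hUn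
  set Ex := ∑ i ∈ visits (cell x d h) z k, excess M p h (T i) (x (i + 1) (h + 1)) with hEx
  set U2 := ∑ i ∈ visits (cell x d h) z k, excess M p h (T i) (x (i + 1) (h + 1)) ^ 2 with hU2
  have hUn0 : 0 ≤ Un := sum_nonneg fun i _ => (unsF_mem M p hβ h _ _).1
  have hEx0 : 0 ≤ Ex := sum_nonneg fun i hi =>
    excess_nonneg ad hh (hb i (mem_visits.mp hi).1) _
  set G := ∑ i ∈ visits (cell x d h) z k, M.nextMean h z.1 z.2 (unsF M p h (T i)) with hG
  have hG0 : 0 ≤ G := sum_nonneg fun i _ =>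
    EpisodicMDP.le_nextMean fun y => (unsF_mem M p hβ h _ _).1
  have hn0 : (0 : ℝ) < cnt (cell x d h) z k := by exact_mod_cast hn
  set n := cnt (cell x d h) z k with hn'
  set J := visits (cell x d h) z k with hJ
  set X := 4 * √(iota M p * (n * (2 * M.maxCondVar + 2 * p.β ^ 2))) + 32 * iota M p * M.H
    + G + Ex with hX
  have hX0 : 0 ≤ X := by positivity
  set N3 := (M.H : ℝ) ^ 2 * iota M p / (n : ℝ) ^ (3 / 4 : ℝ) with hN3
  have key : ∑ j ∈ J, etaW M.H (cnt (cell x d h) z j + 1) n *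
          (M.r h z.1 z.2 + (T j).V (h + 1) (x (j + 1) (h + 1))
            - (T j).VR (h + 1) (x (j + 1) (h + 1)) + (T (j + 1)).μref h z.1 z.2
            + p.cb * ((M.H : ℝ) ^ 2 * iota M p
              / ((cnt (cell x d h) z j + 1 : ℕ) : ℝ) ^ (3 / 4 : ℝ)))
      ≤ ∑ j ∈ J, etaW M.H (cnt (cell x d h) z j + 1) n *
          (M.r h z.1 z.2 + M.nextMean h z.1 z.2 (M.optValue (h + 1)))
        + (∑ j ∈ J, etaW M.H (cnt (cell x d h) z j + 1) n *
          ((T j).V (h + 1) (x (j + 1) (h + 1)) - M.optValue (h + 1) (x (j + 1) (h + 1)))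
        + ∑ j ∈ J, etaW M.H (cnt (cell x d h) z j + 1) n *
          (M.optValue (h + 1) (x (j + 1) (h + 1)) - setF M p h (T j) (x (j + 1) (h + 1))
            - M.nextMean h z.1 z.2 (fun y => M.optValue (h + 1) y - setF M p h (T j) y))
        + X * ∑ j ∈ J, etaW M.H (cnt (cell x d h) z j + 1) n *
          (1 / ((cnt (cell x d h) z j + 1 : ℕ) : ℝ))
        + p.cb * ∑ j ∈ J, etaW M.H (cnt (cell x d h) z j + 1) n *
          ((M.H : ℝ) ^ 2 * iota M p / ((cnt (cell x d h) z j + 1 : ℕ) : ℝ) ^ (3 / 4 : ℝ))) := by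
    rw [mul_sum, mul_sum, ← sum_add_distrib, ← sum_add_distrib, ← sum_add_distrib,
      ← sum_add_distrib]
    refine sum_le_sum fun j hj => ?_
    have hbj := hb j (mem_visits.mp hj).1
    have hw := etaW_nonneg hH (cnt (cell x d h) z j + 1) n
    have hd := hrefu j hj
    have hex := excess_nonneg ad hh hbj (x (j + 1) (h + 1))
    unfold excess at hex
    rw [EpisodicMDP.nextMean_sub]
    have h1 : (T (j + 1)).μref h z.1 z.2 - (T j).VR (h + 1) (x (j + 1) (h + 1))
        ≤ M.nextMean h z.1 z.2 (setF M p h (T j)) - setF M p h (T j) (x (j + 1) (h + 1))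
          + 1 / ((cnt (cell x d h) z j + 1 : ℕ) : ℝ) * X := by linarith
    have := mul_le_mul_of_nonneg_left h1 hw
    linarith
  have hXle : X * (2 * (1 / n)) ≤ 12 * (√((M.maxCondVar + p.β ^ 2 * M.H) * iota M p) / √n)
      + (160 * (M.H * iota M p) + 4 * Un + 2 * Ex) / n :=
    reference_drift_le hQ0 hβH hH hι hn0 huns
  have hsetle := settled_rate_le (H := (M.H : ℝ)) (n := (n : ℝ)) hQ0 hβ (by linarith) hι
  have hbon : bonus M p (T k) h z n
      ≤ p.cb * (5 * (√((M.maxCondVar + p.β ^ 2 * M.H) * iota M p) / √n)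
        + (7 * (M.H * iota M p) + 2 * √(iota M p * U2)) / n) := by
    refine hbonus.trans ?_
    rw [mul_assoc]
    exact mul_le_mul_of_nonneg_left (bonus_rate_le hQ0 hβ hH hι hn0) (by linarith)
  have k1 := mul_le_mul_of_nonneg_left hinv hX0
  have k2 := mul_le_mul_of_nonneg_left hthree (by linarith : 0 ≤ p.cb)
  set C := √((M.maxCondVar + p.β ^ 2 * M.H) * iota M p) / √n with hC
  have hC0 : 0 ≤ C := by positivity
  -- the constants `12` and `38` of the drift and of the settled part add up to `50 ≤ c_b`
  have k3 : 50 * C ≤ p.cb * C := mul_le_mul_of_nonneg_right (by linarith) hC0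
  have k4 : (160 * (M.H * iota M p) + 4 * Un + 2 * Ex) / n
      ≤ p.cb * ((M.H * iota M p + Un + Ex) / n) := by
    rw [← mul_div_assoc]
    refine div_le_div_of_nonneg_right ?_ hn0.le
    have h0 : 0 ≤ (M.H : ℝ) * iota M p := by positivity
    have h1 := mul_le_mul_of_nonneg_right hc (by linarith : 0 ≤ M.H * iota M p + Un + Ex)
    linarith
  have e5 : p.cb * (6 * √((M.maxCondVar + p.β ^ 2 * M.H) * iota M p) / √n
      + 2 * N3 + (8 * M.H * iota M p + Un + Ex + 2 * √(iota M p * U2)) / n)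
      = p.cb * (5 * C + (7 * (M.H * iota M p) + 2 * √(iota M p * U2)) / n) + p.cb * C
        + p.cb * (2 * N3) + p.cb * ((M.H * iota M p + Un + Ex) / n) := by
    rw [hC]; ring
  rw [e5]
  linarith

end upper

/-! ### The total cost of unsettled reference values -/

section costs
variable [Nonempty A] (ad : Admissible M p x d)
include ad

omit [Nonempty A] in
lemma wideWidth_nonneg (h j : ℕ) : 0 ≤ wideWidth M p x d h j := by
  unfold wideWidth
  split_ifs with hc
  · exact ad.hβ.le.trans hc.le
  · exact le_rfl

lemma sum_wideWidth_le {h : ℕ} (hh : h ∈ Icc 1 M.H) :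
    ∑ j ∈ range p.K, wideWidth M p x d (h + 1) j
      ≤ 400 * p.cb ^ 2 * M.H ^ 5 * (Fintype.card S * Fintype.card A) * iota M p / p.β := by
  have hβ := ad.hβ
  have hι := ad.hι
  simp only [mem_Icc] at hh
  rcases Nat.lt_or_ge h M.H with hlt | hge
  · exact ad.sum_width_le (by simp; omega)
  · obtain rfl : h = M.H := by omega
    unfold wideWidth
    simp only [V_last, VLCB_last, sub_self, if_neg hβ.not_gt, sum_const_zero]
    positivity

/-- A state is visited at most once with a width of at most `β` before its reference value is
settled. -/
lemma sum_uns_le {h : ℕ} (hh : h ∈ Icc 1 M.H) :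
    ∑ j ∈ range p.K, unsF M p h (T j) (x (j + 1) (h + 1))
      ≤ p.β * Fintype.card S + ∑ j ∈ range p.K, wideWidth M p x d (h + 1) j := by
  have hβ := ad.hβ
  have hw := wideWidth_nonneg (M := M) (p := p) (x := x) (d := d) ad
  simp only [mem_Icc] at hh
  rcases Nat.lt_or_ge h M.H with hlt | hge
  swap
  · obtain rfl : h = M.H := by omega
    unfold unsF
    simp only [show ¬ (M.H + 1 ≤ M.H) by omega, false_and, if_false, sum_const_zero]
    have := sum_nonneg fun j (_ : j ∈ range p.K) => hw (M.H + 1) j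
    positivity
  have hh' : h + 1 ∈ Icc 1 M.H := by simp; omega
  -- `β` times the number of unsettled states is a potential which pays for the narrow visits
  set Φ : ℕ → Finset S := fun j => univ.filter fun s => (T j).u (h + 1) s = true with hΦ
  have key : ∀ K, ∑ j ∈ range K, unsF M p h (T j) (x (j + 1) (h + 1)) + p.β * (Φ K).card
      ≤ p.β * Fintype.card S + ∑ j ∈ range K, wideWidth M p x d (h + 1) j := by
    intro K
    induction K with
    | zero =>
      simp only [range_zero, sum_empty, zero_add, add_zero]
      exact mul_le_mul_of_nonneg_left (by exact_mod_cast card_le_univ _) hβ.le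
    | succ K ih =>
      rw [sum_range_succ, sum_range_succ]
      set s := x (K + 1) (h + 1) with hs
      have hsub : Φ (K + 1) ⊆ Φ K := by
        intro y hy
        simp only [hΦ, mem_filter, mem_univ, true_and] at hy ⊢
        exact u_succ hh' K y hy
      have hcard : ((Φ (K + 1)).card : ℝ) ≤ (Φ K).card := by exact_mod_cast card_le_card hsub
      have hcard' := mul_le_mul_of_nonneg_left hcard hβ.le
      have hwK := hw (h + 1) K
      have huK : unsF M p h (T K) s = if h + 1 ≤ M.H ∧ (T K).u (h + 1) s = true then p.β else 0 :=
        rfl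
      rw [huK]
      split_ifs with hc
      · by_cases hwide : p.β < (T K).V (h + 1) s - (T K).VLCB (h + 1) s
        · have : p.β ≤ wideWidth M p x d (h + 1) K := by
            unfold wideWidth; rw [if_pos hwide]; exact hwide.le
          linarith
        · have hu : (T (K + 1)).u (h + 1) s = false := by
            rw [u_visit hh' hs.symm, if_neg]
            have h1 := V_succ_le (p := p) (x := x) (d := d) hh' K s
            have h2 := VLCB_le_succ (p := p) (x := x) (d := d) hh' K s
            intro hgt; apply hwide; linarith
          have hlt : (Φ (K + 1)).card + 1 ≤ (Φ K).card := by
            refine card_lt_card ⟨hsub, fun hle => ?_⟩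
            have : s ∈ Φ (K + 1) := hle (by simp [hΦ, hc.2])
            simp [hΦ, hu] at this
          have hlt' : ((Φ (K + 1)).card : ℝ) + 1 ≤ (Φ K).card := by exact_mod_cast hlt
          have := mul_le_mul_of_nonneg_left hlt' hβ.le
          linarith
      · linarith
  have := key p.K
  have h0 : 0 ≤ p.β * ((Φ p.K).card : ℝ) := by positivity
  linarith

lemma cellCost_mono {h : ℕ} (hh : h ∈ Icc 1 M.H) (hb : ∀ j < p.K, Bracket M p x d j) (z : S × A)
    {k : ℕ} (hk : k ≤ p.K) : cellCost M p x d h z k ≤ cellCost M p x d h z p.K := by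
  have hι : 0 ≤ iota M p := by linarith [ad.hι]
  have hsub : visits (cell x d h) z k ⊆ visits (cell x d h) z p.K := visits_mono hk
  unfold cellCost
  gcongr ?_ + ?_ + ?_ + 2 * √(iota M p * ?_)
  · exact le_rfl
  · exact sum_le_sum_of_subset_of_nonneg hsub fun i _ _ => (unsF_mem M p ad.hβ.le h _ _).1
  · exact sum_le_sum_of_subset_of_nonneg hsub fun i hi _ =>
      excess_nonneg ad hh (hb i (mem_visits.mp hi).1) _
  · exact sum_le_sum_of_subset_of_nonneg hsub fun i _ _ => sq_nonneg _

lemma cellCost_nonneg {h : ℕ} (hh : h ∈ Icc 1 M.H) (hb : ∀ j < p.K, Bracket M p x d j) (z : S × A)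
    {k : ℕ} (hk : k ≤ p.K) : 0 ≤ cellCost M p x d h z k := by
  have hι : 0 ≤ iota M p := by linarith [ad.hι]
  have h1 : 0 ≤ ∑ i ∈ visits (cell x d h) z k, unsF M p h (T i) (x (i + 1) (h + 1)) :=
    sum_nonneg fun i _ => (unsF_mem M p ad.hβ.le h _ _).1
  have h2 : 0 ≤ ∑ i ∈ visits (cell x d h) z k, excess M p h (T i) (x (i + 1) (h + 1)) :=
    sum_nonneg fun i hi =>
      excess_nonneg ad hh (hb i (by have := (mem_visits.mp hi).1; omega)) _
  unfold cellCost
  positivity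

lemma sum_cellCost_le {h : ℕ} (hh : h ∈ Icc 1 M.H) (hb : ∀ j < p.K, Bracket M p x d j) :
    ∑ z, cellCost M p x d h z p.K
      ≤ 1211 * p.cb ^ 2 * M.H ^ 5 * (Fintype.card S * Fintype.card A) * iota M p / p.β := by
  have hι := ad.hι
  have hβ := ad.hβ
  have hH := ad.one_le_H
  have hwide := sum_wideWidth_le ad hh
  have huns := sum_uns_le ad hh
  have hex : ∑ j ∈ range p.K, excess M p h (T j) (x (j + 1) (h + 1))
      ≤ ∑ j ∈ range p.K, wideWidth M p x d (h + 1) j :=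
    sum_le_sum fun j hj => excess_le_wideWidth ad hh (hb j (by simpa using hj))
  have hcell : ∀ z, cellCost M p x d h z p.K ≤ 9 * (M.H * iota M p)
      + ∑ i ∈ visits (cell x d h) z p.K, unsF M p h (T i) (x (i + 1) (h + 1))
      + 2 * ∑ i ∈ visits (cell x d h) z p.K, excess M p h (T i) (x (i + 1) (h + 1)) := by
    intro z
    unfold cellCost
    set X := ∑ i ∈ visits (cell x d h) z p.K, excess M p h (T i) (x (i + 1) (h + 1)) with hX
    have hX0 : 0 ≤ X := sum_nonneg fun i hi => excess_nonneg ad hh (hb i (mem_visits.mp hi).1) _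
    have h1 : ∑ i ∈ visits (cell x d h) z p.K, excess M p h (T i) (x (i + 1) (h + 1)) ^ 2
        ≤ M.H * X := by
      rw [hX, mul_sum]
      refine sum_le_sum fun i hi => ?_
      have hbi := hb i (mem_visits.mp hi).1
      rw [sq]
      exact mul_le_mul_of_nonneg_right (excess_le_H ad hh hbi _) (excess_nonneg ad hh hbi _)
    have h2 : √(iota M p * ∑ i ∈ visits (cell x d h) z p.K,
        excess M p h (T i) (x (i + 1) (h + 1)) ^ 2) ≤ (M.H * iota M p + X) / 2 := by
      apply Real.sqrt_le_iff.mpr ⟨by positivity, ?_⟩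
      calc _ ≤ iota M p * (M.H * X) := mul_le_mul_of_nonneg_left h1 (by linarith)
        _ ≤ _ := by linarith [sq_nonneg ((M.H * iota M p - X) / 2)]
    linarith
  have hsum : ∑ z, cellCost M p x d h z p.K ≤ (Fintype.card S * Fintype.card A)
        * (9 * (M.H * iota M p))
      + ∑ j ∈ range p.K, unsF M p h (T j) (x (j + 1) (h + 1))
      + 2 * ∑ j ∈ range p.K, excess M p h (T j) (x (j + 1) (h + 1)) := by
    refine (sum_le_sum fun z _ => hcell z).trans_eq ?_
    rw [sum_cells_visits (c := cell x d h), sum_cells_visits (c := cell x d h), mul_sum univ,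
      sum_add_distrib, sum_add_distrib, sum_const, card_univ, Fintype.card_prod, nsmul_eq_mul,
      Nat.cast_mul]
  set N : ℝ := (Fintype.card S * Fintype.card A : ℝ) with hN
  have hN0 : 0 ≤ N := by positivity
  have hS : (Fintype.card S : ℝ) ≤ N :=
    le_mul_of_one_le_right (by positivity) (by exact_mod_cast Fintype.card_pos)
  set Y := p.cb ^ 2 * M.H ^ 5 * N * iota M p / p.β with hY
  have hHβ : 1 ≤ (M.H : ℝ) / p.β := by rw [le_div_iff₀ hβ]; linarith [ad.hβH]
  have hc2 : 1 ≤ p.cb ^ 2 := one_le_pow₀ ad.hcb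
  have h1 : N * (M.H * iota M p) ≤ Y := by
    have hH3 : (M.H : ℝ) ^ 1 ≤ (M.H : ℝ) ^ 4 := pow_le_pow_right₀ hH (by norm_num)
    calc N * (M.H * iota M p) = 1 * (N * (M.H ^ 1 * iota M p)) * 1 := by ring
      _ ≤ p.cb ^ 2 * (N * (M.H ^ 4 * iota M p)) * (M.H / p.β) := by gcongr
      _ = Y := by rw [hY]; ring
  have h2 : p.β * Fintype.card S ≤ 2 * (N * (M.H * iota M p)) := by
    calc p.β * Fintype.card S ≤ M.H * N := mul_le_mul ad.hβH hS (by positivity) (by positivity)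
      _ = 2 * (N * (M.H * (1 / 2))) := by ring
      _ ≤ _ := by gcongr
  have h3 : 400 * p.cb ^ 2 * M.H ^ 5 * N * iota M p / p.β = 400 * Y := by rw [hY]; ring
  have h4 : 1211 * p.cb ^ 2 * M.H ^ 5 * N * iota M p / p.β = 1211 * Y := by rw [hY]; ring
  rw [h3] at hwide
  rw [h4]
  linarith

end costs

/-! ### The sum of the gaps along a good trajectory -/

section clipped

/-- Clipping of `D / n^{3/4}` at the level `C / √n`, with `n^{1/4}` written as `√√n`. -/
noncomputable def clipRpow (D C : ℝ) (n : ℕ) : ℝ :=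
  if √√(n : ℝ) < D / C then D * (1 / √√(n : ℝ) ^ 3) else 0

lemma clipRpow_nonneg {D C : ℝ} (hD : 0 ≤ D) (n : ℕ) : 0 ≤ clipRpow D C n := by
  unfold clipRpow; split_ifs <;> positivity

lemma le_add_clipRpow {D C : ℝ} (hC : 0 < C) {n : ℕ} (hn : 1 ≤ n) :
    D / (n : ℝ) ^ (3 / 4 : ℝ) ≤ C / √(n : ℝ) + clipRpow D C n := by
  have hn0 : (0 : ℝ) < n := by exact_mod_cast hn
  rw [rpow_three_quarters _ hn0.le]
  unfold clipRpow
  have hm : 0 < √√(n : ℝ) := by positivity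
  have hm2 : √(n : ℝ) = √√(n : ℝ) ^ 2 := (Real.sq_sqrt (Real.sqrt_nonneg _)).symm
  have hC2 : C / √(n : ℝ) = C / √√(n : ℝ) ^ 2 := by rw [← hm2]
  rw [hC2]
  generalize √√(n : ℝ) = m at *
  split_ifs with h
  · rw [mul_one_div]
    have : 0 ≤ C / m ^ 2 := by positivity
    linarith
  · rw [not_lt, div_le_iff₀ hC] at h
    rw [add_zero, div_le_div_iff₀ (by positivity) (by positivity)]
    calc D * m ^ 2 ≤ m * C * m ^ 2 := by gcongr
      _ = _ := by ring

lemma sum_clipRpow_le {D C : ℝ} (hD : 0 ≤ D) (hC : 0 < C) (n : ℕ) :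
    ∑ i ∈ range n, clipRpow D C (i + 1) ≤ 4 * D ^ 2 / C := by
  calc ∑ i ∈ range n, clipRpow D C (i + 1)
      = D * ∑ i ∈ range n, (if √√((i + 1 : ℕ) : ℝ) < D / C
          then 1 / √√((i + 1 : ℕ) : ℝ) ^ 3 else 0) := by
        unfold clipRpow; rw [mul_sum]; simp only [mul_ite, mul_zero]
    _ ≤ D * (4 * (D / C)) :=
        mul_le_mul_of_nonneg_left (sum_clipped_inv_rpow_le (by positivity) n) hD
    _ = _ := by ring

end clipped

section gaps
variable [Nonempty A] (ad : Admissible M p x d) (hc : 400 ≤ p.cb) (hlog : Real.log p.K ≤ iota M p)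
  (hg : ∀ h ∈ Icc 1 M.H, ∀ z, GoodAt M p x d h z)
include ad hc hg

/-- The error `Q_h - Q_h^⋆` at the cell visited in episode `j + 1`, in terms of the errors at step
`h + 1` of the earlier visits.  The first summand of the inhomogeneous part is summable over the
visits only after clipping at a level proportional to the minimum gap. -/
lemma error_le {ε : ℝ} (hε : 0 < ε) {h : ℕ} (hh : h ∈ Icc 1 M.H) {j : ℕ} (hj : j < p.K) :
    (T j).Q h (cell x d h j).1 (cell x d h j).2 - M.optQ h (cell x d h j).1 (cell x d h j).2
      ≤ ∑ i ∈ visits (cell x d h) (cell x d h j) j,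
          etaW M.H (cnt (cell x d h) (cell x d h j) i + 1) (cnt (cell x d h) (cell x d h j) j) *
            ((T i).V (h + 1) (x (i + 1) (h + 1)) - M.optValue (h + 1) (x (i + 1) (h + 1)))
        + (ε + ((if cnt (cell x d h) (cell x d h j) j = 0 then (M.H : ℝ) else
            clipSqrt (8 * p.cb * √((M.maxCondVar + p.β ^ 2 * M.H) * iota M p)) ε
                (cnt (cell x d h) (cell x d h j) j)
            + 2 * p.cb * clipRpow ((M.H : ℝ) ^ 2 * iota M p) (√(p.β ^ 2 * M.H * iota M p))
                (cnt (cell x d h) (cell x d h j) j))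
          + p.cb * (cellCost M p x d h (cell x d h j) p.K
              * (1 / (cnt (cell x d h) (cell x d h j) j : ℝ))))) := by
  have hι := ad.hι
  have hβ := ad.hβ
  have hH := ad.one_le_H
  have hh' := hh
  simp only [mem_Icc] at hh'
  have hbr := fun k (hk : k ≤ p.K) => (bracket ad hc hg k hk)
  set z := cell x d h j with hz
  have hQ0 : 0 ≤ M.maxCondVar :=
    EpisodicMDP.nextVar_nonneg.trans (EpisodicMDP.nextVar_le_maxCondVar M hh'.1 hh'.2 z.1 z.2)
  rcases Nat.eq_zero_or_pos (cnt (cell x d h) z j) with h0 | hn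
  · have hempty : visits (cell x d h) z j = ∅ := card_eq_zero.mp h0
    rw [h0, hempty]
    simp only [sum_empty, if_true, Nat.cast_zero, div_zero, mul_zero, add_zero, zero_add]
    have h1 : (T j).Q h z.1 z.2 ≤ M.H :=
      (ad.V_eq_Q hj hh).symm.le.trans (V_le hh j _)
    have h2 := EpisodicMDP.optQ_nonneg M hh'.1 hh'.2 z.1 z.2
    linarith
  · have h1 := QR_le ad hh (hg h hh z) hj.le hn (fun i hi => (hbr i (by omega)).1) hc
    have h2 := (Q_le_QUCB_QR (p := p) (x := x) (d := d) hh j z.1 z.2).2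
    have hmono := cellCost_mono ad hh (fun i hi => (hbr i hi.le).1) z hj.le
    rw [if_neg (by omega)]
    set n := cnt (cell x d h) z j with hn'
    have hn0 : (0 : ℝ) < n := by exact_mod_cast hn
    set C := √((M.maxCondVar + p.β ^ 2 * M.H) * iota M p) with hC
    set C' := √(p.β ^ 2 * M.H * iota M p) with hC'
    have hC'0 : 0 < C' := Real.sqrt_pos.mpr (by positivity)
    have hCC : C' ≤ C := by
      apply Real.sqrt_le_sqrt
      have := mul_nonneg hQ0 (by linarith : 0 ≤ iota M p)
      linarith
    have k1 := le_add_clipSqrt (C := 8 * p.cb * C) hε hn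
    have k2 := le_add_clipRpow (D := (M.H : ℝ) ^ 2 * iota M p) hC'0 hn
    have k3 : cellCost M p x d h z j / n ≤ cellCost M p x d h z p.K * (1 / n) := by
      rw [mul_one_div]; gcongr
    have hcb0 : 0 ≤ p.cb := by linarith
    have k4 : C' / √(n : ℝ) ≤ C / √(n : ℝ) := by gcongr
    have k5 : 6 * C / √(n : ℝ) + 2 * ((M.H : ℝ) ^ 2 * iota M p / (n : ℝ) ^ (3 / 4 : ℝ))
        + cellCost M p x d h z j / n
        ≤ 8 * (C / √(n : ℝ)) + 2 * clipRpow ((M.H : ℝ) ^ 2 * iota M p) C' n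
          + cellCost M p x d h z p.K * (1 / n) := by
      rw [mul_div_assoc]; linarith
    have k6 := mul_le_mul_of_nonneg_left k5 hcb0
    have k7 : p.cb * (8 * (C / √(n : ℝ))) = 8 * p.cb * C / √(n : ℝ) := by ring
    rw [mul_add p.cb (8 * _ + _), mul_add p.cb (8 * _), k7] at k6
    linarith

include hlog

lemma sum_cost_div_le {h : ℕ} (hh : h ∈ Icc 1 M.H) :
    ∑ j ∈ range p.K, cellCost M p x d h (cell x d h j) p.K
        * (1 / (cnt (cell x d h) (cell x d h j) j : ℝ))
      ≤ 3633 * p.cb ^ 2 * M.H ^ 5 * (Fintype.card S * Fintype.card A) * iota M p ^ 2 / p.β := by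
  have hι := ad.hι
  have hbr := fun k (hk : k < p.K) => (bracket ad hc hg k hk.le).1
  have hsum := sum_cellCost_le ad hh hbr
  calc _ = ∑ z, ∑ j ∈ visits (cell x d h) z p.K, cellCost M p x d h z p.K
        * (1 / (cnt (cell x d h) z j : ℝ)) := by
        rw [sum_cells_visits (c := cell x d h)]
        refine sum_congr rfl fun z _ => sum_congr rfl fun j hj => ?_
        rw [(mem_visits.mp hj).2]
    _ = ∑ z, cellCost M p x d h z p.K * ∑ i ∈ range (cnt (cell x d h) z p.K), 1 / (i : ℝ) := by
        refine sum_congr rfl fun z _ => ?_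
        rw [← mul_sum, sum_visits_cnt (fun i => 1 / (i : ℝ))]
    _ ≤ ∑ z, cellCost M p x d h z p.K * (3 * iota M p) := by
        refine sum_le_sum fun z _ => mul_le_mul_of_nonneg_left ?_
          (cellCost_nonneg ad hh hbr z le_rfl)
        have h1 := sum_range_le_zero_add (φ := fun i => 1 / (i : ℝ)) (fun i => by positivity)
          (cnt (cell x d h) z p.K)
        have h2 := sum_inv_le_log (cnt_le (c := cell x d h) (z := z) p.K)
        -- the term of the first visit is `1 / 0 = 0`
        simp only [Nat.cast_zero, div_zero, zero_add] at h1
        linarith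
    _ = (∑ z, cellCost M p x d h z p.K) * (3 * iota M p) := by rw [sum_mul]
    _ ≤ _ * (3 * iota M p) := mul_le_mul_of_nonneg_right hsum (by positivity)
    _ = _ := by ring

/-- On the good event the sum of the gaps along the trajectory obeys the regret bound. -/
theorem sum_gap_le (hM : M.positiveGaps.Nonempty) :
    ∑ h ∈ Icc 1 M.H, ∑ j ∈ range p.K, M.gap h (cell x d h j).1 (cell x d h j).2
      ≤ 6 * M.H ^ 2 * ((Fintype.card S * Fintype.card A)
        * (256 * p.cb ^ 2 * (M.maxCondVar + p.β ^ 2 * M.H) * M.H * iota M p / M.minGap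
          + 4000 * p.cb ^ 3 * M.H ^ 5 * iota M p ^ 2 / p.β)) := by
  have hι := ad.hι
  have hβ := ad.hβ
  have hH := ad.one_le_H
  have hcb := ad.hcb
  have hΔ := EpisodicMDP.minGap_pos M hM
  have hbr := fun k (hk : k ≤ p.K) => bracket ad hc hg k hk
  have hQ0 : 0 ≤ M.maxCondVar := by
    obtain ⟨_, _, h, hh, s, a, _⟩ := hM
    simp only [mem_Icc] at hh
    exact EpisodicMDP.nextVar_nonneg.trans (EpisodicMDP.nextVar_le_maxCondVar M hh.1 hh.2 s a)
  set N : ℝ := (Fintype.card S * Fintype.card A : ℝ) with hN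
  have hN0 : 0 ≤ N := by positivity
  -- `H` contributions `ε` to an error `≥ Δ_min` amount to at most half of it
  set ε : ℝ := M.minGap / (2 * M.H) with hε
  have hε0 : 0 < ε := by positivity
  set C := 8 * p.cb * √((M.maxCondVar + p.β ^ 2 * M.H) * iota M p) with hC
  have hC0 : 0 ≤ C := by positivity
  have hC2 : 2 * C ^ 2 / ε
      = 256 * p.cb ^ 2 * (M.maxCondVar + p.β ^ 2 * M.H) * M.H * iota M p / M.minGap := by
    rw [hC, mul_pow, Real.sq_sqrt (by positivity), hε]; field_simp; ring
  set D := (M.H : ℝ) ^ 2 * iota M p with hD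
  have hD0 : 0 ≤ D := by positivity
  set C' := √(p.β ^ 2 * M.H * iota M p) with hC'
  have hC'0 : 0 < C' := Real.sqrt_pos.mpr (by positivity)
  have hC'le : p.β / 2 ≤ C' := by
    apply Real.le_sqrt_of_sq_le
    calc (p.β / 2) ^ 2 ≤ p.β ^ 2 * 1 * (1 / 2) := by linarith [sq_nonneg p.β]
      _ ≤ _ := by gcongr
  set Y := (M.H : ℝ) ^ 5 * iota M p ^ 2 / p.β with hY
  have hY0 : 0 ≤ Y := by positivity
  have hDC : 4 * D ^ 2 / C' ≤ 8 * Y := by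
    calc 4 * D ^ 2 / C' ≤ 4 * D ^ 2 / (p.β / 2) := by gcongr
      _ = 8 * (M.H ^ 4 * iota M p ^ 2 / p.β) := by rw [hD]; field_simp; ring
      _ ≤ 8 * Y := by rw [hY]; gcongr; norm_num
  have hHY : (M.H : ℝ) ≤ 4 * Y := by
    have hHβ : 1 ≤ (M.H : ℝ) / p.β := by rw [le_div_iff₀ hβ]; linarith [ad.hβH]
    have hi2 : 1 ≤ 4 * iota M p ^ 2 := by nlinarith
    have hH3 : (M.H : ℝ) ^ 1 ≤ (M.H : ℝ) ^ 4 := pow_le_pow_right₀ hH (by norm_num)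
    calc (M.H : ℝ) = M.H ^ 1 * 1 * 1 := by ring
      _ ≤ M.H ^ 4 * (4 * iota M p ^ 2) * (M.H / p.β) := by gcongr
      _ = _ := by rw [hY]; ring
  set φ : ℕ → ℝ := fun n => if n = 0 then (M.H : ℝ) else
    clipSqrt C ε n + 2 * p.cb * clipRpow D C' n with hφ
  have hφ0 : ∀ n, 0 ≤ φ n := by
    intro n; simp only [hφ]; split_ifs
    · linarith
    · have h1 := clipSqrt_nonneg (ε := ε) hC0 n
      have h2 := clipRpow_nonneg (C := C') hD0 n
      positivity
  have hφsum : ∀ n ≤ p.K, ∑ i ∈ range n, φ i ≤ 2 * C ^ 2 / ε + 20 * p.cb * Y := by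
    intro n _
    refine (sum_range_le_zero_add hφ0 n).trans ?_
    have e1 : ∑ i ∈ range n, φ (i + 1) = ∑ i ∈ range n, clipSqrt C ε (i + 1)
        + 2 * p.cb * ∑ i ∈ range n, clipRpow D C' (i + 1) := by
      rw [mul_sum, ← sum_add_distrib]
      exact sum_congr rfl fun i _ => by simp [hφ]
    rw [e1]
    have h0 : φ 0 = M.H := by simp [hφ]
    have h1 := sum_clipSqrt_le hC0 hε0 n
    have h2 := mul_le_mul_of_nonneg_left ((sum_clipRpow_le hD0 hC'0 n).trans hDC)
      (by linarith : 0 ≤ 2 * p.cb)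
    have h3 : Y ≤ p.cb * Y := le_mul_of_one_le_left hY0 hcb
    linarith
  set R : ℝ := N * (2 * C ^ 2 / ε + 4000 * p.cb ^ 3 * Y) with hR
  have hR0 : 0 ≤ R := by positivity
  set ρ : ℕ → ℕ → ℝ := fun h j => if h ∈ Icc 1 M.H then φ (cnt (cell x d h) (cell x d h j) j)
      + p.cb * (cellCost M p x d h (cell x d h j) p.K
        * (1 / (cnt (cell x d h) (cell x d h j) j : ℝ))) else 0 with hρ
  have hρ0 : ∀ h j, 0 ≤ ρ h j := by
    intro h j
    simp only [hρ]
    split_ifs with hh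
    · have h1 := cellCost_nonneg ad hh (fun j hj => (hbr j hj.le).1) (cell x d h j) le_rfl
      have h2 := hφ0 (cnt (cell x d h) (cell x d h j) j)
      positivity
    · exact le_rfl
  have hρR : ∀ h ∈ Icc 1 M.H, ∑ j ∈ range p.K, ρ h j ≤ R := by
    intro h hh
    simp only [hρ, if_pos hh]
    rw [sum_add_distrib, ← mul_sum]
    have h1 := sum_cnt_le (cell x d h) φ p.K _ hφsum
    rw [Fintype.card_prod, Nat.cast_mul, ← hN] at h1
    have h2 := mul_le_mul_of_nonneg_left (sum_cost_div_le ad hc hlog hg hh)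
      (by linarith : 0 ≤ p.cb)
    have e2 : p.cb * (3633 * p.cb ^ 2 * M.H ^ 5 * N * iota M p ^ 2 / p.β)
        = 3633 * (p.cb ^ 3 * (N * Y)) := by rw [hY]; ring
    rw [e2] at h2
    have h3 : p.cb * (N * Y) ≤ p.cb ^ 3 * (N * Y) := by
      refine mul_le_mul_of_nonneg_right ?_ (by positivity)
      calc p.cb = p.cb ^ 1 := (pow_one _).symm
        _ ≤ _ := pow_le_pow_right₀ hcb (by norm_num)
    have h4 : 0 ≤ p.cb ^ 3 * (N * Y) := by positivity
    have e3 : R = N * (2 * C ^ 2 / ε) + 4000 * (p.cb ^ 3 * (N * Y)) := by rw [hR]; ring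
    rw [e3]
    linarith
  set E : ℕ → ℕ → ℝ := fun h j => if h ≤ M.H then (T j).Q h (cell x d h j).1 (cell x d h j).2
    - M.optQ h (cell x d h j).1 (cell x d h j).2 else 0 with hE
  have hVE : ∀ h ∈ Icc 1 M.H, ∀ i < p.K,
      (T i).V (h + 1) (x (i + 1) (h + 1)) - M.optValue (h + 1) (x (i + 1) (h + 1))
        ≤ E (h + 1) i := by
    intro h hh i hi
    simp only [mem_Icc] at hh
    simp only [hE]
    split_ifs with hlt
    · rw [ad.V_eq_Q hi (by simp; omega : h + 1 ∈ Icc 1 M.H)]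
      have := EpisodicMDP.optQ_le_optValue M (by omega) hlt (cell x d (h + 1) i).1
        (cell x d (h + 1) i).2
      have e : (cell x d (h + 1) i).1 = x (i + 1) (h + 1) := rfl
      rw [e] at this ⊢
      linarith
    · obtain rfl : h = M.H := by omega
      rw [V_last, EpisodicMDP.optValue_of_lt M (by omega), sub_zero]
  have hstep : ∀ h ∈ Icc 1 M.H, ∀ j < p.K, E h j ≤ ∑ i ∈ visits (cell x d h) (cell x d h j) j,
      etaW M.H (cnt (cell x d h) (cell x d h j) i + 1) (cnt (cell x d h) (cell x d h j) j)
        * E (h + 1) i + (ε + ρ h j) := by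
    intro h hh j hj
    have h1 := error_le ad hc hg hε0 hh hj
    have e1 : E h j = (T j).Q h (cell x d h j).1 (cell x d h j).2
        - M.optQ h (cell x d h j).1 (cell x d h j).2 := if_pos (mem_Icc.mp hh).2
    rw [e1]
    refine h1.trans (add_le_add (sum_le_sum fun i hi => ?_) ?_)
    · exact mul_le_mul_of_nonneg_left
        (hVE h hh i (by have := (mem_visits.mp hi).1; omega)) (etaW_nonneg hH _ _)
    · simp only [hρ, if_pos hh, hφ]
      exact le_rfl
  have hmain : ∀ h ∈ Icc 1 M.H, ∑ j ∈ range p.K, M.gap h (cell x d h j).1 (cell x d h j).2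
      ≤ 6 * M.H * R := by
    intro h hh
    have hh' := hh
    simp only [mem_Icc] at hh'
    have hw := weighted_error_le (n := M.H) (K := p.K) ad.hH hε0.le (cell x d) E ρ hρ0 hR0 hρR
      (fun j _ => by simp [hE]) hstep hh (fun j => if M.minGap ≤ E h j then 1 else 0)
      (fun j => by split_ifs <;> norm_num) (fun j => by split_ifs <;> norm_num)
    set W := ∑ j ∈ range p.K, (if M.minGap ≤ E h j then (1 : ℝ) else 0) with hW
    have hleft : ∑ j ∈ range p.K, (if M.minGap ≤ E h j then (1 : ℝ) else 0) * E h j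
        = ∑ j ∈ range p.K, (if M.minGap ≤ E h j then E h j else 0) :=
      sum_congr rfl fun j _ => by split_ifs <;> simp
    rw [hleft] at hw
    have hWle : M.minGap * W ≤ ∑ j ∈ range p.K, (if M.minGap ≤ E h j then E h j else 0) := by
      rw [hW, mul_sum]
      refine sum_le_sum fun j _ => ?_
      split_ifs with h <;> simp; exact h
    -- the contribution of `ε` is absorbed into the left-hand side
    have hεW : (M.H : ℝ) * ε * W = M.minGap * W / 2 := by rw [hε]; field_simp
    have hgap : ∑ j ∈ range p.K, M.gap h (cell x d h j).1 (cell x d h j).2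
        ≤ ∑ j ∈ range p.K, (if M.minGap ≤ E h j then E h j else 0) := by
      refine sum_le_sum fun j hj => ?_
      have hj' : j < p.K := by simpa using hj
      have hEge : M.gap h (cell x d h j).1 (cell x d h j).2 ≤ E h j := by
        have h1 := ((hbr j hj'.le).1 h (by simp; omega) (cell x d h j).1).1
        have h2 := ad.V_eq_Q hj' hh
        have e : (cell x d h j).1 = x (j + 1) h := rfl
        simp only [hE, if_pos hh'.2]
        unfold EpisodicMDP.gap
        rw [← e] at h2
        linarith
      rcases (EpisodicMDP.gap_nonneg M hh'.1 hh'.2 (cell x d h j).1 (cell x d h j).2).eq_or_lt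
        with h0 | hpos
      · -- a zero gap costs nothing, whether or not the error is large
        rw [← h0] at hEge ⊢
        split_ifs
        · exact hEge
        · exact le_rfl
      · rw [if_pos ((EpisodicMDP.minGap_le M hh'.1 hh'.2 _ _ hpos).trans hEge)]
        exact hEge
    linarith
  calc _ ≤ ∑ _h ∈ Icc 1 M.H, 6 * (M.H : ℝ) * R := sum_le_sum hmain
    _ = 6 * M.H ^ 2 * R := by rw [sum_const, Nat.card_Icc, nsmul_eq_mul]; simp; ring
    _ = _ := by rw [hR, hC2, hY]; ring

end gaps

end QESA

namespace QESA
open scoped Classical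

/-! ### Random variables with finitely many values -/

/-- `f` takes finitely many values, each of them on an `m`-measurable set.  No σ-algebra on the
codomain is needed, so that this applies to the tables of the algorithm. -/
def FinMeas {Ω α : Type*} (m : MeasurableSpace Ω) (f : Ω → α) : Prop :=
  (Set.range f).Finite ∧ ∀ a, MeasurableSet[m] (f ⁻¹' {a})

namespace FinMeas
variable {Ω α γ : Type*} {m m' : MeasurableSpace Ω} {f : Ω → α} {g : Ω → γ}

lemma const (a : α) : FinMeas m (fun _ => a) := by
  refine ⟨(Set.finite_singleton a).subset (by rintro _ ⟨_, rfl⟩; rfl), fun b => ?_⟩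
  by_cases h : a = b
  · simp [h]
  · have : (fun _ : Ω => a) ⁻¹' {b} = ∅ := by ext; simp [h]
    rw [this]; exact @MeasurableSet.empty _ m

lemma mono (hf : FinMeas m f) (h : m ≤ m') : FinMeas m' f := ⟨hf.1, fun a => h _ (hf.2 a)⟩

lemma preimage (hf : FinMeas m f) (s : Set α) : MeasurableSet[m] (f ⁻¹' s) := by
  have : f ⁻¹' s = ⋃ a ∈ Set.range f ∩ s, f ⁻¹' {a} := by
    ext ω; simp
  rw [this]
  exact (hf.1.subset Set.inter_subset_left).measurableSet_biUnion fun a _ => hf.2 a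

lemma comp (hf : FinMeas m f) (φ : α → γ) : FinMeas m (fun ω => φ (f ω)) := by
  refine ⟨(hf.1.image φ).subset ?_, fun c => hf.preimage (φ ⁻¹' {c})⟩
  rintro _ ⟨ω, rfl⟩; exact ⟨f ω, ⟨ω, rfl⟩, rfl⟩

lemma prodMk (hf : FinMeas m f) (hg : FinMeas m g) : FinMeas m (fun ω => (f ω, g ω)) := by
  refine ⟨(hf.1.prod hg.1).subset ?_, fun c => ?_⟩
  · rintro _ ⟨ω, rfl⟩; exact ⟨⟨ω, rfl⟩, ⟨ω, rfl⟩⟩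
  · have : (fun ω => (f ω, g ω)) ⁻¹' {c} = f ⁻¹' {c.1} ∩ g ⁻¹' {c.2} := by
      ext ω; simp [Prod.ext_iff]
    rw [this]; exact (hf.2 _).inter (hg.2 _)

lemma pi {κ : Type*} [Finite κ] {f : κ → Ω → α} (hf : ∀ i, FinMeas m (f i)) :
    FinMeas m (fun ω i => f i ω) := by
  refine ⟨(Set.Finite.pi' fun i => (hf i).1).subset ?_, fun c => ?_⟩
  · rintro _ ⟨ω, rfl⟩ i; exact ⟨ω, rfl⟩
  · have : (fun ω i => f i ω) ⁻¹' {c} = ⋂ i, f i ⁻¹' {c i} := by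
      ext ω; simp [funext_iff]
    rw [this]; exact MeasurableSet.iInter fun i => (hf i).2 _

lemma of_finite [Finite α] (hf : ∀ a, MeasurableSet[m] {ω | f ω = a}) : FinMeas m f :=
  ⟨Set.toFinite _, hf⟩

/-- A random variable chosen among finitely many by another one. -/
lemma apply {κ : Type*} [Finite κ] {i : Ω → κ} (hi : FinMeas m i) {f : κ → Ω → α}
    (hf : ∀ j, FinMeas m (f j)) : FinMeas m (fun ω => f (i ω) ω) :=
  ((pi hf).prodMk hi).comp (fun q => q.1 q.2)

lemma stronglyMeasurable {f : Ω → ℝ} (hf : FinMeas m f) : StronglyMeasurable[m] f := by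
  have : Measurable[m] f := fun s _ => hf.preimage s
  exact this.stronglyMeasurable

lemma sum {κ : Type*} {J : Finset κ} {f : κ → Ω → ℝ} (hf : ∀ j ∈ J, FinMeas m (f j)) :
    FinMeas m (fun ω => ∑ j ∈ J, f j ω) := by
  induction J using Finset.induction_on with
  | empty => simpa using const 0
  | insert a J ha ih =>
    simp only [sum_insert ha]
    exact ((hf a (mem_insert_self _ _)).prodMk
      (ih fun j hj => hf j (mem_insert_of_mem hj))).comp (fun q : ℝ × ℝ => q.1 + q.2)

lemma integrable {mΩ : MeasurableSpace Ω} {μ : Measure Ω} [IsFiniteMeasure μ] {f : Ω → ℝ}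
    (hf : FinMeas mΩ f) : Integrable f μ := by
  obtain ⟨C, hC⟩ := (hf.1.image norm).bddAbove
  exact Integrable.of_bound hf.stronglyMeasurable.aestronglyMeasurable C
    (Filter.Eventually.of_forall fun ω => hC ⟨f ω, ⟨ω, rfl⟩, rfl⟩)

end FinMeas

/-! ### The run as an adapted process -/

section run
variable {S A : Type*} [Fintype S] [Fintype A] {M : EpisodicMDP S A} {p : QESAParams}
  {Ω : Type*} [mΩ : MeasurableSpace Ω] {μ : Measure Ω} [IsProbabilityMeasure μ]
  {ℱ : Filtration ℕ mΩ} {X : ℕ → ℕ → Ω → S} {π : ℕ → Ω → ℕ → S → A}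
  (hrun : IsRun M p μ ℱ X π)
include hrun

omit [IsProbabilityMeasure μ]

lemma IsRun.finMeas_state {k : ℕ} (hk : k ∈ Icc 1 p.K) {h : ℕ} (hh : h ∈ Icc 1 (M.H + 1)) {m : ℕ}
    (hm : k * M.H + h ≤ m) : FinMeas (ℱ m) (X k h) :=
  (FinMeas.of_finite (hrun.state_meas k hk h hh)).mono (ℱ.mono hm)

lemma IsRun.finMeas_policy {k : ℕ} (hk : k ∈ Icc 1 p.K) {h : ℕ} (hh : h ∈ Icc 1 M.H) {m : ℕ}
    (hm : k * M.H + 1 ≤ m) (s : S) : FinMeas (ℱ m) (fun ω => π k ω h s) :=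
  (FinMeas.of_finite (hrun.policy_meas k hk h hh s)).mono (ℱ.mono hm)

lemma IsRun.finMeas_action {k : ℕ} (hk : k ∈ Icc 1 p.K) {h : ℕ} (hh : h ∈ Icc 1 M.H) {m : ℕ}
    (hm : k * M.H + h ≤ m) : FinMeas (ℱ m) (fun ω => π k ω h (X k h ω)) := by
  have hh' := mem_Icc.mp hh
  exact (hrun.finMeas_state hk (by simp; omega) hm).apply
    (hrun.finMeas_policy hk hh (by omega))

lemma IsRun.finMeas_tables {k : ℕ} (hk : k ≤ p.K) {m : ℕ} (hm : (k + 1) * M.H + 1 ≤ m) :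
    FinMeas (ℱ m) (fun ω => tables M p (fun j i => X j i ω) (fun j => π j ω) k) := by
  induction k generalizing m with
  | zero => exact FinMeas.const _
  | succ k ih =>
    have hk' : k + 1 ∈ Icc 1 p.K := by simp; omega
    have e : (k + 1 + 1) * M.H = (k + 1) * M.H + M.H := by ring
    have key : ∀ h ≤ M.H, FinMeas (ℱ ((k + 1) * M.H + h + 1)) (fun ω =>
        afterSteps M p (tables M p (fun j i => X j i ω) (fun j => π j ω) k)
          (fun i => X (k + 1) i ω) (π (k + 1) ω) h) := by
      intro h
      induction h with
      | zero => intro _; exact ih (by omega) (by omega)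
      | succ h ihh =>
        intro hle
        have h1 := (ihh (by omega)).mono (ℱ.mono (by omega : _ ≤ (k + 1) * M.H + (h + 1) + 1))
        have h2 := hrun.finMeas_state hk' (h := h + 1) (by simp; omega)
          (by omega : _ ≤ (k + 1) * M.H + (h + 1) + 1)
        have h3 := hrun.finMeas_action hk' (h := h + 1) (by simp; omega)
          (by omega : _ ≤ (k + 1) * M.H + (h + 1) + 1)
        have h4 := hrun.finMeas_state hk' (h := h + 2) (by simp; omega)
          (by omega : _ ≤ (k + 1) * M.H + (h + 1) + 1)
        exact ((h1.prodMk h2).prodMk (h3.prodMk h4)).comp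
          (fun q => step M p q.1.1 (h + 1) q.1.2 q.2.1 q.2.2)
    exact (key M.H le_rfl).mono (ℱ.mono (by omega))

lemma IsRun.finMeas_value {k : ℕ} (hk : k ∈ Icc 1 p.K) {m : ℕ} (hm : k * M.H + 1 ≤ m) {h : ℕ}
    (h1 : 1 ≤ h) (s : S) : FinMeas (ℱ m) (fun ω => M.value (detPolicy (π k ω)) h s) := by
  have key : ∀ d h, M.H + 1 ≤ h + d → 1 ≤ h → ∀ s,
      FinMeas (ℱ m) (fun ω => M.value (detPolicy (π k ω)) h s) := by
    intro d
    induction d with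
    | zero =>
      intro h hd _ s
      simp only [EpisodicMDP.value_of_lt M _ (by omega : M.H < h)]
      exact FinMeas.const 0
    | succ d ih =>
      intro h hd h1 s
      rcases Nat.lt_or_ge M.H h with hlt | hle
      · simp only [EpisodicMDP.value_of_lt M _ hlt]
        exact FinMeas.const 0
      · simp only [EpisodicMDP.value_detPolicy M _ hle]
        exact ((hrun.finMeas_policy hk (by simp; omega) hm s).prodMk
          (FinMeas.pi (ih (h + 1) (by omega) (by omega)))).comp
          (fun q => M.r h s q.1 + M.nextMean h s q.1 q.2)
  exact key (M.H + 1) h (by omega) h1 s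

end run

section expectation
variable {S A : Type*} [Fintype S] [Fintype A] {M : EpisodicMDP S A} {p : QESAParams}
  {Ω : Type*} [mΩ : MeasurableSpace Ω] {μ : Measure Ω} [IsProbabilityMeasure μ]
  {ℱ : Filtration ℕ mΩ} {X : ℕ → ℕ → Ω → S} {π : ℕ → Ω → ℕ → S → A}
  (hrun : IsRun M p μ ℱ X π)
include hrun

/-- Integrating out the next state. -/
lemma IsRun.integral_next {k : ℕ} (hk : k ∈ Icc 1 p.K) {h : ℕ} (hh : h ∈ Icc 1 M.H)
    {f : S → Ω → ℝ} (hf : ∀ y, FinMeas (ℱ (k * M.H + h)) (f y)) :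
    ∫ ω, f (X k (h + 1) ω) ω ∂μ
      = ∫ ω, M.nextMean h (X k h ω) (π k ω h (X k h ω)) (fun y => f y ω) ∂μ := by
  have hh' := mem_Icc.mp hh
  have hle := ℱ.le (k * M.H + h)
  have hX : ∀ y, MeasurableSet {ω | X k (h + 1) ω = y} := fun y =>
    ℱ.le _ _ (hrun.state_meas k hk (h + 1) (by simp; omega) y)
  have hind : ∀ y, Integrable ({ω | X k (h + 1) ω = y}.indicator fun _ => (1 : ℝ)) μ := fun y =>
    (integrable_const 1).indicator (hX y)
  have hprod : ∀ y, Integrable (f y * {ω | X k (h + 1) ω = y}.indicator fun _ => (1 : ℝ)) μ := by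
    intro y
    have : (f y * {ω | X k (h + 1) ω = y}.indicator fun _ => (1 : ℝ))
        = {ω | X k (h + 1) ω = y}.indicator (f y) := by
      ext ω; by_cases h : X k (h + 1) ω = y <;> simp [h]
    rw [this]
    exact ((hf y).mono hle).integrable.indicator (hX y)
  have hstep : ∀ y, ∫ ω, (f y * {ω | X k (h + 1) ω = y}.indicator fun _ => (1 : ℝ)) ω ∂μ
      = ∫ ω, M.P h (X k h ω) (π k ω h (X k h ω)) y * f y ω ∂μ := by
    intro y
    rw [← integral_condExp hle]
    refine integral_congr_ae ?_
    filter_upwards [condExp_mul_of_stronglyMeasurable_left (hf y).stronglyMeasurable (hprod y)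
      (hind y), hrun.transition k hk h hh y] with ω h1 h2
    rw [h1, Pi.mul_apply, h2, mul_comm]
  have hPint : ∀ y, Integrable (fun ω => M.P h (X k h ω) (π k ω h (X k h ω)) y * f y ω) μ := by
    intro y
    exact ((((hrun.finMeas_state hk (by simp; omega) le_rfl).prodMk
      (hrun.finMeas_action hk hh le_rfl)).prodMk (hf y)).comp
      (fun q => M.P h q.1.1 q.1.2 y * q.2) |>.mono hle).integrable
  calc ∫ ω, f (X k (h + 1) ω) ω ∂μ
      = ∫ ω, ∑ y, (f y * {ω | X k (h + 1) ω = y}.indicator fun _ => (1 : ℝ)) ω ∂μ := by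
        refine integral_congr_ae (Filter.Eventually.of_forall fun ω => ?_)
        simp [Set.indicator_apply]
    _ = ∑ y, ∫ ω, M.P h (X k h ω) (π k ω h (X k h ω)) y * f y ω ∂μ := by
        rw [integral_finsetSum _ fun y _ => hprod y]
        exact sum_congr rfl fun y _ => hstep y
    _ = _ := by
        rw [← integral_finsetSum _ fun y _ => hPint y]
        rfl

/-- The expected regret is the expected sum of the gaps at the visited cells. -/
lemma IsRun.integral_regret [Nonempty A] :
    Integrable (fun ω => M.regret p.K (fun k => X k 1 ω) (fun k => π k ω)) μ ∧
    ∫ ω, M.regret p.K (fun k => X k 1 ω) (fun k => π k ω) ∂μ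
      = ∫ ω, ∑ h ∈ Icc 1 M.H, ∑ j ∈ range p.K,
          M.gap h (X (j + 1) h ω) (π (j + 1) ω h (X (j + 1) h ω)) ∂μ := by
  have hdiff : ∀ k ∈ Icc 1 p.K, ∀ h ∈ Icc 1 (M.H + 1), ∀ m, k * M.H + h ≤ m → ∀ y,
      FinMeas (ℱ m) (fun ω => M.optValue h y - M.value (detPolicy (π k ω)) h y) := by
    intro k hk h hh m hm y
    simp only [mem_Icc] at hh
    exact (hrun.finMeas_value hk (by omega) hh.1 y).comp (fun v => M.optValue h y - v)
  have hdiffX : ∀ k ∈ Icc 1 p.K, ∀ h ∈ Icc 1 (M.H + 1), Integrable (fun ω =>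
      M.optValue h (X k h ω) - M.value (detPolicy (π k ω)) h (X k h ω)) μ := by
    intro k hk h hh
    exact (((hrun.finMeas_state hk hh le_rfl).apply
      (hdiff k hk h hh _ le_rfl)).mono (ℱ.le _)).integrable
  have hgap : ∀ k ∈ Icc 1 p.K, ∀ h ∈ Icc 1 M.H, Integrable (fun ω =>
      M.gap h (X k h ω) (π k ω h (X k h ω))) μ := by
    intro k hk h hh
    have hh' := mem_Icc.mp hh
    exact ((((hrun.finMeas_state hk (by simp; omega) le_rfl).prodMk
      (hrun.finMeas_action hk hh le_rfl)).comp (fun q => M.gap h q.1 q.2)).mono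
        (ℱ.le _)).integrable
  have hstep : ∀ k ∈ Icc 1 p.K, ∀ h ∈ Icc 1 M.H,
      ∫ ω, (M.optValue h (X k h ω) - M.value (detPolicy (π k ω)) h (X k h ω)) ∂μ
        = ∫ ω, M.gap h (X k h ω) (π k ω h (X k h ω)) ∂μ
          + ∫ ω, (M.optValue (h + 1) (X k (h + 1) ω)
            - M.value (detPolicy (π k ω)) (h + 1) (X k (h + 1) ω)) ∂μ := by
    intro k hk h hh
    have hh' := mem_Icc.mp hh
    have hmem : h + 1 ∈ Icc 1 (M.H + 1) := by simp; omega
    have hF : ∀ y, FinMeas (ℱ (k * M.H + h)) (fun ω =>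
        M.optValue (h + 1) y - M.value (detPolicy (π k ω)) (h + 1) y) := fun y =>
      (hrun.finMeas_value hk (by omega) (by omega) y).comp (fun v => M.optValue (h + 1) y - v)
    have h1 := hrun.integral_next hk hh hF
    rw [h1, ← integral_add (hgap k hk h hh)]
    · refine integral_congr_ae (Filter.Eventually.of_forall fun ω => ?_)
      simp only
      rw [EpisodicMDP.value_detPolicy M _ hh'.2, EpisodicMDP.nextMean_sub]
      unfold EpisodicMDP.gap EpisodicMDP.optQ
      ring
    · exact ((((hrun.finMeas_state hk (by simp; omega) le_rfl).prodMk
        (hrun.finMeas_action hk hh le_rfl)).prodMk (FinMeas.pi hF)).comp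
        (fun q => M.nextMean h q.1.1 q.1.2 q.2) |>.mono (ℱ.le _)).integrable
  have hsum : ∀ k ∈ Icc 1 p.K, ∀ n h, h + n = M.H + 1 → 1 ≤ h →
      ∫ ω, (M.optValue h (X k h ω) - M.value (detPolicy (π k ω)) h (X k h ω)) ∂μ
        = ∑ i ∈ Icc h M.H, ∫ ω, M.gap i (X k i ω) (π k ω i (X k i ω)) ∂μ := by
    intro k hk n
    induction n with
    | zero =>
      intro h hn _
      rw [Icc_eq_empty (by omega)]
      simp [EpisodicMDP.value_of_lt M _ (by omega : M.H < h),
        EpisodicMDP.optValue_of_lt M (by omega : M.H < h)]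
    | succ n ih =>
      intro h hn h1
      rw [hstep k hk h (by simp; omega), ih (h + 1) (by omega) (by omega),
        ← Finset.insert_Icc_add_one_left_eq_Icc (by omega : h ≤ M.H), sum_insert (by simp)]
  have hreg : ∀ k ∈ Icc 1 p.K, Integrable (fun ω =>
      M.optValue 1 (X k 1 ω) - M.value (detPolicy (π k ω)) 1 (X k 1 ω)) μ :=
    fun k hk => hdiffX k hk 1 (by simp)
  refine ⟨integrable_finsetSum _ hreg, ?_⟩
  unfold EpisodicMDP.regret
  rw [integral_finsetSum _ hreg]
  have hshift : ∀ f : ℕ → ℝ, ∑ k ∈ Icc 1 p.K, f k = ∑ j ∈ range p.K, f (j + 1) := by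
    intro f
    rw [range_eq_Ico, sum_Ico_add' f 0 p.K 1]
    rfl
  have hmem : ∀ j ∈ range p.K, j + 1 ∈ Icc 1 p.K := by
    intro j hj; simp at hj ⊢; omega
  rw [integral_finsetSum _ fun h hh => integrable_finsetSum _ fun j hj =>
    hgap (j + 1) (hmem j hj) h hh]
  rw [sum_congr rfl fun h hh => integral_finsetSum _ fun j hj => hgap (j + 1) (hmem j hj) h hh]
  rw [sum_comm, ← hshift fun k => ∑ h ∈ Icc 1 M.H, ∫ ω, M.gap h (X k h ω)
    (π k ω h (X k h ω)) ∂μ]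
  exact sum_congr rfl fun k hk => hsum k hk M.H 1 (by omega) le_rfl

end expectation

/-! ### Bernstein's inequality from exponential moments -/

/-- Optimization of the exponential bound over a finite grid of parameters. -/
lemma le_of_grid {D V L R : ℝ} {N : ℕ} (hN : 1 ≤ N) (hR : 0 < R) (hL : 0 < L) (hV0 : 0 ≤ V)
    (hV : V ≤ N * R ^ 2)
    (h : ∀ l ∈ Icc 1 N, (l / (N * R)) * D - (l / (N * R)) ^ 2 * V ≤ L) :
    D ≤ 2 * √(L * V) + (2 * L + 1) * R := by
  have hN0 : (0 : ℝ) < N := by exact_mod_cast hN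
  have hsq := Real.sqrt_nonneg (L * V)
  have hsq2 : √(L * V) ^ 2 = L * V := Real.sq_sqrt (by positivity)
  -- a parameter `u ≤ 1 / R` of the grid gives `D ≤ u V + L / u`
  have key : ∀ l ∈ Icc 1 N, D ≤ l / (N * R) * V + L / (l / (N * R)) := by
    intro l hl
    have hl0 : (0 : ℝ) < l := by exact_mod_cast (mem_Icc.mp hl).1
    have hu : (0 : ℝ) < l / (N * R) := by positivity
    have h1 := h l hl
    set u : ℝ := l / (N * R)
    have h2 : u * D ≤ u * (u * V + L / u) := by
      rw [mul_add, mul_div_cancel₀ _ hu.ne']; linarith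
    exact le_of_mul_le_mul_left h2 hu
  rcases le_or_gt V (L * R ^ 2) with hcase | hcase
  · have h1 := key N (by simp; omega)
    have e1 : (N : ℝ) / (N * R) = 1 / R := by field_simp
    rw [e1] at h1
    have h2 : 1 / R * V ≤ L * R := by
      rw [one_div, inv_mul_le_iff₀ hR]; linarith
    have h3 : L / (1 / R) = L * R := by field_simp
    rw [h3] at h1
    linarith
  · have hVpos : 0 < V := lt_of_le_of_lt (by positivity) hcase
    have hspos : 0 < √(L * V) := Real.sqrt_pos.mpr (by positivity)
    -- the optimal parameter is `√(L V) / V`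
    set v := √(L * V) / V with hv
    have hv0 : 0 < v := by positivity
    have hvR : v * R ≤ 1 := by
      have h0 : √(L * V) * R ≤ V := by
        apply le_of_sq_le_sq _ hVpos.le
        rw [mul_pow, hsq2]
        calc L * V * R ^ 2 = (L * R ^ 2) * V := by ring
          _ ≤ V * V := by gcongr
          _ = V ^ 2 := by ring
      rw [hv, div_mul_eq_mul_div, div_le_one hVpos]; exact h0
    set l := ⌈v * (N * R)⌉₊ with hl
    have hl1 : v * (N * R) ≤ l := Nat.le_ceil _
    have hl2 : (l : ℝ) < v * (N * R) + 1 := Nat.ceil_lt_add_one (by positivity)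
    have hlmem : l ∈ Icc 1 N := by
      rw [mem_Icc]
      refine ⟨Nat.one_le_ceil_iff.mpr (by positivity), Nat.ceil_le.mpr ?_⟩
      calc v * (N * R) = v * R * N := by ring
        _ ≤ 1 * N := by gcongr
        _ = N := one_mul _
    have h1 := key l hlmem
    have hNR : 0 < (N : ℝ) * R := by positivity
    have hu1 : v ≤ l / (N * R) := by rw [le_div_iff₀ hNR]; exact hl1
    have hu2 : (l : ℝ) / (N * R) ≤ v + 1 / (N * R) := by
      rw [div_le_iff₀ hNR, add_mul, one_div, inv_mul_cancel₀ hNR.ne']; exact hl2.le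
    have h2 : (l : ℝ) / (N * R) * V ≤ √(L * V) + R := by
      calc (l : ℝ) / (N * R) * V ≤ (v + 1 / (N * R)) * V := by gcongr
        _ = √(L * V) + V / (N * R) := by rw [hv]; field_simp
        _ ≤ _ := by
            gcongr
            rw [div_le_iff₀ hNR]; linarith
    have h3 : L / (l / (N * R)) ≤ √(L * V) := by
      calc L / (l / (N * R)) ≤ L / v := by gcongr
        _ = √(L * V) := by
            rw [hv, div_div_eq_mul_div, div_eq_iff hspos.ne', ← sq, hsq2]
    have h4 : 0 ≤ L * R := by positivity
    linarith

lemma exp_le_one_add_add_sq {u : ℝ} (hu : |u| ≤ 1) : Real.exp u ≤ 1 + u + u ^ 2 := by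
  have := Real.abs_exp_sub_one_sub_id_le hu
  linarith [(abs_le.mp this).2]

variable {S A : Type*} [Fintype S] [Fintype A] {M : EpisodicMDP S A} {p : QESAParams}

omit [Fintype A] in
lemma nextMean_exp_le_one {h : ℕ} {s : S} {a : A} {F : S → ℝ} {u B : ℝ} (hu : |u| * B ≤ 1)
    (hF : ∀ y y', |F y - F y'| ≤ B) :
    M.nextMean h s a (fun y => Real.exp (u * (F y - M.nextMean h s a F)
      - u ^ 2 * M.nextVar h s a F)) ≤ 1 := by
  set m := M.nextMean h s a F with hm
  set v := M.nextVar h s a F with hv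
  have h1 : ∀ y, Real.exp (u * (F y - m) - u ^ 2 * v)
      ≤ Real.exp (-(u ^ 2 * v)) * (1 + u * (F y - m) + u ^ 2 * (F y - m) ^ 2) := by
    intro y
    rw [sub_eq_neg_add, Real.exp_add]
    refine mul_le_mul_of_nonneg_left ?_ (Real.exp_pos _).le
    rw [← mul_pow]
    refine exp_le_one_add_add_sq ?_
    rw [abs_mul]
    exact (mul_le_mul_of_nonneg_left (EpisodicMDP.abs_sub_nextMean_le hF y) (abs_nonneg _)).trans hu
  refine (EpisodicMDP.nextMean_mono h1).trans ?_
  rw [EpisodicMDP.nextMean_const_mul, EpisodicMDP.nextMean_add, EpisodicMDP.nextMean_add,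
    EpisodicMDP.nextMean_const_mul, EpisodicMDP.nextMean_const_mul, EpisodicMDP.nextMean_sub,
    EpisodicMDP.nextMean_const, EpisodicMDP.nextMean_const, ← EpisodicMDP.nextVar_eq, ← hv, ← hm,
    sub_self, mul_zero, add_zero]
  calc _ ≤ Real.exp (-(u ^ 2 * v)) * Real.exp (u ^ 2 * v) := by
        refine mul_le_mul_of_nonneg_left ?_ (Real.exp_pos _).le
        linarith [Real.add_one_le_exp (u ^ 2 * v)]
    _ = 1 := by rw [← Real.exp_add, neg_add_cancel, Real.exp_zero]

/-- A family of deviations to be controlled: the function `F` of the next state, which may depend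
on the current tables, has oscillation at most `B`; the `i`-th of `n` visits gets the weight
`wt n i ≤ R n / B`. -/
structure DevFamily (S A : Type*) where
  /-- the function of the next state -/
  F : QESATables S A → S → ℝ
  /-- the weight of the `i`-th of `n` visits -/
  wt : ℕ → ℕ → ℝ
  /-- bound for the oscillation of `F` -/
  B : ℝ
  /-- bound for the weighted increments -/
  R : ℕ → ℝ

/-- The weights and oscillations are bounded as announced in `DevFamily`. -/
structure DevFamily.Valid {S A : Type*} (f : DevFamily S A) : Prop where
  R_pos : ∀ n, 1 ≤ n → 0 < f.R n
  wt_nonneg : ∀ n i, 0 ≤ f.wt n i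
  wt_le : ∀ n i, 1 ≤ n → 1 ≤ i → f.wt n i * f.B ≤ f.R n
  osc : ∀ t y y', |f.F t y - f.F t y'| ≤ f.B

/-- The logarithm of the exponential supermartingale with parameter `u` after `J` episodes.  Only
the first `n` visits of `z` contribute; the weights depend on `n`, so that each `n` has a
supermartingale of its own. -/
noncomputable def expSum (M : EpisodicMDP S A) (p : QESAParams) (x : ℕ → ℕ → S)
    (d : ℕ → ℕ → S → A) (h : ℕ) (z : S × A) (f : DevFamily S A) (n : ℕ) (u : ℝ) (J : ℕ) : ℝ :=
  ∑ j ∈ range J, if cell x d h j = z ∧ cnt (cell x d h) z j + 1 ≤ n then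
    u * f.wt n (cnt (cell x d h) z j + 1) * (f.F (tables M p x d j) (x (j + 1) (h + 1))
        - M.nextMean h z.1 z.2 (f.F (tables M p x d j)))
      - (u * f.wt n (cnt (cell x d h) z j + 1)) ^ 2 * M.nextVar h z.1 z.2 (f.F (tables M p x d j))
    else 0

/-- The total exponential weight of the deviations of the family `f`. -/
noncomputable def devMass (M : EpisodicMDP S A) (p : QESAParams) (x : ℕ → ℕ → S)
    (d : ℕ → ℕ → S → A) (h : ℕ) (z : S × A) (f : DevFamily S A) : ℝ :=
  ∑ n ∈ Icc 1 p.K, ∑ l ∈ Icc 1 n,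
    Real.exp (expSum M p x d h z f n (l / (n * f.R n)) p.K - 4 * iota M p)

section pathwise
variable {x : ℕ → ℕ → S} {d : ℕ → ℕ → S → A}

local notation "T" => tables M p x d

lemma expSum_eq {h : ℕ} {z : S × A} {f : DevFamily S A} {u : ℝ} {k : ℕ} (hk : k ≤ p.K) :
    expSum M p x d h z f (cnt (cell x d h) z k) u p.K
      = u * ∑ j ∈ visits (cell x d h) z k,
          f.wt (cnt (cell x d h) z k) (cnt (cell x d h) z j + 1)
            * (f.F (T j) (x (j + 1) (h + 1)) - M.nextMean h z.1 z.2 (f.F (T j)))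
        - u ^ 2 * ∑ j ∈ visits (cell x d h) z k,
          f.wt (cnt (cell x d h) z k) (cnt (cell x d h) z j + 1) ^ 2
            * M.nextVar h z.1 z.2 (f.F (T j)) := by
  have hfil : (range p.K).filter (fun j => cell x d h j = z ∧
      cnt (cell x d h) z j + 1 ≤ cnt (cell x d h) z k) = visits (cell x d h) z k := by
    ext j
    simp only [mem_filter, mem_range, mem_visits]
    constructor
    · rintro ⟨_, hz, hle⟩
      refine ⟨?_, hz⟩
      by_contra hge
      have := cnt_mono (c := cell x d h) (z := z) (not_lt.mp hge)
      omega
    · rintro ⟨hj, hz⟩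
      exact ⟨by omega, hz, cnt_lt_of_visit (mem_visits.mpr ⟨hj, hz⟩)⟩
  unfold expSum
  rw [← sum_filter, hfil, mul_sum, mul_sum, ← sum_sub_distrib]
  exact sum_congr rfl fun j _ => by ring

lemma devMass_nonneg (h : ℕ) (z : S × A) (f : DevFamily S A) : 0 ≤ devMass M p x d h z f :=
  sum_nonneg fun _ _ => sum_nonneg fun _ _ => (Real.exp_pos _).le

/-- If the exponential weight is less than `1`, then Bernstein's inequality holds at all times. -/
lemma bernstein_of_devMass_lt {h : ℕ} {z : S × A} {f : DevFamily S A} (hf : f.Valid)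
    (hι : 1 / 2 ≤ iota M p) (hmass : devMass M p x d h z f < 1) {k : ℕ} (hk : k ≤ p.K)
    (hn : 1 ≤ cnt (cell x d h) z k) :
    ∑ j ∈ visits (cell x d h) z k, f.wt (cnt (cell x d h) z k) (cnt (cell x d h) z j + 1)
        * (f.F (T j) (x (j + 1) (h + 1)) - M.nextMean h z.1 z.2 (f.F (T j)))
      ≤ 4 * √(iota M p * ∑ j ∈ visits (cell x d h) z k,
          f.wt (cnt (cell x d h) z k) (cnt (cell x d h) z j + 1) ^ 2
            * M.nextVar h z.1 z.2 (f.F (T j))) + 16 * iota M p * f.R (cnt (cell x d h) z k) := by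
  have hcnt : cnt (cell x d h) z k ≤ p.K := (cnt_le k).trans hk
  have hsmall : ∀ l ∈ Icc 1 (cnt (cell x d h) z k), expSum M p x d h z f (cnt (cell x d h) z k)
      (l / (cnt (cell x d h) z k * f.R (cnt (cell x d h) z k))) p.K ≤ 4 * iota M p := by
    intro l hl
    by_contra hgt
    rw [not_le] at hgt
    have h1 : 1 ≤ Real.exp (expSum M p x d h z f (cnt (cell x d h) z k)
      (l / (cnt (cell x d h) z k * f.R (cnt (cell x d h) z k))) p.K - 4 * iota M p) := by
      rw [← Real.exp_zero]; exact Real.exp_le_exp.mpr (by linarith)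
    have h2 := single_le_sum (f := fun l : ℕ => Real.exp (expSum M p x d h z f
      (cnt (cell x d h) z k) (l / (cnt (cell x d h) z k * f.R (cnt (cell x d h) z k))) p.K
        - 4 * iota M p)) (fun _ _ => (Real.exp_pos _).le) hl
    have h3 := single_le_sum (f := fun n : ℕ => ∑ l ∈ Icc 1 n, Real.exp (expSum M p x d h z f
      n (l / (n * f.R n)) p.K - 4 * iota M p)) (fun _ _ => sum_nonneg fun _ _ =>
        (Real.exp_pos _).le) (mem_Icc.mpr ⟨hn, hcnt⟩)
    unfold devMass at hmass
    linarith
  simp only [expSum_eq hk] at hsmall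
  have hcard : (visits (cell x d h) z k).card = cnt (cell x d h) z k := rfl
  set n := cnt (cell x d h) z k with hn'
  set V := ∑ j ∈ visits (cell x d h) z k, f.wt n (cnt (cell x d h) z j + 1) ^ 2
            * M.nextVar h z.1 z.2 (f.F (T j)) with hV
  have hR := hf.R_pos n hn
  have hV0 : 0 ≤ V := sum_nonneg fun j _ => mul_nonneg (sq_nonneg _) EpisodicMDP.nextVar_nonneg
  have hVle : V ≤ n * f.R n ^ 2 := by
    have hconst : n * f.R n ^ 2 = ∑ j ∈ visits (cell x d h) z k, f.R n ^ 2 := by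
      rw [sum_const, hcard, nsmul_eq_mul]
    rw [hconst]
    refine sum_le_sum fun j _ => ?_
    have h1 := EpisodicMDP.nextVar_le_sq (M := M) (h := h) (s := z.1) (a := z.2) (hf.osc (T j))
    have hB : 0 ≤ f.B := (abs_nonneg _).trans (hf.osc (T j) z.1 z.1)
    calc _ ≤ f.wt n (cnt (cell x d h) z j + 1) ^ 2 * f.B ^ 2 :=
          mul_le_mul_of_nonneg_left h1 (sq_nonneg _)
      _ = (f.wt n (cnt (cell x d h) z j + 1) * f.B) ^ 2 := by ring
      _ ≤ f.R n ^ 2 := by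
          have := hf.wt_le n (cnt (cell x d h) z j + 1) hn (by omega)
          have h0 := mul_nonneg (hf.wt_nonneg n (cnt (cell x d h) z j + 1)) hB
          gcongr
  have := le_of_grid hn hR (by linarith) hV0 hVle hsmall
  have e1 : √(4 * iota M p * V) = 2 * √(iota M p * V) := by
    rw [mul_assoc, Real.sqrt_mul (by norm_num), show (4 : ℝ) = 2 ^ 2 by norm_num,
      Real.sqrt_sq (by norm_num)]
  rw [e1] at this
  have h3 : (2 * (4 * iota M p) + 1) * f.R n ≤ 16 * iota M p * f.R n :=
    mul_le_mul_of_nonneg_right (by linarith) hR.le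
  linarith

end pathwise

section moment
variable {Ω : Type*} [mΩ : MeasurableSpace Ω] {μ : Measure Ω} [IsProbabilityMeasure μ]
  {ℱ : Filtration ℕ mΩ} {X : ℕ → ℕ → Ω → S} {π : ℕ → Ω → ℕ → S → A}
  (hrun : IsRun M p μ ℱ X π)
include hrun

omit [IsProbabilityMeasure μ] in
lemma IsRun.finMeas_cell {h : ℕ} (hh : h ∈ Icc 1 M.H) {j : ℕ} (hj : j < p.K) {m : ℕ}
    (hm : (j + 1) * M.H + h ≤ m) :
    FinMeas (ℱ m) (fun ω => cell (fun j i => X j i ω) (fun j => π j ω) h j) := by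
  have hh' := mem_Icc.mp hh
  have hk : j + 1 ∈ Icc 1 p.K := by simp; omega
  exact (hrun.finMeas_state hk (by simp; omega) hm).prodMk (hrun.finMeas_action hk hh hm)

omit [IsProbabilityMeasure μ] in
lemma IsRun.finMeas_expSum {h : ℕ} (hh : h ∈ Icc 1 M.H) (z : S × A) (f : DevFamily S A) (n : ℕ)
    (u : ℝ) {J : ℕ} (hJ : J ≤ p.K) {m : ℕ} (hm : J * M.H + h + 1 ≤ m) :
    FinMeas (ℱ m) (fun ω =>
      expSum M p (fun j i => X j i ω) (fun j => π j ω) h z f n u J) := by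
  have hh' := mem_Icc.mp hh
  unfold expSum
  refine FinMeas.sum fun j hj => ?_
  have hj' : j < J := by simpa using hj
  have hk : j + 1 ∈ Icc 1 p.K := by simp; omega
  have hle : (j + 1) * M.H ≤ J * M.H := Nat.mul_le_mul_right _ hj'
  have h1 := hrun.finMeas_tables (k := j) (by omega) (by omega : (j + 1) * M.H + 1 ≤ m)
  have h2 := hrun.finMeas_cell hh (by omega : j < p.K) (by omega : (j + 1) * M.H + h ≤ m)
  have h3 := hrun.finMeas_state hk (h := h + 1) (by simp; omega)
    (by omega : (j + 1) * M.H + (h + 1) ≤ m)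
  simp only [← N_eq_cnt M p _ _ hh]
  exact ((h1.prodMk h2).prodMk h3).comp (fun q =>
    if q.1.2 = z ∧ q.1.1.N h z.1 z.2 + 1 ≤ n then
      u * f.wt n (q.1.1.N h z.1 z.2 + 1) * (f.F q.1.1 q.2 - M.nextMean h z.1 z.2 (f.F q.1.1))
      - (u * f.wt n (q.1.1.N h z.1 z.2 + 1)) ^ 2 * M.nextVar h z.1 z.2 (f.F q.1.1) else 0)

/-- The exponential supermartingale has mean at most `1`. -/
lemma IsRun.integral_exp_expSum_le {h : ℕ} (hh : h ∈ Icc 1 M.H) (z : S × A) {f : DevFamily S A}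
    (hf : f.Valid) {n : ℕ} (hn : 1 ≤ n) {u : ℝ} (hu0 : 0 ≤ u) (hu : u * f.R n ≤ 1) {J : ℕ}
    (hJ : J ≤ p.K) :
    ∫ ω, Real.exp (expSum M p (fun j i => X j i ω) (fun j => π j ω) h z f n u J) ∂μ ≤ 1 := by
  have hh' := mem_Icc.mp hh
  induction J with
  | zero => simp [expSum]
  | succ J ih =>
    refine le_trans ?_ (ih (by omega))
    have hk : J + 1 ∈ Icc 1 p.K := by simp; omega
    have hH : 1 ≤ M.H := by omega
    have e : (J + 1) * M.H = J * M.H + M.H := by ring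
    have h0 := hrun.finMeas_expSum hh z f n u (J := J) (by omega)
      (by omega : J * M.H + h + 1 ≤ (J + 1) * M.H + h)
    have h1 := hrun.finMeas_tables (k := J) (by omega)
      (by omega : (J + 1) * M.H + 1 ≤ (J + 1) * M.H + h)
    have h2 := hrun.finMeas_cell hh (by omega : J < p.K) le_rfl
    set φ : ℝ × QESATables S A × (S × A) → S → ℝ := fun q y => Real.exp (q.1 +
      if q.2.2 = z ∧ q.2.1.N h z.1 z.2 + 1 ≤ n then
        u * f.wt n (q.2.1.N h z.1 z.2 + 1) * (f.F q.2.1 y - M.nextMean h z.1 z.2 (f.F q.2.1))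
        - (u * f.wt n (q.2.1.N h z.1 z.2 + 1)) ^ 2 * M.nextVar h z.1 z.2 (f.F q.2.1) else 0)
      with hφ
    have hq := h0.prodMk (h1.prodMk h2)
    have htower := hrun.integral_next hk hh (f := fun y ω => φ
      (expSum M p (fun j i => X j i ω) (fun j => π j ω) h z f n u J,
        tables M p (fun j i => X j i ω) (fun j => π j ω) J,
        cell (fun j i => X j i ω) (fun j => π j ω) h J) y) (fun y => hq.comp fun q => φ q y)
    have hle : ∀ q : ℝ × QESATables S A × (S × A),
        M.nextMean h q.2.2.1 q.2.2.2 (φ q) ≤ Real.exp q.1 := by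
      rintro ⟨e0, t, c⟩
      simp only [hφ, Real.exp_add, EpisodicMDP.nextMean_const_mul]
      refine mul_le_of_le_one_right (Real.exp_pos _).le ?_
      split_ifs with hc
      · obtain ⟨rfl, _⟩ := hc
        refine nextMean_exp_le_one (B := f.B) ?_ (hf.osc t)
        have hw := hf.wt_nonneg n (t.N h c.1 c.2 + 1)
        rw [abs_of_nonneg (mul_nonneg hu0 hw), mul_assoc]
        exact (mul_le_mul_of_nonneg_left (hf.wt_le n _ hn (by omega)) hu0).trans hu
      · exact (EpisodicMDP.nextMean_const _).le.trans (by simp)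
    calc _ = ∫ ω, φ (expSum M p (fun j i => X j i ω) (fun j => π j ω) h z f n u J,
          tables M p (fun j i => X j i ω) (fun j => π j ω) J,
          cell (fun j i => X j i ω) (fun j => π j ω) h J) (X (J + 1) (h + 1) ω) ∂μ := by
          refine integral_congr_ae (Filter.Eventually.of_forall fun ω => ?_)
          simp only [hφ]
          rw [expSum, sum_range_succ, ← expSum, N_eq_cnt M p _ _ hh]
      _ ≤ _ := by
          rw [htower]
          refine integral_mono ?_ ?_ fun ω => hle
            (expSum M p (fun j i => X j i ω) (fun j => π j ω) h z f n u J,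
              tables M p (fun j i => X j i ω) (fun j => π j ω) J,
              cell (fun j i => X j i ω) (fun j => π j ω) h J)
          · exact ((hq.comp fun q => M.nextMean h q.2.2.1 q.2.2.2 (φ q)).mono
              (ℱ.le _)).integrable
          · exact ((h0.comp Real.exp).mono (ℱ.le _)).integrable

lemma IsRun.integrable_exp_expSum {h : ℕ} (hh : h ∈ Icc 1 M.H) (z : S × A) (f : DevFamily S A)
    (n : ℕ) (u c : ℝ) : Integrable (fun ω => Real.exp
      (expSum M p (fun j i => X j i ω) (fun j => π j ω) h z f n u p.K - c)) μ :=
  (((hrun.finMeas_expSum hh z f n u le_rfl le_rfl).comp fun v => Real.exp (v - c)).mono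
    (ℱ.le _)).integrable

lemma IsRun.integrable_devMass {h : ℕ} (hh : h ∈ Icc 1 M.H) (z : S × A) (f : DevFamily S A) :
    Integrable (fun ω => devMass M p (fun j i => X j i ω) (fun j => π j ω) h z f) μ :=
  integrable_finsetSum _ fun n _ => integrable_finsetSum _ fun _ _ =>
    hrun.integrable_exp_expSum hh z f n _ _

lemma IsRun.integral_devMass_le {h : ℕ} (hh : h ∈ Icc 1 M.H) (z : S × A) {f : DevFamily S A}
    (hf : f.Valid) :
    ∫ ω, devMass M p (fun j i => X j i ω) (fun j => π j ω) h z f ∂μ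
      ≤ (p.K : ℝ) ^ 2 * Real.exp (-(4 * iota M p)) := by
  unfold devMass
  rw [integral_finsetSum _ fun n _ => integrable_finsetSum _ fun l _ =>
    hrun.integrable_exp_expSum hh z f n _ _]
  rw [sum_congr rfl fun n _ => integral_finsetSum _ fun l _ =>
    hrun.integrable_exp_expSum hh z f n _ _]
  calc _ ≤ ∑ n ∈ Icc 1 p.K, ∑ l ∈ Icc 1 n, Real.exp (-(4 * iota M p)) := by
        refine sum_le_sum fun n hn => sum_le_sum fun l hl => ?_
        simp only [mem_Icc] at hn hl
        have hR := hf.R_pos n hn.1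
        have hn0 : (0 : ℝ) < n := by exact_mod_cast hn.1
        have hln : (l : ℝ) ≤ n := by exact_mod_cast hl.2
        have h1 := hrun.integral_exp_expSum_le hh z hf hn.1
          (u := l / (n * f.R n)) (by positivity) (by
            rw [div_mul_eq_mul_div, div_le_one (by positivity)]
            exact mul_le_mul_of_nonneg_right hln hR.le) (J := p.K) le_rfl
        simp only [sub_eq_add_neg, Real.exp_add]
        rw [integral_mul_const]
        exact mul_le_of_le_one_left (Real.exp_pos _).le h1
    _ ≤ ∑ n ∈ Icc 1 p.K, p.K * Real.exp (-(4 * iota M p)) := by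
        refine sum_le_sum fun n hn => ?_
        simp only [mem_Icc] at hn
        rw [sum_const, Nat.card_Icc, nsmul_eq_mul, Nat.add_sub_cancel]
        refine mul_le_mul_of_nonneg_right ?_ (Real.exp_pos _).le
        exact_mod_cast hn.2
    _ = _ := by
        rw [sum_const, Nat.card_Icc, nsmul_eq_mul, Nat.add_sub_cancel]; ring

end moment

/-! ### The good event -/

section good

/-- Deviations of averages with the weights `η_i^n`. -/
noncomputable def etaFamily (M : EpisodicMDP S A) (F : QESATables S A → S → ℝ) (B : ℝ) :
    DevFamily S A :=
  ⟨F, fun n i => etaW M.H i n, B, fun n => 2 * M.H / n * B⟩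

/-- Deviations of unweighted sums. -/
def oneFamily (F : QESATables S A → S → ℝ) (B : ℝ) : DevFamily S A :=
  ⟨F, fun _ _ => 1, B, fun _ => B⟩

omit [Fintype A] in
lemma etaFamily_valid {F : QESATables S A → S → ℝ} {B a b : ℝ} (hH : (1 : ℝ) ≤ M.H) (hB : 0 < B)
    (hab : b - a = B) (hF : ∀ t y, a ≤ F t y ∧ F t y ≤ b) : (etaFamily M F B).Valid where
  R_pos n hn := by
    have : (0 : ℝ) < n := by exact_mod_cast hn
    simp only [etaFamily]
    positivity
  wt_nonneg n i := etaW_nonneg hH i n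
  wt_le n i hn hi := mul_le_mul_of_nonneg_right (etaW_le hH hi hn) hB.le
  osc t y y' := (abs_sub_le_of_mem (hF t y) (hF t y')).trans_eq hab

omit [Fintype A] [Fintype S] in
lemma oneFamily_valid {F : QESATables S A → S → ℝ} {B a b : ℝ} (hB : 0 < B)
    (hab : b - a = B) (hF : ∀ t y, a ≤ F t y ∧ F t y ≤ b) : (oneFamily F B).Valid where
  R_pos _ _ := hB
  wt_nonneg _ _ := zero_le_one
  wt_le _ _ _ _ := (one_mul B).le
  osc t y y' := (abs_sub_le_of_mem (hF t y) (hF t y')).trans_eq hab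

/-- The deviations at the cell `(h, z)` which `GoodAt` controls. -/
noncomputable def goodFamilies (M : EpisodicMDP S A) (p : QESAParams) (h : ℕ) (z : S × A) :
    Fin 12 → DevFamily S A :=
  ![etaFamily M (fun _ => M.optValue (h + 1)) M.H,
    etaFamily M (fun _ y => -M.optValue (h + 1) y) M.H,
    etaFamily M (advF M h) M.H,
    etaFamily M (fun t y => -advF M h t y) M.H,
    etaFamily M (fun t y => -advF M h t y ^ 2) (M.H ^ 2),
    etaFamily M (fun t y => M.optValue (h + 1) y - setF M p h t y) p.β,
    oneFamily (fun t y => -refF M h t y) M.H,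
    oneFamily (refF M h) M.H,
    oneFamily (fun t y => -refF M h t y ^ 2) (M.H ^ 2),
    oneFamily (fun _ => optSqF M h z) (M.H ^ 2),
    oneFamily (setF M p h) (2 * M.H),
    oneFamily (fun t y => -unsF M p h t y) p.β]

lemma goodFamilies_valid [Nonempty A] (hH : (1 : ℝ) ≤ M.H) (hβ : 0 < p.β) (hβH : p.β ≤ M.H)
    {h : ℕ} (z : S × A) (i : Fin 12) : (goodFamilies M p h z i).Valid := by
  have hH0 : (0 : ℝ) < M.H := by linarith
  have hV : ∀ y, 0 ≤ M.optValue (h + 1) y ∧ M.optValue (h + 1) y ≤ M.H := fun y =>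
    ⟨EpisodicMDP.optValue_nonneg M (by omega) y, EpisodicMDP.optValue_le M (by omega) y⟩
  have hadv := advF_mem M h
  have href := refF_mem M h
  have hset := setF_mem M p hβ.le h
  have huns := unsF_mem M p hβ.le h
  have hopt : ∀ y, 0 ≤ optSqF M h z y ∧ optSqF M h z y ≤ M.H ^ 2 := fun y => by
    have := abs_sub_le_of_mem (hV y)
      ⟨EpisodicMDP.le_nextMean (M := M) (h := h) (s := z.1) (a := z.2) fun y => (hV y).1,
        EpisodicMDP.nextMean_le fun y => (hV y).2⟩
    rw [sub_zero, abs_le] at this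
    exact ⟨sq_nonneg _, sq_le_sq' this.1 this.2⟩
  have hsq : ∀ {v b : ℝ}, -b ≤ v → v ≤ b → -b ^ 2 ≤ -v ^ 2 ∧ -v ^ 2 ≤ 0 := fun h1 h2 => by
    have := sq_le_sq' h1 h2
    constructor <;> nlinarith
  have hz : ∀ v : ℝ, 0 - -v = v := fun v => by ring
  fin_cases i
  · exact etaFamily_valid hH hH0 (sub_zero _) fun _ => hV
  · exact etaFamily_valid hH hH0 (hz _) fun _ y =>
      ⟨neg_le_neg (hV y).2, neg_nonpos.mpr (hV y).1⟩
  · exact etaFamily_valid hH hH0 (hz _) hadv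
  · exact etaFamily_valid hH hH0 (sub_zero _) fun t y =>
      ⟨neg_nonneg.mpr (hadv t y).2, neg_le.mp (hadv t y).1⟩
  · exact etaFamily_valid hH (by positivity) (hz _) fun t y =>
      hsq (hadv t y).1 ((hadv t y).2.trans hH0.le)
  · exact etaFamily_valid hH hβ (hz _) fun t y =>
      ⟨by linarith [(hset t y).2], by linarith [(hset t y).1]⟩
  · exact oneFamily_valid hH0 (hz _) fun t y =>
      ⟨neg_le_neg (href t y).2, neg_nonpos.mpr (href t y).1⟩
  · exact oneFamily_valid hH0 (sub_zero _) href
  · exact oneFamily_valid (by positivity) (hz _) fun t y =>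
      hsq (by linarith [(href t y).1]) (href t y).2
  · exact oneFamily_valid (by positivity) (sub_zero _) fun _ => hopt
  · exact oneFamily_valid (by positivity) (sub_zero _) fun t y =>
      ⟨(hV y).1.trans (hset t y).1, by linarith [(hset t y).2, (hV y).2]⟩
  · exact oneFamily_valid hβ (hz _) fun t y =>
      ⟨neg_le_neg (huns t y).2, neg_nonpos.mpr (huns t y).1⟩

/-- The exponential weight of all deviations. -/
noncomputable def totalMass (M : EpisodicMDP S A) (p : QESAParams) (x : ℕ → ℕ → S)
    (d : ℕ → ℕ → S → A) : ℝ :=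
  ∑ h ∈ Icc 1 M.H, ∑ z, ∑ i, devMass M p x d h z (goodFamilies M p h z i)

lemma goodAt_of_totalMass_lt [Nonempty A] {x : ℕ → ℕ → S} {d : ℕ → ℕ → S → A}
    (ad : Admissible M p x d) (hmass : totalMass M p x d < 1) {h : ℕ} (hh : h ∈ Icc 1 M.H)
    (z : S × A) : GoodAt M p x d h z := by
  have hH := ad.one_le_H
  have hlt : ∀ i, devMass M p x d h z (goodFamilies M p h z i) < 1 := by
    intro i
    refine lt_of_le_of_lt ?_ hmass
    have h1 := single_le_sum (f := fun i => devMass M p x d h z (goodFamilies M p h z i))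
      (fun _ _ => devMass_nonneg _ _ _) (mem_univ i)
    have h2 := single_le_sum (f := fun z => ∑ i, devMass M p x d h z (goodFamilies M p h z i))
      (fun _ _ => sum_nonneg fun _ _ => devMass_nonneg _ _ _) (mem_univ z)
    have h3 := single_le_sum
      (f := fun h => ∑ z, ∑ i, devMass M p x d h z (goodFamilies M p h z i))
      (fun _ _ => sum_nonneg fun _ _ => sum_nonneg fun _ _ => devMass_nonneg _ _ _) hh
    exact h1.trans (h2.trans h3)
  have hbern := fun i k (hk : k ≤ p.K) (hn : 1 ≤ cnt (cell x d h) z k) =>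
    bernstein_of_devMass_lt (goodFamilies_valid hH ad.hβ ad.hβH z i) ad.hι (hlt i) hk hn
  have hone : ∀ (F : QESATables S A → S → ℝ) (B : ℝ), (∀ k ≤ p.K, 1 ≤ cnt (cell x d h) z k →
      ∑ j ∈ visits (cell x d h) z k, (1 : ℝ)
        * (F (tables M p x d j) (x (j + 1) (h + 1)) - M.nextMean h z.1 z.2 (F (tables M p x d j)))
      ≤ 4 * √(iota M p * ∑ j ∈ visits (cell x d h) z k, (1 : ℝ) ^ 2
            * M.nextVar h z.1 z.2 (F (tables M p x d j))) + 16 * iota M p * B) →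
      BernOne M p x d h z F B := fun F B hF k hk hn => by simpa using hF k hk hn
  exact
    { opt_pos := hbern 0
      opt_neg := hbern 1
      adv_pos := hbern 2
      adv_neg := hbern 3
      adv_sq := hbern 4
      set_eta := hbern 5
      ref_neg := hone _ _ (hbern 6)
      ref_pos := hone _ _ (hbern 7)
      ref_sq := hone _ _ (hbern 8)
      opt_sq := hone _ _ (hbern 9)
      set_one := hone _ _ (hbern 10)
      uns := hone _ _ (hbern 11) }

end good

/-! ### The expected regret -/

section regret
variable {Ω : Type*} [mΩ : MeasurableSpace Ω] {μ : Measure Ω} [IsProbabilityMeasure μ]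
  {ℱ : Filtration ℕ mΩ} {X : ℕ → ℕ → Ω → S} {π : ℕ → Ω → ℕ → S → A}
  (hrun : IsRun M p μ ℱ X π)
include hrun

lemma IsRun.integral_totalMass_le [Nonempty A] (hH : 1 ≤ M.H) (hβ : 0 < p.β) (hβH : p.β ≤ M.H) :
    Integrable (fun ω => totalMass M p (fun j i => X j i ω) (fun j => π j ω)) μ ∧
    ∫ ω, totalMass M p (fun j i => X j i ω) (fun j => π j ω) ∂μ
      ≤ 12 * (M.H * (Fintype.card S * Fintype.card A)) * ((p.K : ℝ) ^ 2
        * Real.exp (-(4 * iota M p))) := by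
  have hH' : (1 : ℝ) ≤ M.H := by exact_mod_cast hH
  have hint := fun h (hh : h ∈ Icc 1 M.H) (z : S × A) (i : Fin 12) =>
    hrun.integrable_devMass hh z (goodFamilies M p h z i)
  refine ⟨integrable_finsetSum _ fun h hh => integrable_finsetSum _ fun z _ =>
    integrable_finsetSum _ fun i _ => hint h hh z i, ?_⟩
  unfold totalMass
  rw [integral_finsetSum _ fun h hh => integrable_finsetSum _ fun z _ =>
    integrable_finsetSum _ fun i _ => hint h hh z i]
  calc _ ≤ ∑ h ∈ Icc 1 M.H, ∑ z : S × A, ∑ i : Fin 12,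
        ((p.K : ℝ) ^ 2 * Real.exp (-(4 * iota M p))) := by
        refine sum_le_sum fun h hh => ?_
        rw [integral_finsetSum _ fun z _ => integrable_finsetSum _ fun i _ => hint h hh z i]
        refine sum_le_sum fun z _ => ?_
        rw [integral_finsetSum _ fun i _ => hint h hh z i]
        exact sum_le_sum fun i _ =>
          hrun.integral_devMass_le hh z (goodFamilies_valid hH' hβ hβH z i)
    _ = _ := by
        simp only [sum_const, card_univ, Fintype.card_prod, Nat.card_Icc, Fintype.card_fin,
          nsmul_eq_mul, Nat.add_sub_cancel]
        push_cast; ring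

/-- The regret bound in terms of `ι`. -/
theorem IsRun.integral_regret_le (hM : M.positiveGaps.Nonempty) (hK : 1 ≤ p.K) (hβ : 0 < p.β)
    (hβH : p.β ≤ M.H) (hδ : 0 < p.δ) (hδ1 : p.δ < 1) (hc : 400 ≤ p.cb) :
    ∫ ω, M.regret p.K (fun k => X k 1 ω) (fun k => π k ω) ∂μ
      ≤ 6 * M.H ^ 2 * ((Fintype.card S * Fintype.card A)
        * (256 * p.cb ^ 2 * (M.maxCondVar + p.β ^ 2 * M.H) * M.H * iota M p / M.minGap
          + 4000 * p.cb ^ 3 * M.H ^ 5 * iota M p ^ 2 / p.β)) + 12 := by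
  obtain ⟨h₀, hh₀, s₀, a₀⟩ : ∃ h ∈ Icc 1 M.H, ∃ (_ : S), Nonempty A := by
    obtain ⟨_, _, h, hh, s, a, _⟩ := hM
    exact ⟨h, hh, s, ⟨a⟩⟩
  have hH : 1 ≤ M.H := by simp only [mem_Icc] at hh₀; omega
  have hH' : (1 : ℝ) ≤ M.H := by exact_mod_cast hH
  have hA2 : (2 : ℝ) ≤ Fintype.card A := by exact_mod_cast EpisodicMDP.two_le_card M hM
  have hS1 : (1 : ℝ) ≤ Fintype.card S := by exact_mod_cast Fintype.card_pos_iff.mpr ⟨s₀⟩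
  have hK' : (1 : ℝ) ≤ p.K := by exact_mod_cast hK
  set N : ℝ := (Fintype.card S : ℝ) * Fintype.card A * (M.H * p.K) with hN
  have hHK : (1 : ℝ) ≤ M.H * p.K := one_le_mul_of_one_le_of_one_le hH' hK'
  have hSA : (2 : ℝ) ≤ Fintype.card S * Fintype.card A := by
    calc (2 : ℝ) = 1 * 2 := by norm_num
      _ ≤ _ := by gcongr
  have hN2 : 2 ≤ N := by
    calc (2 : ℝ) = 2 * 1 := by norm_num
      _ ≤ _ := by rw [hN]; gcongr
  have hNδ : N ≤ N / p.δ := le_div_self (by linarith) hδ hδ1.le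
  have hι : 1 / 2 ≤ iota M p := by
    have h1 : Real.log 2 ≤ iota M p := Real.log_le_log (by norm_num) (hN2.trans hNδ)
    linarith [Real.log_two_gt_d9]
  have hexp : Real.exp (iota M p) = N / p.δ := Real.exp_log (by positivity)
  have hlog : Real.log p.K ≤ iota M p := by
    refine Real.log_le_log (by linarith) (le_trans ?_ hNδ)
    calc (p.K : ℝ) = 1 * (1 * p.K) := by ring
      _ ≤ N := by rw [hN]; gcongr; linarith
  have had : ∀ ω, Admissible M p (fun j i => X j i ω) (fun j => π j ω) := fun ω =>
    { hH := hH
      hβ := hβ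
      hβH := hβH
      hcb := by linarith
      hι := hι
      greedy := fun k hk h hh s a => hrun.greedy k hk ω h hh s a }
  have hQ0 : 0 ≤ M.maxCondVar := by
    simp only [mem_Icc] at hh₀
    exact EpisodicMDP.nextVar_nonneg.trans
      (EpisodicMDP.nextVar_le_maxCondVar M hh₀.1 hh₀.2 s₀ (Classical.arbitrary A))
  have hΔ := EpisodicMDP.minGap_pos M hM
  set B : ℝ := 6 * M.H ^ 2 * ((Fintype.card S * Fintype.card A)
        * (256 * p.cb ^ 2 * (M.maxCondVar + p.β ^ 2 * M.H) * M.H * iota M p / M.minGap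
          + 4000 * p.cb ^ 3 * M.H ^ 5 * iota M p ^ 2 / p.β)) with hB
  have hB0 : 0 ≤ B := by positivity
  obtain ⟨_, hreg⟩ := hrun.integral_regret
  obtain ⟨hmint, hmass⟩ := hrun.integral_totalMass_le hH hβ hβH
  rw [hreg]
  -- off the good event the exponential weight is at least `1` and the regret at most `H ^ 2 * K`
  have hpoint : ∀ ω, ∑ h ∈ Icc 1 M.H, ∑ j ∈ range p.K,
      M.gap h (X (j + 1) h ω) (π (j + 1) ω h (X (j + 1) h ω))
        ≤ B + (M.H : ℝ) ^ 2 * p.K * totalMass M p (fun j i => X j i ω) (fun j => π j ω) := by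
    intro ω
    have hm0 : 0 ≤ totalMass M p (fun j i => X j i ω) (fun j => π j ω) :=
      sum_nonneg fun _ _ => sum_nonneg fun _ _ => sum_nonneg fun _ _ => devMass_nonneg _ _ _
    rcases lt_or_ge (totalMass M p (fun j i => X j i ω) (fun j => π j ω)) 1 with hlt | hge
    · have h1 := sum_gap_le (had ω) hc hlog (fun h hh z => goodAt_of_totalMass_lt (had ω) hlt hh z)
        hM
      have h2 : 0 ≤ (M.H : ℝ) ^ 2 * p.K
          * totalMass M p (fun j i => X j i ω) (fun j => π j ω) := by positivity
      exact h1.trans (by linarith)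
    · have h1 : ∑ h ∈ Icc 1 M.H, ∑ j ∈ range p.K,
          M.gap h (X (j + 1) h ω) (π (j + 1) ω h (X (j + 1) h ω)) ≤ (M.H : ℝ) ^ 2 * p.K := by
        calc _ ≤ ∑ h ∈ Icc 1 M.H, ∑ j ∈ range p.K, (M.H : ℝ) := by
              refine sum_le_sum fun h hh => sum_le_sum fun j _ => ?_
              simp only [mem_Icc] at hh
              exact EpisodicMDP.gap_le M hh.1 hh.2 _ _
          _ = _ := by
              simp only [sum_const, Nat.card_Icc, card_range, nsmul_eq_mul, Nat.add_sub_cancel]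
              ring
      have h2 : (M.H : ℝ) ^ 2 * p.K ≤ (M.H : ℝ) ^ 2 * p.K
          * totalMass M p (fun j i => X j i ω) (fun j => π j ω) :=
        le_mul_of_one_le_right (by positivity) hge
      linarith
  have hgapint : Integrable (fun ω => ∑ h ∈ Icc 1 M.H, ∑ j ∈ range p.K,
      M.gap h (X (j + 1) h ω) (π (j + 1) ω h (X (j + 1) h ω))) μ := by
    refine integrable_finsetSum _ fun h hh => integrable_finsetSum _ fun j hj => ?_
    exact (((hrun.finMeas_cell hh (by simpa using hj) le_rfl).comp
      (fun c => M.gap h c.1 c.2)).mono (ℱ.le _)).integrable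
  have hmain := integral_mono hgapint ((integrable_const B).add
    (hmint.const_mul ((M.H : ℝ) ^ 2 * p.K))) hpoint
  simp only [Pi.add_apply] at hmain
  rw [integral_add (integrable_const B) (hmint.const_mul _)] at hmain
  simp only [integral_const, probReal_univ, one_smul] at hmain
  rw [integral_const_mul] at hmain
  refine hmain.trans (add_le_add le_rfl ?_)
  -- `exp (-4 ι) = (δ / SAT) ^ 4` beats the union bound and the trivial bound `H ^ 2 * K`
  have h4 : Real.exp (-(4 * iota M p)) ≤ 1 / N ^ 4 := by
    rw [Real.exp_neg, show 4 * iota M p = ((4 : ℕ) : ℝ) * iota M p by norm_num, Real.exp_nat_mul,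
      hexp, ← one_div]
    gcongr
  calc (M.H : ℝ) ^ 2 * p.K * ∫ ω, totalMass M p (fun j i => X j i ω) (fun j => π j ω) ∂μ
      ≤ (M.H : ℝ) ^ 2 * p.K * (12 * (M.H * (Fintype.card S * Fintype.card A))
        * ((p.K : ℝ) ^ 2 * (1 / N ^ 4))) := by
        refine mul_le_mul_of_nonneg_left (hmass.trans ?_) (by positivity)
        gcongr
    _ = 12 * (((Fintype.card S * Fintype.card A) ^ 1 * (M.H * p.K) ^ 3 : ℝ) / N ^ 4) := by ring
    _ ≤ 12 * 1 := by
        refine mul_le_mul_of_nonneg_left ?_ (by norm_num)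
        rw [div_le_one (by positivity), hN, mul_pow _ _ 4]
        gcongr <;> linarith
    _ = 12 := by norm_num

end regret

end QESA

end

theorem theorem3p2 :
    -- `c₀` is universal; `c_b` is any sufficiently large constant
    ∃ c₀ : ℝ, 0 < c₀ ∧ ∀ c_b : ℝ, c₀ ≤ c_b →
    -- the constant `C` depends only on `c_b` and on the exponent `q` in `(SAT)^{-q} ≤ δ`
    ∀ q : ℕ, ∃ C : ℝ, 0 < C ∧
    ∀ (S A : Type*) [Fintype S] [Fintype A] (M : EpisodicMDP S A),
    M.positiveGaps.Nonempty →
    ∀ K : ℕ, 1 ≤ K →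
    ∀ β : ℝ, 0 < β → β ≤ M.H →
    ∀ δ : ℝ, 0 < δ → δ < 1 →
      1 / ((Fintype.card S : ℝ) * Fintype.card A * (M.H * K)) ^ q ≤ δ →
    ∀ (Ω : Type*) [mΩ : MeasurableSpace Ω] (μ : Measure Ω) [IsProbabilityMeasure μ]
      (ℱ : Filtration ℕ mΩ) (X : ℕ → ℕ → Ω → S) (π : ℕ → Ω → ℕ → S → A),
    QESA.IsRun M ⟨K, β, δ, c_b⟩ μ ℱ X π →
      Integrable (fun ω => M.regret K (fun k => X k 1 ω) (fun k => π k ω)) μ ∧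
      -- the gap-dependent regret bound
      ∫ ω, M.regret K (fun k => X k 1 ω) (fun k => π k ω) ∂μ ≤
        C * ((M.maxCondVar + β ^ 2 * M.H) * M.H ^ 3 * Fintype.card S * Fintype.card A
              * Real.log ((Fintype.card S : ℝ) * Fintype.card A * (M.H * K)) / M.minGap
            + (M.H : ℝ) ^ 7 * Fintype.card S * Fintype.card A
              * Real.log ((Fintype.card S : ℝ) * Fintype.card A * (M.H * K)) ^ 2 / β) ∧
      -- zero conditional variance and a suitable `β`: the dependence on the gap is `Δ_min^{-1/3}`
      (M.maxCondVar = 0 → β = M.H * min 1 (M.minGap ^ (1 / 3 : ℝ)) →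
        ∫ ω, M.regret K (fun k => X k 1 ω) (fun k => π k ω) ∂μ ≤
          C * ((M.H : ℝ) ^ 6 * Fintype.card S * Fintype.card A
            * Real.log ((Fintype.card S : ℝ) * Fintype.card A * (M.H * K)) ^ 2
            * max 1 (M.minGap ^ (-(1 / 3) : ℝ)))) := by
  refine ⟨400, by norm_num, fun cb hcb q => ?_⟩
  have hcb0 : 0 < cb := by linarith
  set C₁ : ℝ := 24048 * cb ^ 3 * (q + 1) ^ 2 with hC₁
  have hC₁0 : 0 < C₁ := by positivity
  refine ⟨3 * C₁, by positivity, ?_⟩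
  intro S A _ _ M hM K hK β hβ hβH δ hδ hδ1 hδq Ω _ μ _ ℱ X π hrun
  obtain ⟨hH, hS, hA⟩ : 1 ≤ M.H ∧ Nonempty S ∧ Nonempty A := by
    obtain ⟨_, _, h, hh, s, a, _⟩ := hM
    exact ⟨(Finset.mem_Icc.mp hh).1.trans (Finset.mem_Icc.mp hh).2, ⟨s⟩, ⟨a⟩⟩
  have hbound := hrun.integral_regret_le hM hK hβ hβH hδ hδ1 hcb
  have hint := hrun.integral_regret.1
  dsimp only at hbound hint
  refine ⟨hint, ?_⟩
  have hH' : (1 : ℝ) ≤ M.H := by exact_mod_cast hH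
  have hA2 : (2 : ℝ) ≤ Fintype.card A := by exact_mod_cast EpisodicMDP.two_le_card M hM
  have hS1 : (1 : ℝ) ≤ Fintype.card S := by exact_mod_cast Fintype.card_pos
  have hK' : (1 : ℝ) ≤ K := by exact_mod_cast hK
  have hSA : (2 : ℝ) ≤ Fintype.card S * Fintype.card A := by
    calc (2 : ℝ) = 1 * 2 := by norm_num
      _ ≤ _ := by gcongr
  have hHK : (1 : ℝ) ≤ M.H * K := one_le_mul_of_one_le_of_one_le hH' hK'
  have hQ0 : 0 ≤ M.maxCondVar :=
    EpisodicMDP.nextVar_nonneg.trans (EpisodicMDP.nextVar_le_maxCondVar M le_rfl hH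
      (Classical.arbitrary S) (Classical.arbitrary A))
  have hΔ := EpisodicMDP.minGap_pos M hM
  have hiota : QESA.iota M ⟨K, β, δ, cb⟩
      = Real.log ((Fintype.card S : ℝ) * Fintype.card A * (M.H * K) / δ) := rfl
  rw [hiota] at hbound
  set N : ℝ := (Fintype.card S : ℝ) * Fintype.card A * (M.H * K) with hN
  have hN2 : 2 ≤ N := by
    calc (2 : ℝ) = 2 * 1 := by norm_num
      _ ≤ _ := by rw [hN]; gcongr
  set ℓ := Real.log N with hℓ
  have hℓ2 : 1 / 2 ≤ ℓ := by
    have h1 : Real.log 2 ≤ ℓ := Real.log_le_log (by norm_num) hN2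
    linarith [Real.log_two_gt_d9]
  -- `ι` and `log (SAT)` agree up to the factor `q + 1`
  have hι0 : 0 ≤ Real.log (N / δ) := by
    refine Real.log_nonneg ?_
    rw [le_div_iff₀ hδ]; linarith
  have hι : Real.log (N / δ) ≤ (q + 1) * ℓ := by
    rw [Real.log_div (by positivity) hδ.ne']
    have h1 := Real.log_le_log (by positivity) hδq
    rw [one_div, Real.log_inv, Real.log_pow] at h1
    linarith
  set ι := Real.log (N / δ)
  set SA : ℝ := (Fintype.card S * Fintype.card A : ℝ) with hSAdef
  have hSA0 : 0 < SA := by linarith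
  set Y₁ := (M.maxCondVar + β ^ 2 * M.H) * M.H ^ 3 * SA * ℓ / M.minGap with hY₁
  set Y₂ := (M.H : ℝ) ^ 7 * SA * ℓ ^ 2 / β with hY₂
  have hY₁0 : 0 ≤ Y₁ := by positivity
  have hY₂0 : 0 ≤ Y₂ := by positivity
  have hmain : ∫ ω, M.regret K (fun k => X k 1 ω) (fun k => π k ω) ∂μ ≤ C₁ * (Y₁ + Y₂) := by
    refine hbound.trans ?_
    have hq1 : (1 : ℝ) ≤ q + 1 := by linarith [(Nat.cast_nonneg q : (0 : ℝ) ≤ q)]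
    have h1 : 6 * M.H ^ 2 * (SA * (256 * cb ^ 2 * (M.maxCondVar + β ^ 2 * M.H) * M.H * ι
          / M.minGap + 4000 * cb ^ 3 * M.H ^ 5 * ι ^ 2 / β))
        ≤ 1536 * cb ^ 2 * (q + 1) * Y₁ + 24000 * cb ^ 3 * (q + 1) ^ 2 * Y₂ := by
      calc _ ≤ 6 * M.H ^ 2 * (SA * (256 * cb ^ 2 * (M.maxCondVar + β ^ 2 * M.H) * M.H
            * ((q + 1) * ℓ) / M.minGap + 4000 * cb ^ 3 * M.H ^ 5 * ((q + 1) * ℓ) ^ 2 / β)) := by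
            gcongr
        _ = _ := by rw [hY₁, hY₂]; ring
    have h2 : 12 ≤ 48 * Y₂ := by
      have hHβ : 1 ≤ (M.H : ℝ) / β := by rw [le_div_iff₀ hβ]; linarith
      have hl2 : 1 / 4 ≤ ℓ ^ 2 := by
        calc (1 : ℝ) / 4 = (1 / 2) ^ 2 := by norm_num
          _ ≤ _ := by gcongr
      calc (12 : ℝ) = 48 * (1 * 1 * (1 / 4) * 1) := by norm_num
        _ ≤ 48 * (M.H ^ 6 * SA * ℓ ^ 2 * (M.H / β)) := by
            gcongr
            · exact one_le_pow₀ hH'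
            · linarith
        _ = 48 * Y₂ := by rw [hY₂]; ring
    have hcb3 : cb ^ 2 ≤ cb ^ 3 := pow_le_pow_right₀ (by linarith) (by norm_num)
    have hq2 : (q + 1 : ℝ) ≤ (q + 1) ^ 2 := by
      calc (q + 1 : ℝ) = (q + 1) ^ 1 := (pow_one _).symm
        _ ≤ _ := pow_le_pow_right₀ hq1 (by norm_num)
    have h3 : 1536 * cb ^ 2 * (q + 1) * Y₁ ≤ C₁ * Y₁ := by
      rw [hC₁]
      gcongr
      norm_num
    have h4 : 48 * Y₂ ≤ 48 * cb ^ 3 * (q + 1) ^ 2 * Y₂ := by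
      have h5 : (1 : ℝ) ≤ cb ^ 3 * (q + 1) ^ 2 :=
        one_le_mul_of_one_le_of_one_le (one_le_pow₀ (by linarith)) (one_le_pow₀ hq1)
      have := le_mul_of_one_le_left hY₂0 h5
      linarith
    have h6 : C₁ * (Y₁ + Y₂) = C₁ * Y₁ + (24000 * cb ^ 3 * (q + 1) ^ 2 * Y₂
        + 48 * cb ^ 3 * (q + 1) ^ 2 * Y₂) := by rw [hC₁]; ring
    linarith
  constructor
  · refine hmain.trans ?_
    have e : (M.maxCondVar + β ^ 2 * M.H) * M.H ^ 3 * Fintype.card S * Fintype.card A * ℓ / M.minGap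
        + (M.H : ℝ) ^ 7 * Fintype.card S * Fintype.card A * ℓ ^ 2 / β = Y₁ + Y₂ := by
      rw [hY₁, hY₂, hSAdef]; ring
    rw [e]
    have : 0 ≤ C₁ * (Y₁ + Y₂) := by positivity
    linarith
  · intro hQ hβeq
    set m := min 1 (M.minGap ^ (1 / 3 : ℝ)) with hm
    set W := max 1 (M.minGap ^ (-(1 / 3) : ℝ)) with hW
    have hg0 : 0 < M.minGap ^ (1 / 3 : ℝ) := Real.rpow_pos_of_pos hΔ _
    have hm0 : 0 < m := lt_min one_pos hg0
    have hW0 : 0 < W := lt_max_of_lt_left one_pos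
    have hm3 : m ^ 3 ≤ M.minGap := by
      calc m ^ 3 ≤ (M.minGap ^ (1 / 3 : ℝ)) ^ 3 := by gcongr; exact min_le_right _ _
        _ = M.minGap := by
          rw [← Real.rpow_natCast, ← Real.rpow_mul hΔ.le]; norm_num
    have hmW : 1 / m ≤ W := by
      rw [div_le_iff₀ hm0]
      rcases min_cases 1 (M.minGap ^ (1 / 3 : ℝ)) with ⟨h1, _⟩ | ⟨h1, _⟩
      · rw [hm, h1, mul_one]; exact le_max_left _ _
      · rw [hm, h1]
        calc (1 : ℝ) = M.minGap ^ (-(1 / 3) : ℝ) * M.minGap ^ (1 / 3 : ℝ) := by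
              rw [← Real.rpow_add hΔ]; norm_num
          _ ≤ _ := by gcongr; exact le_max_right _ _
    have hY₂le : Y₂ ≤ M.H ^ 6 * SA * ℓ ^ 2 * W := by
      calc Y₂ = M.H ^ 6 * SA * ℓ ^ 2 * (1 / m) := by
            rw [hY₂, hβeq]
            field_simp
        _ ≤ _ := by gcongr
    have hY₁le : Y₁ ≤ 2 * (M.H ^ 6 * SA * ℓ ^ 2 * W) := by
      have h1 : m ^ 2 / M.minGap ≤ W := by
        refine le_trans ?_ hmW
        rw [div_le_div_iff₀ hΔ hm0]
        linarith [show m ^ 2 * m = m ^ 3 by ring]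
      have h2 : ℓ ≤ 2 * ℓ ^ 2 := by
        rw [sq, ← mul_assoc]
        exact le_mul_of_one_le_left (by linarith) (by linarith)
      calc Y₁ = M.H ^ 6 * SA * ℓ * (m ^ 2 / M.minGap) := by
            rw [hY₁, hQ, hβeq]; ring
        _ ≤ M.H ^ 6 * SA * (2 * ℓ ^ 2) * W := by gcongr
        _ = _ := by ring
    refine hmain.trans ?_
    have e : (M.H : ℝ) ^ 6 * Fintype.card S * Fintype.card A * ℓ ^ 2 * W
        = M.H ^ 6 * SA * ℓ ^ 2 * W := by rw [hSAdef]; ring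
    rw [e]
    have := mul_le_mul_of_nonneg_left (add_le_add hY₁le hY₂le) hC₁0.le
    linarith
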